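/- **Conventions.** All vector spaces are over $\mathbb{C}$. $\mathsf{LCS}$ is the category of locally convex spaces (not necessarily Hausdorff) and continuous linear maps, with the symmetric monoidal structure given by the inductive tensor product $\otimes=\otimes_\iota$, i.e. the algebraic tensor product with the finest locally convex topology for which $(x,y)\mapsto x\otimes y$ is separately continuous. $D_R(z)=\{w\in\mathbb{C}: |w-z|<R\}$ and $D_\infty(z)=\mathbb{C}$. The group $S^1\ltimes\mathbb{C}$ acts on $\mathbb{C}$ by $(q,z)w=qw+z$. **Vertex algebras.** $\mathsf{grComVA}^{\mathsf{bb},\mathsf{fin}}$ is the category of commutative $\mathbb{Z}$-graded vertex algebras $V=\bigoplus_{\Delta\in\mathbb{Z}}V_\Delta$ (so $[Y(a,z),Y(b,w)]=0$ for all $a,b\in V$, $|0\rangle\in V_0$ and $a_{(n)}b\in V_{\Delta+\Delta'-n-1}$ for $a\in V_\Delta$, $b\in V_{\Delta'}$) with $V_\Delta=0$ for $\Delta\ll0$ and $\dim V_\Delta<\infty$ for all $\Delta$. Its morphisms are the linear maps that preserve the vacuum, the translation operator $T$, all products $a_{(n)}b$ and the grading. For such $V$ let $\overline V=\prod_\Delta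 V_\Delta$, with the product of the canonical topologies of the finite-dimensional spaces $V_\Delta$. It is a commutative algebra with unit $|0\rangle$ for $(ab)_\Delta=\sum_{\Delta'}(a_{\Delta'})_{(-1)}b_{\Delta-\Delta'}$, and $(q,z)\in S^1\ltimes\mathbb{C}$ acts on it by the continuous algebra automorphism $e^{zT}q^{L_0}$, where $(q^{L_0}a)_\Delta=q^\Delta a_\Delta$ and $(e^{zT}a)_\Delta=\sum_{n\ge0}\frac{z^n}{n!}T^na_{\Delta-n}$. For a morphism $f\colon V\to W$ let $\overline f\colon\overline V\to\overline W$ be $f$ in each degree. **Prefactorization algebras.** An $S^1\ltimes\mathbb{C}$-equivariant prefactorization algebra $\mathcal{F}$ on $\mathbb{C}$ consists of a functor $U\mapsto\mathcal{F}(U)$ from the open subsets of $\mathbb{C}$, ordered by inclusion, to $\mathsf{LCS}$; morphisms $\mathcal{F}(U)\otimes\mathcal{F}(V)\to\mathcal{F}(W)$ for disjoint $U,V\subset W$, which are natural, commutative and associative; a unit $\mathbb{C}\to\mathcal{F}(\varnothing)$ for these multiplications; and natural maps $\sigma_{g,U}\colon\mathcal{F}(U)\to\mathcal{F}(gU)$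 for $g\in S^1\ltimes\mathbb{C}$, with $\sigma_{gh,U}=\sigma_{g,hU}\sigma_{h,U}$ and $\sigma_{1,U}=\mathrm{id}$, compatible with the multiplications and the unit. Morphisms are families of continuous linear maps $\mathcal{F}(U)\to\mathcal{G}(U)$ that are compatible with all of this structure. * $\mathcal{F}$ is a *factorization algebra* if for every family $(U_i)_{i\in I}$ of open subsets of an open set $U$ such that each finite subset of $U$ (including $\varnothing$) is contained in some $U_i$, the diagram $\bigoplus_{i,j}\mathcal{F}(U_i\cap U_j)\rightrightarrows\bigoplus_i\mathcal{F}(U_i)\to\mathcal{F}(U)$ is a coequalizer in $\mathsf{LCS}$, and $\mathcal{F}(U)\otimes\mathcal{F}(V)\to\mathcal{F}(U\sqcup V)$ is an isomorphism in $\mathsf{LCS}$ for all disjoint $U,V$. * $\mathcal{F}$ is *locally constant* if $\mathcal{F}(D_r(z))\to\mathcal{F}(D_R(w))$ is an isomorphism in $\mathsf{LCS}$ whenever $0<r<R\le\infty$ and $D_r(z)\subset D_R(w)$. * Let $\mathcal{F}(D_R(0))_\Delta=\{a:\sigma_{(q,0)}a=q^\Delta a\ \ \forall q\in S^1\}$.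 $\mathcal{F}$ is *holomorphic* if (i) $\mathcal{F}(D_r(0))_\Delta\to\mathcal{F}(D_R(0))_\Delta$ is bijective for all $0<r<R<\infty$ and $\Delta\in\mathbb{Z}$; (ii) for each $0<R<\infty$, $\mathcal{F}(D_R(0))_\Delta=0$ for $\Delta\ll0$; (iii) $\mathcal{F}(D_R(0))$ is Hausdorff and quasi-complete for each $0<R<\infty$; (iv) for $0<R<\infty$, $l\ge1$, weights $\Delta_1,\dots,\Delta_l$ and compatible families $a_i=(a_{i,r})_{r>0}$ with $a_{i,r}\in\mathcal{F}(D_r(0))_{\Delta_i}$, the map that sends pairwise distinct points $z_1,\dots,z_l\in D_R(0)$ to the product in $\mathcal{F}(D_R(0))$ of the elements $\sigma_{(1,z_i)}a_{i,r}\in\mathcal{F}(D_r(z_i))$ (for any small $r>0$) is holomorphic: at each point $c$ of its domain it is complex differentiable, i.e. there are vectors $\xi_1,\dots,\xi_l$ with $\bigl(f(z)-f(c)-\sum_i(z_i-c_i)\xi_i\bigr)/|z-c|\to0$ as $z\to c$. $\mathsf{HolFA}^{\mathsf{loc}}_{\mathbb{C}}$ is the full subcategory of the category of $S^1\ltimes\mathbb{C}$-equivariant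 prefactorization algebras whose objects are the locally constant holomorphic factorization algebras. **The functor.** For $V\in\mathsf{grComVA}^{\mathsf{bb},\mathsf{fin}}$ let $\mathbf{F}^{\mathrm{loc}}_{\overline V}(U)=\varinjlim_L\overline V^{\otimes\pi_0(L)}$, the colimit in $\mathsf{LCS}$ over the disjoint unions $L\subset U$ of finitely many open disks of finite radius, ordered by inclusion. Here $\overline V^{\otimes\pi_0(\varnothing)}=\mathbb{C}$, and for $L\subset M$ the transition map multiplies the entries of all disks of $L$ that lie in the same disk of $M$ and puts $1$ at the disks of $M$ that contain no disk of $L$. The multiplication is induced by $\overline V^{\otimes\pi_0(L)}\otimes\overline V^{\otimes\pi_0(M)}\cong\overline V^{\otimes\pi_0(L\sqcup M)}$ for disjoint $L$ and $M$, the unit is the case $L=\varnothing$, and $(q,z)$ acts by $e^{zT}q^{L_0}$ on every tensor factor. A morphism $f$ induces $\mathbf{F}^{\mathrm{loc}}_{\overline f}$ by applying $\overline f$ to every tensor factor. **Proposition.** For every $V\in\mathsf{grComVA}^{\mathsf{bb},\mathsf{fin}}$, the $S^1\ltimes\mathbb{C}$-equivariant prefactorization algebra $\mathbf{F}^{\mathrm{loc}}_{\overline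 V}$ is a locally constant holomorphic factorization algebra, and the functor $$\mathbf{F}^{\mathrm{loc}}_{\overline{(\,\cdot\,)}}\colon\mathsf{grComVA}^{\mathsf{bb},\mathsf{fin}}\to\mathsf{HolFA}^{\mathsf{loc}}_{\mathbb{C}},\qquad V\mapsto\mathbf{F}^{\mathrm{loc}}_{\overline V},$$ is fully faithful. -/

import Mathlib

open CategoryTheory TopologicalSpace Metric

open scoped TensorProduct Topology

universe u

noncomputable section

namespace CFact

/-! ## Locally convex spaces and the inductive tensor product -/

/-- A locally convex space over `ℂ` (not assumed Hausdorff). -/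
structure LCS where
  carrier : Type u
  [addCommGroup : AddCommGroup carrier]
  [module : Module ℂ carrier]
  [topology : TopologicalSpace carrier]
  [isTopologicalAddGroup : IsTopologicalAddGroup carrier]
  [continuousSMul : ContinuousSMul ℂ carrier]
  [locallyConvex : LocallyConvexSpace ℝ carrier]

instance : CoeSort LCS.{u} (Type u) := ⟨LCS.carrier⟩

attribute [instance] LCS.addCommGroup LCS.module LCS.topology LCS.isTopologicalAddGroup
  LCS.continuousSMul LCS.locallyConvex

section FinestTopology

variable {E : Type*} [AddCommGroup E] [Module ℂ E]

/-- `t` is a locally convex vector space topology. -/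
def IsLCTopology (E : Type*) [AddCommGroup E] [Module ℂ E] (t : TopologicalSpace E) : Prop :=
  @IsTopologicalAddGroup E t _ ∧ @ContinuousSMul ℂ E _ _ t ∧ @LocallyConvexSpace ℝ E _ _ _ _ t

/-- The supremum (in the sense of fineness) of all locally convex vector space topologies with
property `P`.  For the properties `P` used below (continuity of certain maps into `E`) this is the
finest locally convex topology with property `P`. -/
abbrev finestLC (P : TopologicalSpace E → Prop) : TopologicalSpace E :=
  sInf {t | IsLCTopology E t ∧ P t}

theorem finestLC_addGroup (P : TopologicalSpace E → Prop) :
    @IsTopologicalAddGroup E (finestLC P) _ :=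
  topologicalAddGroup_sInf fun _ h => h.1.1

theorem finestLC_smul (P : TopologicalSpace E → Prop) :
    @ContinuousSMul ℂ E _ _ (finestLC P) :=
  continuousSMul_sInf fun _ h => h.1.2.1

theorem finestLC_locallyConvex (P : TopologicalSpace E → Prop) :
    @LocallyConvexSpace ℝ E _ _ _ _ (finestLC P) :=
  LocallyConvexSpace.sInf fun _ h => h.1.2.2

/-- A linear map out of `E` with the topology `finestLC P` is continuous as soon as the topology
which it induces on `E` has property `P`. -/
theorem continuous_of_finestLC {P : TopologicalSpace E → Prop} {F : Type*} [AddCommGroup F]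
    [Module ℂ F] [tF : TopologicalSpace F] [IsTopologicalAddGroup F] [ContinuousSMul ℂ F]
    [LocallyConvexSpace ℝ F] (f : E →ₗ[ℂ] F) (h : P (tF.induced f)) :
    Continuous[finestLC P, tF] f := by
  rw [continuous_iff_le_induced]
  refine sInf_le ⟨⟨topologicalAddGroup_induced f, continuousSMul_induced f, ?_⟩, h⟩
  exact LocallyConvexSpace.induced (f.restrictScalars ℝ)

end FinestTopology

/-- The inductive topology on the tensor product: the finest locally convex topology for which
`(x, y) ↦ x ⊗ y` is separately continuous. -/
abbrev inductiveTensorTopology (X Y : LCS.{u}) : TopologicalSpace (X ⊗[ℂ] Y) :=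
  finestLC fun t =>
    (∀ x : X, Continuous[_, t] fun y : Y => x ⊗ₜ[ℂ] y) ∧
    (∀ y : Y, Continuous[_, t] fun x : X => x ⊗ₜ[ℂ] y)

/-- The inductive tensor product of locally convex spaces. -/
def LCS.tensor (X Y : LCS.{u}) : LCS.{u} where
  carrier := X ⊗[ℂ] Y
  topology := inductiveTensorTopology X Y
  isTopologicalAddGroup := finestLC_addGroup _
  continuousSMul := finestLC_smul _
  locallyConvex := finestLC_locallyConvex _

/-- Pure tensors. -/
def LCS.tmul {X Y : LCS.{u}} (x : X) (y : Y) : X.tensor Y :=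
  (x ⊗ₜ[ℂ] y : X ⊗[ℂ] Y)

/-- The continuous linear map out of the inductive tensor product which is given by a separately
continuous bilinear map. -/
def LCS.tensorLift {X Y Z : LCS.{u}} (b : X →ₗ[ℂ] Y →ₗ[ℂ] Z)
    (h₁ : ∀ x, Continuous fun y => b x y) (h₂ : ∀ y, Continuous fun x => b x y) :
    X.tensor Y →L[ℂ] Z where
  toLinearMap := (TensorProduct.lift b : X ⊗[ℂ] Y →ₗ[ℂ] Z)
  cont := continuous_of_finestLC (E := X ⊗[ℂ] Y) (TensorProduct.lift b)
    ⟨fun x => continuous_induced_rng.2 (h₁ x), fun y => continuous_induced_rng.2 (h₂ y)⟩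

@[simp]
theorem LCS.tensorLift_tmul {X Y Z : LCS.{u}} (b : X →ₗ[ℂ] Y →ₗ[ℂ] Z)
    (h₁ : ∀ x, Continuous fun y => b x y) (h₂ : ∀ y, Continuous fun x => b x y) (x : X) (y : Y) :
    LCS.tensorLift b h₁ h₂ (LCS.tmul x y) = b x y :=
  TensorProduct.lift.tmul x y

/-! ## The group of orientation preserving isometries of the plane -/

/-- The group `S¹ ⋉ ℂ`; the pair `(q, z)` acts on the plane by `w ↦ q w + z`. -/
@[ext]
structure Motion where
  /-- The rotational part. -/
  rot : Circle
  /-- The translational part. -/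
  trans : ℂ

namespace Motion

instance : One Motion := ⟨⟨1, 0⟩⟩

instance : Mul Motion := ⟨fun g h => ⟨g.rot * h.rot, g.trans + g.rot * h.trans⟩⟩

instance : Inv Motion := ⟨fun g => ⟨g.rot⁻¹, -((g.rot⁻¹ : Circle) * g.trans)⟩⟩

@[simp] theorem rot_one : (1 : Motion).rot = 1 := rfl

@[simp] theorem trans_one : (1 : Motion).trans = 0 := rfl

@[simp] theorem rot_mul (g h : Motion) : (g * h).rot = g.rot * h.rot := rfl

@[simp] theorem trans_mul (g h : Motion) : (g * h).trans = g.trans + g.rot * h.trans := rfl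

@[simp] theorem rot_inv (g : Motion) : g⁻¹.rot = g.rot⁻¹ := rfl

@[simp] theorem trans_inv (g : Motion) : g⁻¹.trans = -((g.rot⁻¹ : Circle) * g.trans) := rfl

instance : Group Motion :=
  Group.ofLeftAxioms
    (fun g h k => by
      ext
      · simp [mul_assoc]
      · simp; ring)
    (fun g => by ext <;> simp)
    (fun g => by ext <;> simp)

/-- The action on points of the plane. -/
def act (g : Motion) (w : ℂ) : ℂ := g.rot * w + g.trans

theorem act_one (w : ℂ) : act 1 w = w := by simp [act]

theorem act_mul (g h : Motion) (w : ℂ) : act (g * h) w = act g (act h w) := by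
  simp [act]; ring

theorem dist_act (g : Motion) (v w : ℂ) : dist (g.act v) (g.act w) = dist v w := by
  rw [act, act, dist_add_right, dist_eq_norm, ← mul_sub, norm_mul, Circle.norm_coe, one_mul,
    ← dist_eq_norm]

theorem act_inv (g : Motion) (w : ℂ) : g.act (g⁻¹.act w) = w := by
  rw [← act_mul, mul_inv_cancel, act_one]

theorem image_ball (g : Motion) (c : ℂ) (r : ℝ) :
    g.act '' ball c r = ball (g.act c) r := by
  ext w
  constructor
  · rintro ⟨v, hv, rfl⟩
    rw [mem_ball, dist_act]; exact hv
  · intro hw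
    refine ⟨g⁻¹.act w, ?_, act_inv g w⟩
    rw [mem_ball, ← dist_act g, act_inv]; exact hw

theorem isOpen_image (g : Motion) {s : Set ℂ} (hs : IsOpen s) : IsOpen (g.act '' s) := by
  have h : g.act '' s = g⁻¹.act ⁻¹' s := by
    ext w
    constructor
    · rintro ⟨v, hv, rfl⟩
      have := act_inv g⁻¹ v
      rw [inv_inv] at this
      simpa [this] using hv
    · intro hw
      exact ⟨_, hw, act_inv g w⟩
  rw [h]
  refine hs.preimage ?_
  unfold act
  fun_prop

theorem act_injective (g : Motion) : Function.Injective g.act := fun v w h => by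
  rw [← dist_eq_zero, ← dist_act g, h, dist_self]

/-- The action on open subsets of the plane: `g U = {g w | w ∈ U}`. -/
def actOn (g : Motion) (U : Opens ℂ) : Opens ℂ := ⟨g.act '' U, g.isOpen_image U.2⟩

theorem actOn_mono (g : Motion) {U V : Opens ℂ} (h : U ≤ V) : g.actOn U ≤ g.actOn V :=
  Set.image_mono h

theorem actOn_disjoint (g : Motion) {U V : Opens ℂ} (h : Disjoint U V) :
    Disjoint (g.actOn U) (g.actOn V) := by
  rw [← Opens.coe_disjoint] at h ⊢
  exact (Set.disjoint_image_iff g.act_injective).2 h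

theorem actOn_sup (g : Motion) {U V W : Opens ℂ} (h : U ⊔ V ≤ W) :
    g.actOn U ⊔ g.actOn V ≤ g.actOn W :=
  sup_le (g.actOn_mono (le_sup_left.trans h)) (g.actOn_mono (le_sup_right.trans h))

theorem actOn_one (U : Opens ℂ) : actOn 1 U = U := by
  apply Opens.ext
  change act 1 '' (U : Set ℂ) = U
  rw [show act 1 = id from funext act_one, Set.image_id]

theorem actOn_mul (g h : Motion) (U : Opens ℂ) : actOn (g * h) U = g.actOn (h.actOn U) := by
  apply Opens.ext
  change act (g * h) '' (U : Set ℂ) = act g '' (act h '' (U : Set ℂ))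
  rw [Set.image_image]
  exact Set.image_congr fun w _ => act_mul g h w

theorem actOn_bot (g : Motion) : g.actOn ⊥ = ⊥ := by
  apply Opens.ext
  exact Set.image_empty _

end Motion

/-! ## Equivariant prefactorization algebras on the plane -/

/-- An `S¹ ⋉ ℂ`-equivariant prefactorization algebra on `ℂ` with values in locally convex spaces
with the inductive tensor product.  An equality `U = U'` of open subsets is dealt with by the
structure map `F(U) → F(U')`. -/
structure EquivPFA where
  /-- The space `F(U)`. -/
  obj : Opens ℂ → LCS.{u}
  /-- The structure map `F(U) → F(V)` for `U ⊆ V`. -/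
  res : ∀ {U V : Opens ℂ}, U ≤ V → obj U →L[ℂ] obj V
  /-- The multiplication `F(U) ⊗ F(V) → F(W)` for disjoint `U, V ⊆ W`. -/
  mul : ∀ {U V W : Opens ℂ}, Disjoint U V → U ⊔ V ≤ W → (obj U).tensor (obj V) →L[ℂ] obj W
  /-- The image of `1` under the unit `ℂ → F(∅)`. -/
  one : obj ⊥
  /-- The equivariant structure `F(U) → F(g U)`. -/
  σ : ∀ (g : Motion) (U : Opens ℂ), obj U →L[ℂ] obj (g.actOn U)
  res_self : ∀ (U : Opens ℂ) (x : obj U), res (le_refl U) x = x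
  res_res : ∀ {U V W : Opens ℂ} (h : U ≤ V) (h' : V ≤ W) (x : obj U),
    res h' (res h x) = res (h.trans h') x
  res_mul : ∀ {U₁ U₂ V W : Opens ℂ} (hd : Disjoint U₁ U₂) (h : U₁ ⊔ U₂ ≤ V) (h' : V ≤ W)
    (x : obj U₁) (y : obj U₂),
    res h' (mul hd h (LCS.tmul x y)) = mul hd (h.trans h') (LCS.tmul x y)
  mul_res : ∀ {U₁ U₂ V₁ V₂ W : Opens ℂ} (h₁ : U₁ ≤ V₁) (h₂ : U₂ ≤ V₂) (hd : Disjoint V₁ V₂)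
    (h : V₁ ⊔ V₂ ≤ W) (x : obj U₁) (y : obj U₂),
    mul hd h (LCS.tmul (res h₁ x) (res h₂ y)) =
      mul (hd.mono h₁ h₂) ((sup_le_sup h₁ h₂).trans h) (LCS.tmul x y)
  mul_comm : ∀ {U₁ U₂ V : Opens ℂ} (hd : Disjoint U₁ U₂) (h : U₁ ⊔ U₂ ≤ V) (h' : U₂ ⊔ U₁ ≤ V)
    (x : obj U₁) (y : obj U₂),
    mul hd.symm h' (LCS.tmul y x) = mul hd h (LCS.tmul x y)
  mul_assoc : ∀ {U₁ U₂ U₃ V₁ V₂ W : Opens ℂ} (hd₁ : Disjoint U₁ U₂) (h₁ : U₁ ⊔ U₂ ≤ V₁)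
    (hd₂ : Disjoint U₂ U₃) (h₂ : U₂ ⊔ U₃ ≤ V₂) (hd₃ : Disjoint U₁ V₂) (h₃ : U₁ ⊔ V₂ ≤ W)
    (hd₄ : Disjoint V₁ U₃) (h₄ : V₁ ⊔ U₃ ≤ W) (x : obj U₁) (y : obj U₂) (z : obj U₃),
    mul hd₄ h₄ (LCS.tmul (mul hd₁ h₁ (LCS.tmul x y)) z) =
      mul hd₃ h₃ (LCS.tmul x (mul hd₂ h₂ (LCS.tmul y z)))
  one_mul : ∀ {U : Opens ℂ} (hd : Disjoint ⊥ U) (h : ⊥ ⊔ U ≤ U) (x : obj U),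
    mul hd h (LCS.tmul one x) = x
  σ_res : ∀ (g : Motion) {U V : Opens ℂ} (h : U ≤ V) (x : obj U),
    σ g V (res h x) = res (g.actOn_mono h) (σ g U x)
  σ_mul : ∀ (g h : Motion) (U : Opens ℂ) (x : obj U),
    res (Motion.actOn_mul g h U).le (σ (g * h) U x) = σ g (h.actOn U) (σ h U x)
  σ_one : ∀ (U : Opens ℂ) (x : obj U), res (Motion.actOn_one U).le (σ 1 U x) = x
  σ_mul_mul : ∀ (g : Motion) {U V W : Opens ℂ} (hd : Disjoint U V) (h : U ⊔ V ≤ W)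
    (x : obj U) (y : obj V),
    σ g W (mul hd h (LCS.tmul x y)) =
      mul (g.actOn_disjoint hd) (g.actOn_sup h) (LCS.tmul (σ g U x) (σ g V y))
  σ_unit : ∀ (g : Motion), res g.actOn_bot.le (σ g ⊥ one) = one

namespace EquivPFA

/-- A morphism of `S¹ ⋉ ℂ`-equivariant prefactorization algebras. -/
@[ext]
structure Hom (F G : EquivPFA.{u}) where
  /-- The component at an open subset. -/
  app : ∀ U : Opens ℂ, F.obj U →L[ℂ] G.obj U
  app_res : ∀ {U V : Opens ℂ} (h : U ≤ V) (x : F.obj U), G.res h (app U x) = app V (F.res h x)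
  app_mul : ∀ {U V W : Opens ℂ} (hd : Disjoint U V) (h : U ⊔ V ≤ W) (x : F.obj U) (y : F.obj V),
    app W (F.mul hd h (LCS.tmul x y)) = G.mul hd h (LCS.tmul (app U x) (app V y))
  app_one : app ⊥ F.one = G.one
  app_σ : ∀ (g : Motion) (U : Opens ℂ) (x : F.obj U),
    G.σ g U (app U x) = app (g.actOn U) (F.σ g U x)

instance : Category EquivPFA.{u} where
  Hom := Hom
  id F :=
    { app := fun U => ContinuousLinearMap.id ℂ (F.obj U)
      app_res := fun _ _ => rfl
      app_mul := fun _ _ _ _ => rfl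
      app_one := rfl
      app_σ := fun _ _ _ => rfl }
  comp φ ψ :=
    { app := fun U => (ψ.app U).comp (φ.app U)
      app_res := fun h x => by simp [φ.app_res, ψ.app_res]
      app_mul := fun hd h x y => by simp [φ.app_mul, ψ.app_mul]
      app_one := by simp [φ.app_one, ψ.app_one]
      app_σ := fun g U x => by simp [φ.app_σ, ψ.app_σ] }

/-! ### Factorization algebras and local constancy -/

/-- A family of open subsets of `U` such that every finite subset of `U` is contained in one of
its members. -/
def IsWeissCover {I : Type} (U : Opens ℂ) (𝒰 : I → Opens ℂ) : Prop :=
  (∀ i, 𝒰 i ≤ U) ∧ ∀ s : Set ℂ, s.Finite → s ⊆ U → ∃ i, s ⊆ 𝒰 i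

/-- The factorization algebra axioms.  The first one is the universal property of the coequalizer
of `⨁ F(Uᵢ ∩ Uⱼ) ⇉ ⨁ F(Uᵢ)` in the category of locally convex spaces. -/
structure IsFactorizationAlgebra (F : EquivPFA.{u}) : Prop where
  descent : ∀ (U : Opens ℂ) {I : Type} (𝒰 : I → Opens ℂ) (h𝒰 : IsWeissCover U 𝒰) (E : LCS.{u})
    (f : ∀ i, F.obj (𝒰 i) →L[ℂ] E),
    (∀ (i j : I) (x : F.obj (𝒰 i ⊓ 𝒰 j)),
      f i (F.res inf_le_left x) = f j (F.res inf_le_right x)) →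
    ∃! g : F.obj U →L[ℂ] E, ∀ (i : I) (x : F.obj (𝒰 i)), g (F.res (h𝒰.1 i) x) = f i x
  mul_iso : ∀ (U V : Opens ℂ) (hd : Disjoint U V),
    IsHomeomorph (F.mul hd (le_refl (U ⊔ V)))

/-- The open disk. -/
def disk (z : ℂ) (r : ℝ) : Opens ℂ := ⟨ball z r, isOpen_ball⟩

/-- Local constancy: `F(D_r(z)) → F(D_R(w))` is an isomorphism whenever `D_r(z) ⊆ D_R(w)` and
`0 < r < R ≤ ∞`, where `D_∞(w) = ℂ`. -/
structure IsLocallyConstant (F : EquivPFA.{u}) : Prop where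
  finite_radius : ∀ (r R : ℝ) (z w : ℂ) (h : disk z r ≤ disk w R), 0 < r → r < R →
    IsHomeomorph (F.res h)
  infinite_radius : ∀ (r : ℝ) (z : ℂ), 0 < r →
    IsHomeomorph (F.res (le_top : disk z r ≤ ⊤))

/-! ### Holomorphic prefactorization algebras -/

/-- The rotation by `q` about the origin. -/
def rotation (q : Circle) : Motion := ⟨q, 0⟩

/-- The translation by `z`. -/
def translation (z : ℂ) : Motion := ⟨1, z⟩

theorem rotation_disk (q : Circle) (R : ℝ) : (rotation q).actOn (disk 0 R) = disk 0 R := by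
  apply Opens.ext
  change (rotation q).act '' ball 0 R = ball 0 R
  rw [Motion.image_ball]
  simp [Motion.act, rotation]

/-- The action of `q ∈ S¹` on `F(D_R(0))`. -/
def rotate (F : EquivPFA.{u}) (R : ℝ) (q : Circle) : F.obj (disk 0 R) →L[ℂ] F.obj (disk 0 R) :=
  (F.res (rotation_disk q R).le).comp (F.σ (rotation q) (disk 0 R))

/-- The weight space `F(D_R(0))_Δ`. -/
def weightSpace (F : EquivPFA.{u}) (R : ℝ) (Δ : ℤ) : Set (F.obj (disk 0 R)) :=
  {a | ∀ q : Circle, F.rotate R q a = ((q : ℂ) ^ Δ) • a}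

theorem disk_mono {r R : ℝ} (h : r ≤ R) (z : ℂ) : disk z r ≤ disk z R := ball_subset_ball h

/-- An element of weight `Δ` of the costalk at the origin: a compatible family of elements of
`F(D_R(0))_Δ`, for `R > 0`. -/
structure CostalkWeight (F : EquivPFA.{u}) (Δ : ℤ) where
  /-- The components of the family. -/
  val : ∀ R : ℝ, 0 < R → F.obj (disk 0 R)
  mem : ∀ (R : ℝ) (hR : 0 < R), val R hR ∈ F.weightSpace R Δ
  compat : ∀ (r R : ℝ) (hr : 0 < r) (h : r < R),
    F.res (disk_mono h.le 0) (val r hr) = val R (hr.trans h)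

/-- The multiplication `F(U₀) ⊗ ⋯ ⊗ F(Uₙ) → F(V)` for pairwise disjoint `U₀, …, Uₙ ⊆ V`, evaluated
on pure tensors; it is defined by iterating the binary multiplication. -/
def nary (F : EquivPFA.{u}) : ∀ (n : ℕ) (U : Fin (n + 1) → Opens ℂ)
    (_ : _root_.Pairwise fun i j => Disjoint (U i) (U j)) (V : Opens ℂ) (_ : ∀ i, U i ≤ V),
    (∀ i, F.obj (U i)) → F.obj V
  | 0, _, _, _, h, a => F.res (h 0) (a 0)
  | n + 1, U, hd, _, h, a =>
    F.mul (U := ⨆ i : Fin (n + 1), U i.castSucc) (V := U (Fin.last (n + 1)))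
      (iSup_disjoint_iff.2 fun i => hd (Fin.castSucc_lt_last i).ne)
      (sup_le (iSup_le fun i => h i.castSucc) (h _))
      (LCS.tmul
        (F.nary n (fun i => U i.castSucc)
          (fun _ _ hij => hd fun e => hij (Fin.castSucc_injective _ e)) _
          (fun i => le_iSup (fun i : Fin (n + 1) => U i.castSucc) i) (fun i => a i.castSucc))
        (a (Fin.last (n + 1))))

/-- The set of tuples of pairwise different points of the disk `D_R(0)`. -/
def conf (n : ℕ) (R : ℝ) : Set (Fin n → ℂ) :=
  {z | (∀ i, z i ∈ ball (0 : ℂ) R) ∧ _root_.Pairwise fun i j => z i ≠ z j}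

/-- The radius `r` is small enough that `D_r(z₁), …, D_r(z_n)` are pairwise disjoint subsets of
`D_R(0)`; here `D_r(zᵢ)` is written as the translate of `D_r(0)` by `zᵢ`. -/
def Admissible {n : ℕ} (R : ℝ) (z : Fin n → ℂ) (r : ℝ) : Prop :=
  0 < r ∧
  (_root_.Pairwise fun i j =>
    Disjoint ((translation (z i)).actOn (disk 0 r)) ((translation (z j)).actOn (disk 0 r))) ∧
  ∀ i, (translation (z i)).actOn (disk 0 r) ≤ disk 0 R

theorem translation_disk (z : ℂ) (r : ℝ) : (translation z).actOn (disk 0 r) = disk z r := by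
  apply Opens.ext
  change (translation z).act '' ball 0 r = ball z r
  rw [Motion.image_ball]
  simp [Motion.act, translation]

theorem exists_admissible {n : ℕ} {R : ℝ} {z : Fin n → ℂ} (hz : z ∈ conf n R) :
    ∃ r, Admissible R z r := by
  have h : ∀ᶠ r : ℝ in 𝓝[>] 0, Admissible R z r := by
    simp only [Admissible, translation_disk, _root_.Pairwise]
    refine Filter.Eventually.and self_mem_nhdsWithin (Filter.Eventually.and ?_ ?_)
    · simp only [Filter.eventually_all]
      intro i j hij
      have hpos : 0 < dist (z i) (z j) / 2 := half_pos (dist_pos.2 (hz.2 hij))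
      filter_upwards [Ioo_mem_nhdsGT hpos] with r hr
      rw [← Opens.coe_disjoint]
      exact ball_disjoint_ball (by linarith [hr.2])
    · rw [Filter.eventually_all]
      intro i
      have hi := hz.1 i
      rw [mem_ball] at hi
      filter_upwards [Ioo_mem_nhdsGT (sub_pos.2 hi)] with r hr
      exact ball_subset_ball' (by linarith [hr.2])
  exact h.exists

/-- The element `μ^R_{z₀, …, z_n}(a₀ ⊗ ⋯ ⊗ a_n)` of `F(D_R(0))`, for pairwise different points
`z₀, …, z_n` of `D_R(0)` and homogeneous `a₀, …, a_n` in the costalk at the origin: translate `aᵢ`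
to a small disk about `zᵢ` and multiply.  The result does not depend on the small radius. -/
def mu (F : EquivPFA.{u}) {n : ℕ} {Δ : Fin (n + 1) → ℤ} (a : ∀ i, F.CostalkWeight (Δ i)) (R : ℝ)
    (z : Fin (n + 1) → ℂ) (hz : z ∈ conf (n + 1) R) : F.obj (disk 0 R) :=
  have hr := (exists_admissible hz).choose_spec
  F.nary n (fun i => (translation (z i)).actOn (disk 0 (exists_admissible hz).choose)) hr.2.1
    (disk 0 R) hr.2.2
    (fun i => F.σ (translation (z i)) (disk 0 (exists_admissible hz).choose) ((a i).val _ hr.1))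

/-- Holomorphy of a function on a subset `U` of `ℂⁿ` with values in a locally convex space: at each
point `a` of `U` there are `ξ₁, …, ξ_n` such that
`(f z - f a - ∑ᵢ (zᵢ - aᵢ) ξᵢ) / |z - a| → 0` as `z → a` in `U ∖ {a}`. -/
def IsHolomorphicOn {n : ℕ} (U : Set (Fin n → ℂ)) {E : LCS.{u}} (f : ∀ z ∈ U, E) : Prop :=
  ∀ (a : Fin n → ℂ) (ha : a ∈ U), ∃ ξ : Fin n → E,
    Filter.Tendsto
      (fun z : U =>
        ((Real.sqrt (∑ i, ‖z.1 i - a i‖ ^ 2) : ℝ) : ℂ)⁻¹ •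
          (f z.1 z.2 - f a ha - ∑ i, (z.1 i - a i) • ξ i))
      (𝓝[≠] (⟨a, ha⟩ : U)) (𝓝 0)

/-- Holomorphic prefactorization algebras. -/
structure IsHolomorphic (F : EquivPFA.{u}) : Prop where
  weight_iso : ∀ (r R : ℝ) (_ : 0 < r) (h : r < R) (Δ : ℤ),
    Set.BijOn (F.res (disk_mono h.le 0)) (F.weightSpace r Δ) (F.weightSpace R Δ)
  weight_bounded : ∀ R : ℝ, 0 < R → ∃ N : ℤ, ∀ Δ < N, F.weightSpace R Δ = {0}
  quasiComplete : ∀ R : ℝ, 0 < R →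
    @QuasiCompleteSpace ℂ (F.obj (disk 0 R)) _ (IsTopologicalAddGroup.rightUniformSpace _) _ _
  hausdorff : ∀ R : ℝ, 0 < R → T2Space (F.obj (disk 0 R))
  holomorphic : ∀ R : ℝ, 0 < R → ∀ (n : ℕ) (Δ : Fin (n + 1) → ℤ) (a : ∀ i, F.CostalkWeight (Δ i)),
    IsHolomorphicOn (conf (n + 1) R) (F.mu a R)

/-- Locally constant holomorphic factorization algebras. -/
def IsLocHolFA : ObjectProperty EquivPFA.{u} := fun F =>
  F.IsFactorizationAlgebra ∧ F.IsLocallyConstant ∧ F.IsHolomorphic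

end EquivPFA

/-! ## The locally constant prefactorization algebra of a commutative algebra -/

/-- A commutative algebra with a locally convex topology for which the multiplication is
separately continuous, together with an action of `S¹ ⋉ ℂ` by continuous algebra automorphisms. -/
structure MotionAlg where
  carrier : Type u
  [commRing : CommRing carrier]
  [algebra : Algebra ℂ carrier]
  [topology : TopologicalSpace carrier]
  [isTopologicalAddGroup : IsTopologicalAddGroup carrier]
  [continuousSMul : ContinuousSMul ℂ carrier]
  [locallyConvex : LocallyConvexSpace ℝ carrier]
  continuous_mul : ∀ a : carrier, Continuous fun b : carrier => a * b
  /-- The action. -/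
  θ : Motion → carrier →ₐ[ℂ] carrier
  θ_one : θ 1 = AlgHom.id ℂ carrier
  θ_mul : ∀ g h, θ (g * h) = (θ g).comp (θ h)
  continuous_θ : ∀ g, Continuous (θ g)

instance : CoeSort MotionAlg.{u} (Type u) := ⟨MotionAlg.carrier⟩

attribute [instance] MotionAlg.commRing MotionAlg.algebra MotionAlg.topology
  MotionAlg.isTopologicalAddGroup MotionAlg.continuousSMul MotionAlg.locallyConvex

/-- Equivariant continuous algebra homomorphisms. -/
@[ext]
structure MotionAlg.Hom (A B : MotionAlg.{u}) where
  /-- The underlying algebra homomorphism. -/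
  hom : A →ₐ[ℂ] B
  continuous_hom : Continuous hom
  hom_θ : ∀ g a, hom (A.θ g a) = B.θ g (hom a)

/-! ### Tensor powers -/

/-- The tensor power `⨂_{i ∈ ι} A`, as a commutative algebra. -/
def TPow (ι : Type) (A : Type u) [CommRing A] [Algebra ℂ A] : Type u := ⨂[ℂ] _ : ι, A

namespace TPow

theorem prod_update {ι κ : Type} {A : Type u} [CommRing A] [Fintype ι] [DecidableEq κ]
    [DecidableEq ι] (p : ι → κ) (a : ι → A) (i : ι) (x : A) :
    (fun j => ∏ i' with p i' = j, Function.update a i x i') =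
      Function.update (fun j => ∏ i' with p i' = j, a i') (p i)
        ((∏ i' ∈ ({i' | p i' = p i} : Finset ι).erase i, a i') * x) := by
  funext j
  by_cases h : j = p i
  · subst h
    rw [Function.update_self,
      ← Finset.prod_erase_mul _ _ (show i ∈ ({i' | p i' = p i} : Finset ι) by simp),
      Function.update_self]
    congr 1
    refine Finset.prod_congr rfl fun k hk => ?_
    rw [Function.update_of_ne (Finset.ne_of_mem_erase hk)]
  · rw [Function.update_of_ne h]
    refine Finset.prod_congr rfl fun k hk => ?_
    rw [Function.update_of_ne]
    rintro rfl
    simp only [Finset.mem_filter, Finset.mem_univ, true_and] at hk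
    exact h hk.symm

section

variable {ι κ μ : Type} {A B C : Type u} [CommRing A] [Algebra ℂ A] [CommRing B] [Algebra ℂ B]
  [CommRing C] [Algebra ℂ C]

instance : CommRing (TPow ι A) := inferInstanceAs (CommRing (⨂[ℂ] _ : ι, A))

instance : Algebra ℂ (TPow ι A) := inferInstanceAs (Algebra ℂ (⨂[ℂ] _ : ι, A))

/-- The pure tensor `⨂ᵢ aᵢ`. -/
def tprod : MultilinearMap ℂ (fun _ : ι => A) (TPow ι A) := PiTensorProduct.tprod ℂ

theorem tprod_mul (a b : ι → A) : tprod a * tprod b = tprod (a * b) :=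
  PiTensorProduct.tprod_mul_tprod a b

theorem tprod_one : tprod (1 : ι → A) = 1 := rfl

/-- Linear maps out of the tensor power. -/
def lift {E : Type*} [AddCommGroup E] [Module ℂ E] (f : MultilinearMap ℂ (fun _ : ι => A) E) :
    TPow ι A →ₗ[ℂ] E :=
  PiTensorProduct.lift f

@[simp]
theorem lift_tprod {E : Type*} [AddCommGroup E] [Module ℂ E]
    (f : MultilinearMap ℂ (fun _ : ι => A) E) (a : ι → A) : lift f (tprod a) = f a :=
  PiTensorProduct.lift.tprod a

theorem hom_ext {E : Type*} [AddCommGroup E] [Module ℂ E] {f g : TPow ι A →ₗ[ℂ] E}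
    (h : ∀ a : ι → A, f (tprod a) = g (tprod a)) : f = g :=
  PiTensorProduct.ext (MultilinearMap.ext h)

theorem induction {P : TPow ι A → Prop} (h₀ : ∀ a, P (tprod a)) (h₁ : ∀ x y, P x → P y → P (x + y))
    (h₂ : ∀ (c : ℂ) x, P x → P (c • x)) (x : TPow ι A) : P x := by
  refine PiTensorProduct.induction_on (R := ℂ) (s := fun _ : ι => A) (motive := P) x ?_ h₁
  intro r a
  exact h₂ r _ (h₀ a)

variable [Fintype ι] [DecidableEq κ]

theorem tprod_prod_update [DecidableEq ι] (p : ι → κ) (θ : A →ₐ[ℂ] B) (a : ι → A) (i : ι) (x : A) :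
    (tprod fun j => ∏ i' with p i' = j, θ (Function.update a i x i')) =
      tprod (Function.update (fun j => ∏ i' with p i' = j, θ (a i')) (p i)
        ((∏ i' ∈ ({i' | p i' = p i} : Finset ι).erase i, θ (a i')) * θ x)) := by
  rw [← prod_update p (fun i' => θ (a i')) i (θ x)]
  congr 1
  funext j
  refine Finset.prod_congr rfl fun k _ => ?_
  exact Function.apply_update (fun _ => θ) a i x k

/-- The multilinear map underlying `push`. -/
def pushMultilinear (p : ι → κ) (θ : A →ₐ[ℂ] B) :
    MultilinearMap ℂ (fun _ : ι => A) (TPow κ B) where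
  toFun a := tprod fun j => ∏ i with p i = j, θ (a i)
  map_update_add' := by
    intro _ a i x y
    simp only [tprod_prod_update, map_add, mul_add, MultilinearMap.map_update_add]
  map_update_smul' := by
    intro _ a i c x
    simp only [tprod_prod_update, map_smul, mul_smul_comm, MultilinearMap.map_update_smul]

/-- The algebra homomorphism `⨂ᵢ aᵢ ↦ ⨂ⱼ ∏_{i : p i = j} θ aᵢ`. -/
def push (p : ι → κ) (θ : A →ₐ[ℂ] B) : TPow ι A →ₐ[ℂ] TPow κ B :=
  AlgHom.ofLinearMap (lift (pushMultilinear p θ))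
    (by
      rw [← tprod_one, lift_tprod, ← tprod_one]
      change tprod _ = tprod _
      simp only [Pi.one_apply, map_one, Finset.prod_const_one]
      rfl)
    (by
      intro x y
      induction x using TPow.induction with
      | h₁ x x' hx hx' => rw [add_mul, map_add, hx, hx', map_add, add_mul]
      | h₂ c x hx => rw [smul_mul_assoc, map_smul, hx, map_smul, smul_mul_assoc]
      | h₀ a =>
        induction y using TPow.induction with
        | h₁ x x' hx hx' => rw [mul_add, map_add, hx, hx', map_add, mul_add]
        | h₂ c x hx => rw [mul_smul_comm, map_smul, hx, map_smul, mul_smul_comm]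
        | h₀ b =>
          rw [tprod_mul]
          simp only [lift_tprod]
          change tprod _ = tprod _ * tprod _
          rw [tprod_mul]
          congr 1
          funext j
          simp only [Pi.mul_apply, map_mul, Finset.prod_mul_distrib])

@[simp]
theorem push_tprod (p : ι → κ) (θ : A →ₐ[ℂ] B) (a : ι → A) :
    push p θ (tprod a) = tprod fun j => ∏ i with p i = j, θ (a i) :=
  lift_tprod _ _

theorem push_push [Fintype κ] [DecidableEq μ] (p : ι → κ) (θ : A →ₐ[ℂ] B) (p' : κ → μ)
    (θ' : B →ₐ[ℂ] C) (x : TPow ι A) :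
    push p' θ' (push p θ x) = push (fun i => p' (p i)) (θ'.comp θ) x := by
  induction x using TPow.induction with
  | h₁ x x' hx hx' => simp only [map_add, hx, hx']
  | h₂ c x hx => simp only [map_smul, hx]
  | h₀ a =>
    simp only [push_tprod, map_prod, AlgHom.comp_apply]
    congr 1
    funext k
    rw [← Finset.prod_fiberwise_of_maps_to (s := ({i | p' (p i) = k} : Finset ι))
      (t := ({j | p' j = k} : Finset κ)) (g := p) (by simp)]
    refine Finset.prod_congr rfl fun j hj => Finset.prod_congr ?_ fun _ _ => rfl
    ext i
    simp only [Finset.mem_filter, Finset.mem_univ, true_and] at hj ⊢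
    exact ⟨fun h => ⟨h ▸ hj, h⟩, fun h => h.2⟩

theorem push_id [DecidableEq ι] (x : TPow ι A) : push (fun i : ι => i) (AlgHom.id ℂ A) x = x := by
  induction x using TPow.induction with
  | h₁ x x' hx hx' => simp only [map_add, hx, hx']
  | h₂ c x hx => simp only [map_smul, hx]
  | h₀ a =>
    rw [push_tprod]
    congr 1
    funext j
    simp [Finset.filter_eq']

end

/-! The topology of a tensor power -/

section

variable {ι κ : Type} {A B : MotionAlg.{u}}

open Classical in
/-- The topology of the iterated inductive tensor product: the finest locally convex topology on
`⨂_{i ∈ ι} A` for which `(aᵢ) ↦ ⨂ᵢ aᵢ` is separately continuous. -/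
instance instTopology : TopologicalSpace (TPow ι A) :=
  finestLC fun t => ∀ (i : ι) (a : ι → A),
    Continuous[_, t] fun x : A => (tprod (Function.update a i x) : TPow ι A)

instance : IsTopologicalAddGroup (TPow ι A) := finestLC_addGroup _

instance : ContinuousSMul ℂ (TPow ι A) := finestLC_smul _

instance : LocallyConvexSpace ℝ (TPow ι A) := finestLC_locallyConvex _

theorem continuous_tprod_update [DecidableEq ι] (i : ι) (a : ι → A) :
    Continuous fun x : A => (tprod (Function.update a i x) : TPow ι A) := by
  classical
  refine continuous_sInf_rng.2 fun t ht => ?_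
  convert ht.2 i a

theorem continuous_of_tprod {E : Type*} [AddCommGroup E] [Module ℂ E] [TopologicalSpace E]
    [IsTopologicalAddGroup E] [ContinuousSMul ℂ E] [LocallyConvexSpace ℝ E] (f : TPow ι A →ₗ[ℂ] E)
    (h : ∀ [DecidableEq ι] (i : ι) (a : ι → A),
      Continuous fun x : A => f (tprod (Function.update a i x))) : Continuous f := by
  classical
  exact continuous_of_finestLC f fun i a => continuous_induced_rng.2 (h i a)

theorem continuous_mul_right (y : TPow ι A) : Continuous fun x : TPow ι A => x * y := by
  induction y using TPow.induction with
  | h₁ x x' hx hx' => simp only [mul_add]; exact hx.add hx'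
  | h₂ c x hx => simp only [mul_smul_comm]; exact hx.const_smul c
  | h₀ b =>
    refine continuous_of_tprod ((LinearMap.mul ℂ (TPow ι A)).flip (tprod b)) fun i a => ?_
    have : (fun x : A => (LinearMap.mul ℂ (TPow ι A)).flip (tprod b) (tprod (Function.update a i x)))
        = fun x : A => tprod (Function.update (a * b) i (b i * x)) := by
      funext x
      rw [LinearMap.flip_apply, LinearMap.mul_apply', tprod_mul]
      congr 1
      funext j
      by_cases h : j = i
      · subst h; simp [mul_comm]
      · simp [h]
    rw [this]
    exact (continuous_tprod_update i (a * b)).comp (A.continuous_mul (b i))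

theorem continuous_push [Fintype ι] [DecidableEq κ] (p : ι → κ) (θ : A →ₐ[ℂ] B)
    (hθ : Continuous θ) : Continuous (push p θ) := by
  refine continuous_of_tprod (push p θ).toLinearMap fun i a => ?_
  simp only [AlgHom.toLinearMap_apply, push_tprod, tprod_prod_update]
  exact (continuous_tprod_update (p i) _).comp ((B.continuous_mul _).comp hθ)

end

end TPow

/-! ### Finite disjoint unions of disks -/

/-- A finite set of pairwise disjoint open disks, given by their centers and radii. -/
@[ext]
structure DiskConfig where
  /-- The pairs (center, radius). -/
  disks : Finset (ℂ × ℝ)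
  radius_pos : ∀ d ∈ disks, 0 < d.2
  disjoint : ∀ d ∈ disks, ∀ e ∈ disks, d ≠ e → Disjoint (ball d.1 d.2) (ball e.1 e.2)

namespace DiskConfig

/-- The union of the disks. -/
def support (L : DiskConfig) : Opens ℂ :=
  ⟨⋃ d ∈ L.disks, ball d.1 d.2, isOpen_biUnion fun _ _ => isOpen_ball⟩

theorem mem_support {L : DiskConfig} {w : ℂ} :
    w ∈ L.support ↔ ∃ d ∈ L.disks, w ∈ ball d.1 d.2 := by
  change w ∈ ⋃ d ∈ L.disks, ball d.1 d.2 ↔ _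
  simp

theorem ball_subset (L : DiskConfig) (d : L.disks) : ball d.1.1 d.1.2 ⊆ L.support :=
  fun _ hw => mem_support.2 ⟨d.1, d.2, hw⟩

theorem center_mem (L : DiskConfig) (d : L.disks) : d.1.1 ∈ ball d.1.1 d.1.2 :=
  mem_ball_self (L.radius_pos _ d.2)

/-- Configurations are ordered by inclusion of the unions. -/
instance : Preorder DiskConfig := Preorder.lift support

theorem le_def {L M : DiskConfig} : L ≤ M ↔ L.support ≤ M.support := Iff.rfl

theorem exists_parent {L M : DiskConfig} (h : L ≤ M) (d : L.disks) :
    ∃ e : M.disks, ball d.1.1 d.1.2 ⊆ ball e.1.1 e.1.2 := by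
  obtain ⟨e, he, hde⟩ := mem_support.1 (h (L.ball_subset d (L.center_mem d)))
  refine ⟨⟨e, he⟩, ?_⟩
  have hconn : IsPreconnected (ball d.1.1 d.1.2) := (convex_ball _ _).isPreconnected
  refine hconn.subset_left_of_subset_union isOpen_ball
    (v := ⋃ e' ∈ M.disks.erase e, ball e'.1 e'.2) (isOpen_biUnion fun _ _ => isOpen_ball) ?_ ?_
    ⟨d.1.1, L.center_mem d, hde⟩
  · refine Set.disjoint_iUnion₂_right.2 fun e' he' => ?_
    exact M.disjoint e he e' (Finset.mem_of_mem_erase he') (Finset.ne_of_mem_erase he').symm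
  · intro w hw
    obtain ⟨e', he', hwe'⟩ := mem_support.1 (h (L.ball_subset d hw))
    by_cases hee : e' = e
    · subst hee; exact Or.inl hwe'
    · exact Or.inr (Set.mem_biUnion (Finset.mem_erase.2 ⟨hee, he'⟩) hwe')

/-- The disk of `M` which contains a given disk of `L`. -/
def parent {L M : DiskConfig} (h : L ≤ M) (d : L.disks) : M.disks := (exists_parent h d).choose

theorem subset_parent {L M : DiskConfig} (h : L ≤ M) (d : L.disks) :
    ball d.1.1 d.1.2 ⊆ ball (parent h d).1.1 (parent h d).1.2 := (exists_parent h d).choose_spec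

theorem eq_of_mem {M : DiskConfig} {e e' : M.disks} {w : ℂ} (h : w ∈ ball e.1.1 e.1.2)
    (h' : w ∈ ball e'.1.1 e'.1.2) : e = e' := by
  by_contra hne
  exact Set.disjoint_left.1 (M.disjoint e.1 e.2 e'.1 e'.2 fun hh => hne (Subtype.ext hh)) h h'

theorem parent_eq {L M : DiskConfig} (h : L ≤ M) (d : L.disks) {e : M.disks}
    (he : d.1.1 ∈ ball e.1.1 e.1.2) : parent h d = e :=
  eq_of_mem (subset_parent h d (L.center_mem d)) he

theorem parent_self {L : DiskConfig} (h : L ≤ L) (d : L.disks) : parent h d = d :=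
  parent_eq h d (L.center_mem d)

theorem parent_parent {L M N : DiskConfig} (h : L ≤ M) (h' : M ≤ N) (d : L.disks) :
    parent h' (parent h d) = parent (h.trans h') d :=
  (parent_eq _ d (subset_parent h' _ (subset_parent h d (L.center_mem d)))).symm

/-- The empty configuration. -/
def empty : DiskConfig := ⟨∅, by simp, by simp⟩

theorem empty_le (U : Opens ℂ) : empty.support ≤ U := by
  intro w hw
  obtain ⟨d, hd, _⟩ := mem_support.1 hw
  simp [empty] at hd

open Classical in
/-- The union of two configurations with disjoint supports. -/
def union (L M : DiskConfig) (h : Disjoint L.support M.support) : DiskConfig where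
  disks := L.disks ∪ M.disks
  radius_pos d hd := (Finset.mem_union.1 hd).elim (L.radius_pos d) (M.radius_pos d)
  disjoint d hd e he hne := by
    rw [← Opens.coe_disjoint] at h
    rcases Finset.mem_union.1 hd with hd | hd <;> rcases Finset.mem_union.1 he with he | he
    · exact L.disjoint d hd e he hne
    · exact h.mono (L.ball_subset ⟨d, hd⟩) (M.ball_subset ⟨e, he⟩)
    · exact (h.mono (L.ball_subset ⟨e, he⟩) (M.ball_subset ⟨d, hd⟩)).symm
    · exact M.disjoint d hd e he hne

theorem support_union (L M : DiskConfig) (h : Disjoint L.support M.support) :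
    (L.union M h).support = L.support ⊔ M.support := by
  ext w
  change w ∈ (L.union M h).support ↔ w ∈ L.support ∨ w ∈ M.support
  simp only [mem_support, union, Finset.mem_union]
  constructor
  · rintro ⟨d, hd | hd, hw⟩
    · exact Or.inl ⟨d, hd, hw⟩
    · exact Or.inr ⟨d, hd, hw⟩
  · rintro (⟨d, hd, hw⟩ | ⟨d, hd, hw⟩)
    · exact ⟨d, Or.inl hd, hw⟩
    · exact ⟨d, Or.inr hd, hw⟩

theorem left_le_union (L M : DiskConfig) (h : Disjoint L.support M.support) : L ≤ L.union M h := by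
  rw [le_def, support_union]; exact le_sup_left

theorem right_le_union (L M : DiskConfig) (h : Disjoint L.support M.support) : M ≤ L.union M h := by
  rw [le_def, support_union]; exact le_sup_right

open Classical in
/-- The image of a configuration under a motion of the plane. -/
def move (g : Motion) (L : DiskConfig) : DiskConfig where
  disks := L.disks.image fun d => (g.act d.1, d.2)
  radius_pos d hd := by
    obtain ⟨e, he, rfl⟩ := Finset.mem_image.1 hd
    exact L.radius_pos e he
  disjoint d hd e he hne := by
    obtain ⟨d', hd', rfl⟩ := Finset.mem_image.1 hd
    obtain ⟨e', he', rfl⟩ := Finset.mem_image.1 he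
    simp only [← Motion.image_ball]
    rw [Set.disjoint_image_iff g.act_injective]
    exact L.disjoint d' hd' e' he' fun h => hne (by rw [h])

/-- The image of a disk of the configuration. -/
def moveDisk (g : Motion) {L : DiskConfig} (d : L.disks) : (L.move g).disks :=
  ⟨(g.act d.1.1, d.1.2), Finset.mem_image_of_mem _ d.2⟩

theorem support_move (g : Motion) (L : DiskConfig) : (L.move g).support = g.actOn L.support := by
  ext w
  change w ∈ (L.move g).support ↔ w ∈ g.act '' L.support
  constructor
  · intro hw
    obtain ⟨d, hd, hwd⟩ := mem_support.1 hw
    obtain ⟨e, he, rfl⟩ := Finset.mem_image.1 hd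
    simp only [← Motion.image_ball] at hwd
    obtain ⟨v, hv, rfl⟩ := hwd
    exact ⟨v, mem_support.2 ⟨e, he, hv⟩, rfl⟩
  · rintro ⟨v, hv, rfl⟩
    obtain ⟨e, he, hve⟩ := mem_support.1 hv
    refine mem_support.2 ⟨_, Finset.mem_image_of_mem _ he, ?_⟩
    simp only [← Motion.image_ball]
    exact ⟨v, hve, rfl⟩

theorem move_mono (g : Motion) {L M : DiskConfig} (h : L ≤ M) : L.move g ≤ M.move g := by
  rw [le_def, support_move, support_move]; exact g.actOn_mono h

theorem move_le (g : Motion) {L : DiskConfig} {U : Opens ℂ} (h : L.support ≤ U) :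
    (L.move g).support ≤ g.actOn U := by
  rw [support_move]; exact g.actOn_mono h

theorem parent_moveDisk (g : Motion) {L M : DiskConfig} (h : L ≤ M) (d : L.disks) :
    parent (move_mono g h) (moveDisk g d) = moveDisk g (parent h d) := by
  refine parent_eq _ _ ?_
  have h := Set.mem_image_of_mem g.act (subset_parent h d (L.center_mem d))
  rw [Motion.image_ball] at h
  exact h

end DiskConfig

/-! ### The extension from disjoint unions of disks to all open subsets -/

namespace MotionAlg

open DiskConfig

variable (A B : MotionAlg.{u})

open Classical in
/-- For `L ⊆ M`, the map `F(L) → F(M)`, where `F(L)` is the tensor power of `A` over the set of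
disks of `L`; it multiplies the entries of all disks which lie in the same disk of `M`. -/
def ext {L M : DiskConfig} (h : L ≤ M) : TPow L.disks A →ₐ[ℂ] TPow M.disks A :=
  TPow.push (parent h) (AlgHom.id ℂ A)

theorem ext_self {L : DiskConfig} (h : L ≤ L) (x : TPow L.disks A) : A.ext h x = x := by
  have h' : parent h = fun d : L.disks => d := funext fun d => parent_self h d
  rw [ext, h', TPow.push_id]

theorem ext_ext {L M N : DiskConfig} (h : L ≤ M) (h' : M ≤ N) (x : TPow L.disks A) :
    A.ext h' (A.ext h x) = A.ext (h.trans h') x := by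
  rw [ext, ext, TPow.push_push, ext]
  congr 1
  congr 1
  funext d
  exact parent_parent h h' d

theorem continuous_ext {L M : DiskConfig} (h : L ≤ M) : Continuous (A.ext h) :=
  TPow.continuous_push _ _ continuous_id

/-- The disjoint unions of finitely many disks that are contained in `U`. -/
abbrev Basis (U : Opens ℂ) : Type := {L : DiskConfig // L.support ≤ U}

open Classical in
/-- The vector space `colim F(L)`, where `L` runs through the finite disjoint unions of disks that
are contained in `U`. -/
def Colim (U : Opens ℂ) : Type u :=
  Module.DirectLimit (R := ℂ) (fun L : Basis U => TPow L.1.disks A)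
    (fun _ _ h => (A.ext h).toLinearMap)

variable {A B} {U V W : Opens ℂ}

namespace Colim

open Classical in
instance : AddCommGroup (A.Colim U) :=
  Module.DirectLimit.addCommGroup (R := ℂ) (fun L : Basis U => TPow L.1.disks A)
    (fun _ _ h => (A.ext h).toLinearMap)

open Classical in
instance : Module ℂ (A.Colim U) :=
  Module.DirectLimit.module (R := ℂ) (G := fun L : Basis U => TPow L.1.disks A)
    (fun _ _ h => (A.ext h).toLinearMap)

open Classical in
/-- The canonical map `F(L) → colim F(L)`. -/
def inc (L : DiskConfig) (h : L.support ≤ U) : TPow L.disks A →ₗ[ℂ] A.Colim U :=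
  Module.DirectLimit.of ℂ (Basis U) (fun L : Basis U => TPow L.1.disks A)
    (fun _ _ h => (A.ext h).toLinearMap) ⟨L, h⟩

theorem inc_ext {L M : DiskConfig} (h : L ≤ M) (hM : M.support ≤ U) (x : TPow L.disks A) :
    inc M hM (A.ext h x) = inc (U := U) L (le_trans (le_def.1 h) hM) x := by
  classical
  exact Module.DirectLimit.of_f (R := ℂ) (G := fun L : Basis U => TPow L.1.disks A)
    (f := fun _ _ h => (A.ext h).toLinearMap) (i := ⟨L, le_trans (le_def.1 h) hM⟩)
    (j := ⟨M, hM⟩) (hij := h)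

variable {E : Type*} [AddCommGroup E] [Module ℂ E]

open Classical in
/-- The universal property of the colimit. -/
def lift (f : ∀ L : DiskConfig, L.support ≤ U → TPow L.disks A →ₗ[ℂ] E)
    (hf : ∀ (L M : DiskConfig) (h : L ≤ M) (hL : L.support ≤ U) (hM : M.support ≤ U) x,
      f M hM (A.ext h x) = f L hL x) : A.Colim U →ₗ[ℂ] E :=
  Module.DirectLimit.lift ℂ (Basis U) (fun L : Basis U => TPow L.1.disks A)
    (fun _ _ h => (A.ext h).toLinearMap) (fun L => f L.1 L.2) (fun L M h x => hf L.1 M.1 h L.2 M.2 x)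

@[simp]
theorem lift_inc (f : ∀ L : DiskConfig, L.support ≤ U → TPow L.disks A →ₗ[ℂ] E)
    (hf : ∀ (L M : DiskConfig) (h : L ≤ M) (hL : L.support ≤ U) (hM : M.support ≤ U) x,
      f M hM (A.ext h x) = f L hL x) (L : DiskConfig) (hL : L.support ≤ U) (x : TPow L.disks A) :
    lift f hf (inc L hL x) = f L hL x := by
  classical
  exact Module.DirectLimit.lift_of (R := ℂ) (G := fun L : Basis U => TPow L.1.disks A)
    (f := fun _ _ h => (A.ext h).toLinearMap) (i := ⟨L, hL⟩) (fun L : Basis U => f L.1 L.2)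
    (fun L M h x => hf L.1 M.1 h L.2 M.2 x) x

theorem hom_ext {f g : A.Colim U →ₗ[ℂ] E} (h : ∀ L hL x, f (inc L hL x) = g (inc L hL x)) :
    f = g := by
  classical
  exact Module.DirectLimit.hom_ext (R := ℂ) (G := fun L : Basis U => TPow L.1.disks A)
    (f := fun _ _ h => (A.ext h).toLinearMap) fun L => LinearMap.ext fun x => h L.1 L.2 x

theorem induction {P : A.Colim U → Prop} (h₀ : ∀ L hL x, P (inc L hL x))
    (h₁ : ∀ x y, P x → P y → P (x + y)) (x : A.Colim U) : P x := by
  classical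
  have h0 : P 0 := by simpa using h₀ empty (empty_le U) 0
  refine Quotient.inductionOn' x fun z => ?_
  refine DirectSum.induction_on z h0 (fun L x => h₀ L.1 L.2 x) fun x y hx hy => h₁ _ _ hx hy

/-- The locally convex inductive limit topology: the finest locally convex topology for which all
maps `F(L) → colim F(L)` are continuous. -/
instance : TopologicalSpace (A.Colim U) :=
  finestLC fun t => ∀ (L : DiskConfig) (hL : L.support ≤ U), Continuous[_, t] (inc (A := A) L hL)

instance : IsTopologicalAddGroup (A.Colim U) := finestLC_addGroup _

instance : ContinuousSMul ℂ (A.Colim U) := finestLC_smul _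

instance : LocallyConvexSpace ℝ (A.Colim U) := finestLC_locallyConvex _

theorem continuous_inc (L : DiskConfig) (hL : L.support ≤ U) :
    Continuous (inc (A := A) (U := U) L hL) :=
  continuous_sInf_rng.2 fun _ ht => ht.2 L hL

theorem continuous_of_inc [TopologicalSpace E] [IsTopologicalAddGroup E] [ContinuousSMul ℂ E]
    [LocallyConvexSpace ℝ E] (f : A.Colim U →ₗ[ℂ] E)
    (h : ∀ L hL, Continuous fun x => f (inc L hL x)) : Continuous f :=
  continuous_of_finestLC f fun L hL => continuous_induced_rng.2 (h L hL)

/-- The colimit as a locally convex space. -/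
abbrev toLCS (A : MotionAlg.{u}) (U : Opens ℂ) : LCS.{u} := ⟨A.Colim U⟩

/-- The universal property of the colimit in locally convex spaces. -/
def liftL [TopologicalSpace E] [IsTopologicalAddGroup E] [ContinuousSMul ℂ E]
    [LocallyConvexSpace ℝ E] (f : ∀ L : DiskConfig, L.support ≤ U → TPow L.disks A →ₗ[ℂ] E)
    (hf : ∀ (L M : DiskConfig) (h : L ≤ M) (hL : L.support ≤ U) (hM : M.support ≤ U) x,
      f M hM (A.ext h x) = f L hL x) (hc : ∀ L hL, Continuous (f L hL)) : A.Colim U →L[ℂ] E :=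
  ⟨lift f hf, continuous_of_inc (lift f hf) fun L hL => by simpa only [lift_inc] using hc L hL⟩

@[simp]
theorem liftL_inc [TopologicalSpace E] [IsTopologicalAddGroup E] [ContinuousSMul ℂ E]
    [LocallyConvexSpace ℝ E] (f : ∀ L : DiskConfig, L.support ≤ U → TPow L.disks A →ₗ[ℂ] E)
    (hf : ∀ (L M : DiskConfig) (h : L ≤ M) (hL : L.support ≤ U) (hM : M.support ≤ U) x,
      f M hM (A.ext h x) = f L hL x) (hc : ∀ L hL, Continuous (f L hL))
    (L : DiskConfig) (hL : L.support ≤ U) (x : TPow L.disks A) :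
    liftL f hf hc (inc L hL x) = f L hL x :=
  lift_inc f hf L hL x

/-- The structure map for `U ⊆ V`. -/
def res (h : U ≤ V) : A.Colim U →L[ℂ] A.Colim V :=
  liftL (fun L hL => inc L (hL.trans h)) (fun _ _ h' _ _ x => inc_ext h' _ x)
    fun L _ => continuous_inc L _

@[simp]
theorem res_inc (h : U ≤ V) (L : DiskConfig) (hL : L.support ≤ U) (x : TPow L.disks A) :
    res h (inc L hL x) = inc L (hL.trans h) x :=
  liftL_inc _ _ _ L hL x

/-- The product of `x ∈ F(L)` and `y ∈ F(M)` in `F(N)`, for `L ⊔ M ⊆ N`: the entries of all disks of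
`L` and `M` which lie in the same disk of `N` are multiplied.  For `N = L ⊔ M` this is the canonical
isomorphism `F(L) ⊗ F(M) ≅ F(L ⊔ M)`. -/
def basisMul {L M N : DiskConfig} (hL : L ≤ N) (hM : M ≤ N) :
    TPow L.disks A →ₗ[ℂ] TPow M.disks A →ₗ[ℂ] TPow N.disks A :=
  (LinearMap.mul ℂ (TPow N.disks A)).compl₁₂ (A.ext hL).toLinearMap (A.ext hM).toLinearMap

theorem basisMul_apply {L M N : DiskConfig} (hL : L ≤ N) (hM : M ≤ N) (x : TPow L.disks A)
    (y : TPow M.disks A) : basisMul hL hM x y = A.ext hL x * A.ext hM y := rfl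

theorem disjoint_support {L M : DiskConfig} (hd : Disjoint U V) (hL : L.support ≤ U)
    (hM : M.support ≤ V) : Disjoint L.support M.support := hd.mono hL hM

theorem union_le {L M : DiskConfig} (hd : Disjoint L.support M.support) (h : U ⊔ V ≤ W)
    (hL : L.support ≤ U) (hM : M.support ≤ V) : (L.union M hd).support ≤ W := by
  rw [support_union]; exact (sup_le_sup hL hM).trans h

/-- The composition `F(L) ⊗ F(M) → F(L ⊔ M) → colim F`. -/
def mulInc (hd : Disjoint U V) (h : U ⊔ V ≤ W) (L : DiskConfig) (hL : L.support ≤ U)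
    (M : DiskConfig) (hM : M.support ≤ V) :
    TPow L.disks A →ₗ[ℂ] TPow M.disks A →ₗ[ℂ] A.Colim W :=
  (basisMul (left_le_union L M (disjoint_support hd hL hM))
    (right_le_union L M (disjoint_support hd hL hM))).compr₂
      (inc _ (union_le (disjoint_support hd hL hM) h hL hM))

theorem inc_basisMul (hd : Disjoint U V) (h : U ⊔ V ≤ W) {L M N : DiskConfig}
    (hL : L.support ≤ U) (hM : M.support ≤ V) (hLN : L ≤ N) (hMN : M ≤ N) (hN : N.support ≤ W)
    (x : TPow L.disks A) (y : TPow M.disks A) :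
    mulInc hd h L hL M hM x y = inc N hN (A.ext hLN x * A.ext hMN y) := by
  have hle : L.union M (disjoint_support hd hL hM) ≤ N := by
    rw [le_def, support_union]; exact sup_le hLN hMN
  rw [mulInc, LinearMap.compr₂_apply, basisMul_apply, ← inc_ext hle hN, map_mul, ext_ext, ext_ext]

/-- The bilinear multiplication `colim F(L) × colim F(M) → colim F(N)`, where `L ⊆ U`, `M ⊆ V`,
`N ⊆ W`. -/
def mulBilin (hd : Disjoint U V) (h : U ⊔ V ≤ W) : A.Colim U →ₗ[ℂ] A.Colim V →ₗ[ℂ] A.Colim W :=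
  lift
    (fun L hL =>
      (lift (fun M hM => (mulInc hd h L hL M hM).flip) (by
        intro M M' hMM hM hM' y
        refine LinearMap.ext fun x => ?_
        simp only [LinearMap.flip_apply]
        rw [inc_basisMul hd h hL hM (left_le_union L M' (disjoint_support hd hL hM'))
          (hMM.trans (right_le_union L M' (disjoint_support hd hL hM')))
          (union_le _ h hL hM'), mulInc, LinearMap.compr₂_apply, basisMul_apply, ext_ext])).flip)
    (by
      intro L L' hLL hL hL' x
      refine hom_ext fun M hM y => ?_
      simp only [LinearMap.flip_apply, lift_inc]
      rw [inc_basisMul hd h hL hM (hLL.trans (left_le_union L' M (disjoint_support hd hL' hM)))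
          (right_le_union L' M (disjoint_support hd hL' hM))
          (union_le _ h hL' hM), mulInc, LinearMap.compr₂_apply, basisMul_apply, ext_ext])

theorem mulBilin_inc (hd : Disjoint U V) (h : U ⊔ V ≤ W) (L : DiskConfig) (hL : L.support ≤ U)
    (M : DiskConfig) (hM : M.support ≤ V) (x : TPow L.disks A) (y : TPow M.disks A) :
    mulBilin hd h (inc L hL x) (inc M hM y) = mulInc hd h L hL M hM x y := by
  simp [mulBilin]

theorem mulBilin_inc' (hd : Disjoint U V) (h : U ⊔ V ≤ W) {L M N : DiskConfig}
    (hL : L.support ≤ U) (hM : M.support ≤ V) (hLN : L ≤ N) (hMN : M ≤ N) (hN : N.support ≤ W)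
    (x : TPow L.disks A) (y : TPow M.disks A) :
    mulBilin hd h (inc L hL x) (inc M hM y) = inc N hN (A.ext hLN x * A.ext hMN y) := by
  rw [mulBilin_inc, inc_basisMul hd h hL hM hLN hMN hN]

theorem mulBilin_comm (hd : Disjoint U V) (h : U ⊔ V ≤ W) (h' : V ⊔ U ≤ W) (x : A.Colim U)
    (y : A.Colim V) : mulBilin hd.symm h' y x = mulBilin hd h x y := by
  induction x using Colim.induction with
  | h₁ x x' hx hx' => simp only [map_add, LinearMap.add_apply, hx, hx']
  | h₀ L hL x =>
    induction y using Colim.induction with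
    | h₁ y y' hy hy' => simp only [map_add, LinearMap.add_apply, hy, hy']
    | h₀ M hM y =>
      have hLM := disjoint_support hd hL hM
      rw [mulBilin_inc' hd h hL hM (left_le_union L M hLM) (right_le_union L M hLM)
          (union_le hLM h hL hM),
        mulBilin_inc' hd.symm h' hM hL (right_le_union L M hLM) (left_le_union L M hLM)
          (union_le hLM h hL hM), mul_comm]

theorem continuous_mulBilin_left (hd : Disjoint U V) (h : U ⊔ V ≤ W) (y : A.Colim V) :
    Continuous fun x : A.Colim U => mulBilin hd h x y := by
  induction y using Colim.induction with
  | h₁ y y' hy hy' => simp only [map_add]; exact hy.add hy'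
  | h₀ M hM y =>
    refine continuous_of_inc ((mulBilin hd h).flip (inc M hM y)) fun L hL => ?_
    simp only [LinearMap.flip_apply, mulBilin_inc, mulInc, LinearMap.compr₂_apply, basisMul_apply]
    exact (continuous_inc _ _).comp ((TPow.continuous_mul_right _).comp (A.continuous_ext _))

theorem continuous_mulBilin_right (hd : Disjoint U V) (h : U ⊔ V ≤ W) (x : A.Colim U) :
    Continuous fun y : A.Colim V => mulBilin hd h x y := by
  have h' : V ⊔ U ≤ W := by rwa [sup_comm]
  simp only [← mulBilin_comm hd h h']
  exact continuous_mulBilin_left hd.symm h' x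

open Classical in
/-- The map `F(L) → F(g L)`: apply the automorphism `θ g` of `A` at every disk. -/
def basisMove (g : Motion) (L : DiskConfig) : TPow L.disks A →ₐ[ℂ] TPow (L.move g).disks A :=
  TPow.push (moveDisk g) (A.θ g)

theorem basisMove_ext (g : Motion) {L M : DiskConfig} (h : L ≤ M) (x : TPow L.disks A) :
    basisMove g M (A.ext h x) = A.ext (move_mono g h) (basisMove g L x) := by
  rw [basisMove, basisMove, ext, ext, TPow.push_push, TPow.push_push]
  have h' : (fun d => moveDisk g (parent h d)) = fun d => parent (move_mono g h) (moveDisk g d) :=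
    funext fun d => (parent_moveDisk g h d).symm
  rw [h']
  rfl

theorem basisMove_compat (g : Motion) (L M : DiskConfig) (h : L ≤ M) (hL : L.support ≤ U)
    (hM : M.support ≤ U) (x : TPow L.disks A) :
    (inc (M.move g) (move_le g hM) ∘ₗ (basisMove g M).toLinearMap) (A.ext h x) =
      (inc (L.move g) (move_le g hL) ∘ₗ (basisMove g L).toLinearMap) x := by
  simp only [LinearMap.comp_apply, AlgHom.toLinearMap_apply]
  rw [basisMove_ext, inc_ext]

/-- The action of a motion, `colim_{L ⊆ U} F(L) → colim_{M ⊆ g U} F(M)`. -/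
def move (g : Motion) (U : Opens ℂ) : A.Colim U →L[ℂ] A.Colim (g.actOn U) :=
  liftL (fun L hL => inc (L.move g) (move_le g hL) ∘ₗ (basisMove g L).toLinearMap)
    (basisMove_compat g)
    (fun _ _ => (continuous_inc _ _).comp (TPow.continuous_push _ _ (A.continuous_θ g)))

@[simp]
theorem move_inc (g : Motion) (L : DiskConfig) (hL : L.support ≤ U) (x : TPow L.disks A) :
    move g U (inc L hL x) = inc (L.move g) (move_le g hL) (basisMove g L x) :=
  liftL_inc _ _ _ L hL x

open Classical in
/-- The map `F_A(L) → F_B(L)` induced by a homomorphism of algebras. -/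
def basisMap (f : MotionAlg.Hom A B) (L : DiskConfig) : TPow L.disks A →ₐ[ℂ] TPow L.disks B :=
  TPow.push (fun d => d) f.hom

theorem basisMap_ext (f : MotionAlg.Hom A B) {L M : DiskConfig} (h : L ≤ M)
    (x : TPow L.disks A) : basisMap f M (A.ext h x) = B.ext h (basisMap f L x) := by
  rw [basisMap, basisMap, ext, ext, TPow.push_push, TPow.push_push]
  rfl

theorem basisMap_compat (f : MotionAlg.Hom A B) (L M : DiskConfig) (h : L ≤ M)
    (hL : L.support ≤ U) (hM : M.support ≤ U) (x : TPow L.disks A) :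
    (inc M hM ∘ₗ (basisMap f M).toLinearMap) (A.ext h x) =
      (inc L hL ∘ₗ (basisMap f L).toLinearMap) x := by
  simp only [LinearMap.comp_apply, AlgHom.toLinearMap_apply]
  rw [basisMap_ext, inc_ext]

/-- The map induced by a homomorphism of algebras. -/
def map (f : MotionAlg.Hom A B) (U : Opens ℂ) : A.Colim U →L[ℂ] B.Colim U :=
  liftL (fun L hL => inc L hL ∘ₗ (basisMap f L).toLinearMap) (basisMap_compat f)
    (fun _ _ => (continuous_inc _ _).comp (TPow.continuous_push _ _ f.continuous_hom))

@[simp]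
theorem map_inc (f : MotionAlg.Hom A B) (L : DiskConfig) (hL : L.support ≤ U)
    (x : TPow L.disks A) : map f U (inc L hL x) = inc L hL (basisMap f L x) :=
  liftL_inc _ _ _ L hL x

end Colim

end MotionAlg

namespace MotionAlg

open DiskConfig Colim

namespace Colim

variable {A B : MotionAlg.{u}} {U V W : Opens ℂ}

/-- Elements of the colimit with the same support can be compared at one configuration. -/
theorem inc_eq_of_support {L M : DiskConfig} (h : L ≤ M) (hL : L.support ≤ U)
    (hM : M.support ≤ U) {x : TPow L.disks A} {y : TPow M.disks A} (e : A.ext h x = y) :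
    inc (U := U) L hL x = inc M hM y := by
  rw [← e, inc_ext]

theorem support_triple {L M N : DiskConfig} (h : Disjoint L.support M.support)
    (h' : Disjoint (L.union M h).support N.support) :
    ((L.union M h).union N h').support = L.support ⊔ M.support ⊔ N.support := by
  rw [support_union, support_union]

theorem move_mulBilin (g : Motion) (hd : Disjoint U V) (h : U ⊔ V ≤ W) (x : A.Colim U)
    (y : A.Colim V) :
    move g W (mulBilin hd h x y) =
      mulBilin (g.actOn_disjoint hd) (g.actOn_sup h) (move g U x) (move g V y) := by
  induction x using Colim.induction with
  | h₁ x x' hx hx' => simp only [map_add, LinearMap.add_apply, hx, hx']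
  | h₀ L hL x =>
    induction y using Colim.induction with
    | h₁ y y' hy hy' => simp only [map_add, hy, hy']
    | h₀ M hM y =>
      have hLM := disjoint_support hd hL hM
      rw [mulBilin_inc' hd h hL hM (left_le_union L M hLM) (right_le_union L M hLM)
          (union_le hLM h hL hM), move_inc, move_inc, move_inc,
        mulBilin_inc' (N := (L.union M hLM).move g) _ _ _ _
          (move_mono g (left_le_union L M hLM)) (move_mono g (right_le_union L M hLM))
          (move_le g (union_le hLM h hL hM)), map_mul, basisMove_ext, basisMove_ext]

theorem mulBilin_assoc {U₁ U₂ U₃ V₁ V₂ : Opens ℂ} (hd₁ : Disjoint U₁ U₂)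
    (h₁ : U₁ ⊔ U₂ ≤ V₁) (hd₂ : Disjoint U₂ U₃) (h₂ : U₂ ⊔ U₃ ≤ V₂) (hd₃ : Disjoint U₁ V₂)
    (h₃ : U₁ ⊔ V₂ ≤ W) (hd₄ : Disjoint V₁ U₃) (h₄ : V₁ ⊔ U₃ ≤ W) (x : A.Colim U₁)
    (y : A.Colim U₂) (z : A.Colim U₃) :
    mulBilin hd₄ h₄ (mulBilin hd₁ h₁ x y) z = mulBilin hd₃ h₃ x (mulBilin hd₂ h₂ y z) := by
  induction x using Colim.induction with
  | h₁ x x' hx hx' => simp only [map_add, LinearMap.add_apply, hx, hx']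
  | h₀ L hL x =>
  induction y using Colim.induction with
  | h₁ y y' hy hy' => simp only [map_add, LinearMap.add_apply, hy, hy']
  | h₀ M hM y =>
  induction z using Colim.induction with
  | h₁ z z' hz hz' => simp only [map_add, hz, hz']
  | h₀ N hN z =>
    have hLM := disjoint_support hd₁ hL hM
    have hMN := disjoint_support hd₂ hM hN
    have hLMN := disjoint_support hd₄ (union_le hLM h₁ hL hM) hN
    have a := left_le_union (L.union M hLM) N hLMN
    have b := right_le_union (L.union M hLM) N hLMN
    have hP : ((L.union M hLM).union N hLMN).support ≤ W :=
      union_le hLMN h₄ (union_le hLM h₁ hL hM) hN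
    have hMN' : M.union N hMN ≤ (L.union M hLM).union N hLMN := by
      rw [le_def, support_union]
      exact sup_le ((right_le_union L M hLM).trans a) b
    rw [mulBilin_inc' hd₁ h₁ hL hM (left_le_union L M hLM) (right_le_union L M hLM)
        (union_le hLM h₁ hL hM),
      mulBilin_inc' hd₂ h₂ hM hN (left_le_union M N hMN) (right_le_union M N hMN)
        (union_le hMN h₂ hM hN),
      mulBilin_inc' hd₄ h₄ _ hN a b hP,
      mulBilin_inc' hd₃ h₃ hL _ ((left_le_union L M hLM).trans a) hMN' hP,
      map_mul (A.ext a), map_mul (A.ext hMN'), ext_ext, ext_ext, ext_ext, ext_ext, mul_assoc]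

theorem mulBilin_one {hd : Disjoint ⊥ U} (h : ⊥ ⊔ U ≤ U) (x : A.Colim U) :
    mulBilin hd h (inc empty (empty_le ⊥) 1) x = x := by
  induction x using Colim.induction with
  | h₁ x x' hx hx' => simp only [map_add, hx, hx']
  | h₀ L hL x =>
    rw [mulBilin_inc' hd h _ hL (empty_le _) le_rfl hL, map_one, one_mul, ext_self]

theorem move_one (U : Opens ℂ) (x : A.Colim U) :
    res (Motion.actOn_one U).le (move 1 U x) = x := by
  induction x using Colim.induction with
  | h₁ x x' hx hx' => simp only [map_add, hx, hx']
  | h₀ L hL x =>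
    rw [move_inc, res_inc]
    have hs : L.move 1 ≤ L := by
      rw [le_def, support_move, Motion.actOn_one]
    refine inc_eq_of_support hs _ hL ?_
    rw [basisMove, ext, TPow.push_push, A.θ_one]
    have h' : (fun d => parent hs (moveDisk 1 d)) = fun d : L.disks => d := funext fun d =>
      parent_eq hs _ (by
        change Motion.act 1 d.1.1 ∈ _
        rw [Motion.act_one]; exact L.center_mem d)
    rw [h']
    exact TPow.push_id x

theorem move_mul (g h : Motion) (U : Opens ℂ) (x : A.Colim U) :
    res (Motion.actOn_mul g h U).le (move (g * h) U x) = move g (h.actOn U) (move h U x) := by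
  induction x using Colim.induction with
  | h₁ x x' hx hx' => simp only [map_add, hx, hx']
  | h₀ L hL x =>
    rw [move_inc, res_inc, move_inc, move_inc]
    have hs : L.move (g * h) ≤ (L.move h).move g := by
      rw [le_def, support_move, support_move, support_move, Motion.actOn_mul]
    refine inc_eq_of_support hs _ _ ?_
    rw [basisMove, basisMove, basisMove, ext, TPow.push_push, TPow.push_push, A.θ_mul]
    have h' : (fun d : L.disks => parent hs (moveDisk (g * h) d)) =
        fun d => moveDisk g (moveDisk h d) := funext fun d =>
      parent_eq hs _ (by
        change Motion.act (g * h) d.1.1 ∈ ball (g.act (h.act d.1.1)) d.1.2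
        rw [Motion.act_mul]; exact mem_ball_self (L.radius_pos _ d.2))
    rw [h']
    rfl

theorem res_self (x : A.Colim U) : res (le_refl U) x = x := by
  induction x using Colim.induction with
  | h₁ x x' hx hx' => simp only [map_add, hx, hx']
  | h₀ L hL x => exact res_inc _ _ _ _

theorem res_res (h : U ≤ V) (h' : V ≤ W) (x : A.Colim U) :
    res h' (res h x) = res (h.trans h') x := by
  induction x using Colim.induction with
  | h₁ x x' hx hx' => simp only [map_add, hx, hx']
  | h₀ L hL x => simp only [res_inc]

theorem res_mulBilin {W' : Opens ℂ} (hd : Disjoint U V) (h : U ⊔ V ≤ W) (h' : W ≤ W')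
    (x : A.Colim U) (y : A.Colim V) :
    res h' (mulBilin hd h x y) = mulBilin hd (h.trans h') x y := by
  induction x using Colim.induction with
  | h₁ x x' hx hx' => simp only [map_add, LinearMap.add_apply, hx, hx']
  | h₀ L hL x =>
    induction y using Colim.induction with
    | h₁ y y' hy hy' => simp only [map_add, hy, hy']
    | h₀ M hM y =>
      rw [mulBilin_inc, mulBilin_inc]
      exact res_inc _ _ _ _

theorem mulBilin_res {U' V' : Opens ℂ} (h₁ : U ≤ U') (h₂ : V ≤ V') (hd : Disjoint U' V')
    (h : U' ⊔ V' ≤ W) (x : A.Colim U) (y : A.Colim V) :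
    mulBilin hd h (res h₁ x) (res h₂ y) =
      mulBilin (hd.mono h₁ h₂) ((sup_le_sup h₁ h₂).trans h) x y := by
  induction x using Colim.induction with
  | h₁ x x' hx hx' => simp only [map_add, LinearMap.add_apply, hx, hx']
  | h₀ L hL x =>
    induction y using Colim.induction with
    | h₁ y y' hy hy' => simp only [map_add, hy, hy']
    | h₀ M hM y =>
      rw [res_inc, res_inc, mulBilin_inc, mulBilin_inc]
      rfl

theorem move_res (g : Motion) (h : U ≤ V) (x : A.Colim U) :
    move g V (res h x) = res (g.actOn_mono h) (move g U x) := by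
  induction x using Colim.induction with
  | h₁ x x' hx hx' => simp only [map_add, hx, hx']
  | h₀ L hL x => simp only [res_inc, move_inc]

theorem move_unit (g : Motion) :
    res g.actOn_bot.le (move g ⊥ (inc (A := A) empty (empty_le ⊥) 1)) =
      inc empty (empty_le ⊥) 1 := by
  rw [move_inc, res_inc, map_one]
  refine (inc_eq_of_support (empty_le _) (empty_le ⊥) _ ?_).symm
  rw [map_one]

/-- The multiplication as a continuous linear map on the inductive tensor product. -/
def mulL (hd : Disjoint U V) (h : U ⊔ V ≤ W) :
    (toLCS A U).tensor (toLCS A V) →L[ℂ] toLCS A W :=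
  LCS.tensorLift (X := toLCS A U) (Y := toLCS A V) (Z := toLCS A W) (mulBilin hd h)
    (continuous_mulBilin_right hd h) (continuous_mulBilin_left hd h)

theorem mulL_tmul (hd : Disjoint U V) (h : U ⊔ V ≤ W) (x : toLCS A U) (y : toLCS A V) :
    mulL hd h (LCS.tmul x y) = mulBilin hd h x y :=
  LCS.tensorLift_tmul (X := toLCS A U) (Y := toLCS A V) (Z := toLCS A W) _ _ _ x y

theorem map_res (f : MotionAlg.Hom A B) (h : U ≤ V) (x : A.Colim U) :
    res h (map f U x) = map f V (res h x) := by
  induction x using Colim.induction with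
  | h₁ x x' hx hx' => simp only [map_add, hx, hx']
  | h₀ L hL x => simp only [res_inc, map_inc]

theorem map_mulBilin (f : MotionAlg.Hom A B) (hd : Disjoint U V) (h : U ⊔ V ≤ W) (x : A.Colim U)
    (y : A.Colim V) :
    map f W (mulBilin hd h x y) = mulBilin hd h (map f U x) (map f V y) := by
  induction x using Colim.induction with
  | h₁ x x' hx hx' => simp only [map_add, LinearMap.add_apply, hx, hx']
  | h₀ L hL x =>
    induction y using Colim.induction with
    | h₁ y y' hy hy' => simp only [map_add, hy, hy']
    | h₀ M hM y =>
      have hLM := disjoint_support hd hL hM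
      rw [mulBilin_inc' hd h hL hM (left_le_union L M hLM) (right_le_union L M hLM)
          (union_le hLM h hL hM), map_inc, map_inc, map_inc,
        mulBilin_inc' hd h hL hM (left_le_union L M hLM) (right_le_union L M hLM)
          (union_le hLM h hL hM), map_mul, basisMap_ext, basisMap_ext]

theorem map_mulL (f : MotionAlg.Hom A B) (hd : Disjoint U V) (h : U ⊔ V ≤ W) (x : toLCS A U)
    (y : toLCS A V) :
    map f W (mulL hd h (LCS.tmul x y)) =
      mulL hd h (LCS.tmul (X := toLCS B U) (Y := toLCS B V) (map f U x) (map f V y)) := by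
  rw [mulL_tmul, mulL_tmul, map_mulBilin]

theorem map_move (f : MotionAlg.Hom A B) (g : Motion) (U : Opens ℂ) (x : A.Colim U) :
    move g U (map f U x) = map f (g.actOn U) (move g U x) := by
  induction x using Colim.induction with
  | h₁ x x' hx hx' => simp only [map_add, hx, hx']
  | h₀ L hL x =>
    rw [map_inc, move_inc, move_inc, map_inc]
    congr 1
    rw [basisMove, basisMove, basisMap, basisMap, TPow.push_push, TPow.push_push]
    have : f.hom.comp (A.θ g) = (B.θ g).comp f.hom := AlgHom.ext fun a => f.hom_θ g a
    rw [this]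

end Colim

/-- The equivariant prefactorization algebra `F_A` of a commutative algebra `A` with an action of
`S¹ ⋉ ℂ`:  `F_A(U) = colim A^{⊗ disks of L}`, where `L` runs through the disjoint unions of finitely
many disks in `U`. -/
def toPFA (A : MotionAlg.{u}) : EquivPFA.{u} where
  obj U := Colim.toLCS A U
  res h := Colim.res h
  mul hd h := Colim.mulL hd h
  one := inc empty (empty_le ⊥) 1
  σ g U := Colim.move g U
  res_self U x := Colim.res_self x
  res_res h h' x := Colim.res_res h h' x
  res_mul hd h h' x y := by
    rw [mulL_tmul, mulL_tmul]; exact Colim.res_mulBilin hd h h' x y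
  mul_res h₁ h₂ hd h x y := by
    rw [mulL_tmul, mulL_tmul]; exact Colim.mulBilin_res h₁ h₂ hd h x y
  mul_comm hd h h' x y := by
    rw [mulL_tmul, mulL_tmul]; exact mulBilin_comm hd h h' x y
  mul_assoc hd₁ h₁ hd₂ h₂ hd₃ h₃ hd₄ h₄ x y z := by
    rw [mulL_tmul, mulL_tmul, mulL_tmul, mulL_tmul]
    exact mulBilin_assoc hd₁ h₁ hd₂ h₂ hd₃ h₃ hd₄ h₄ x y z
  one_mul hd h x := by
    rw [mulL_tmul]; exact mulBilin_one h x
  σ_res g U V h x := Colim.move_res g h x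
  σ_mul g h U x := Colim.move_mul g h U x
  σ_one U x := Colim.move_one U x
  σ_mul_mul g U V W hd h x y := by
    rw [mulL_tmul, mulL_tmul]; exact move_mulBilin g hd h x y
  σ_unit g := Colim.move_unit g

/-- The morphism `F_A → F_B` of equivariant prefactorization algebras induced by a continuous
equivariant homomorphism `A → B`. -/
def toPFAHom {A B : MotionAlg.{u}} (f : MotionAlg.Hom A B) : A.toPFA ⟶ B.toPFA :=
  ({ app := fun U => Colim.map f U
     app_res := fun h x => Colim.map_res f h x
     app_mul := fun hd h x y => map_mulL f hd h x y
     app_one := by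
       change Colim.map f ⊥ (inc empty (empty_le ⊥) 1) = inc empty (empty_le ⊥) 1
       rw [map_inc, map_one]
     app_σ := fun g U x => map_move f g U x } : EquivPFA.Hom A.toPFA B.toPFA)

theorem toPFAHom_id (A : MotionAlg.{u}) (f : MotionAlg.Hom A A) (hf : f.hom = AlgHom.id ℂ A) :
    toPFAHom f = 𝟙 A.toPFA := by
  refine EquivPFA.Hom.ext (funext fun U => ContinuousLinearMap.ext fun x => ?_)
  change Colim.map f U x = x
  induction x using Colim.induction with
  | h₁ x x' hx hx' => simp only [map_add, hx, hx']
  | h₀ L hL x =>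
    rw [map_inc, basisMap, hf, TPow.push_id]

theorem toPFAHom_comp {A B C : MotionAlg.{u}} (f : MotionAlg.Hom A B) (g : MotionAlg.Hom B C)
    (k : MotionAlg.Hom A C) (hk : k.hom = g.hom.comp f.hom) :
    toPFAHom k = toPFAHom f ≫ toPFAHom g := by
  refine EquivPFA.Hom.ext (funext fun U => ContinuousLinearMap.ext fun x => ?_)
  change Colim.map k U x = Colim.map g U (Colim.map f U x)
  induction x using Colim.induction with
  | h₁ x x' hx hx' => simp only [map_add, hx, hx']
  | h₀ L hL x =>
    rw [map_inc, map_inc, map_inc, basisMap, basisMap, basisMap, hk, TPow.push_push]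

end MotionAlg

/-! ## Vertex algebras -/

open scoped VertexOperator in
/-- Vertex algebras.  A field on `V` is a `VertexOperator ℂ V`, i.e. a linear map from `V` to the
space `V((z))` of Laurent series, and `(Y a)[[n]]` is the mode `a₍ₙ₎` in
`Y(a, z) = ∑ₙ a₍ₙ₎ z^(-n-1)`. -/
structure VertexAlgebra (V : Type*) [AddCommGroup V] [Module ℂ V] where
  /-- The vacuum. -/
  vac : V
  /-- The translation operator. -/
  T : V →ₗ[ℂ] V
  /-- The state-field correspondence. -/
  Y : V →ₗ[ℂ] VertexOperator ℂ V
  /-- `Y(|0⟩, z) = id`. -/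
  Y_vac : ∀ n : ℤ, (Y vac)[[n]] = if n = -1 then LinearMap.id else 0
  /-- `Y(a, z)|0⟩ ∈ V[[z]]`. -/
  Y_apply_vac : ∀ (a : V) (n : ℤ), 0 ≤ n → ((Y a)[[n]]) vac = 0
  /-- `Y(a, z)|0⟩` has the value `a` at `z = 0`. -/
  Y_neg_one_vac : ∀ a : V, ((Y a)[[-1]]) vac = a
  T_vac : T vac = 0
  /-- `[T, Y(a, z)] = ∂_z Y(a, z)`. -/
  translation : ∀ (a : V) (n : ℤ),
    T ∘ₗ ((Y a)[[n]]) - ((Y a)[[n]]) ∘ₗ T = (-n : ℂ) • ((Y a)[[n - 1]])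
  /-- `(z - w)^N [Y(a, z), Y(b, w)] = 0`, as the vanishing of all coefficients. -/
  locality : ∀ a b : V, ∃ N : ℕ, ∀ m n : ℤ,
    ∑ j ∈ Finset.range (N + 1), ((-1) ^ j * (N.choose j : ℂ)) •
      (((Y a)[[m + N - j]]) ∘ₗ ((Y b)[[n + j]]) -
        ((Y b)[[n + j]]) ∘ₗ ((Y a)[[m + N - j]])) = 0

namespace VertexAlgebra

variable {V : Type*} [AddCommGroup V] [Module ℂ V] (A : VertexAlgebra V)

/-- The mode `a₍ₙ₎`. -/
def mode (a : V) (n : ℤ) : V →ₗ[ℂ] V := VertexOperator.ncoeff (A.Y a) n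

/-- Commutativity: `[Y(a, z), Y(b, w)] = 0` for all `a` and `b`. -/
def IsCommutative : Prop :=
  ∀ (a b : V) (m n : ℤ) (c : V), A.mode a m (A.mode b n c) = A.mode b n (A.mode a m c)

/-- The `ℤ`-graded vertex algebra structures, for a direct sum decomposition of `V`. -/
structure IsGradedBy (grade : ℤ → Submodule ℂ V) : Prop where
  isInternal : DirectSum.IsInternal grade
  vac_mem : A.vac ∈ grade 0
  mode_mem : ∀ (Δ Δ' n : ℤ) (a b : V), a ∈ grade Δ → b ∈ grade Δ' →
    A.mode a n b ∈ grade (Δ + Δ' - n - 1)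

variable {A}

theorem mode_vac (n : ℤ) (a : V) : A.mode A.vac n a = if n = -1 then a else 0 := by
  rw [mode, A.Y_vac]
  split_ifs <;> rfl

theorem mode_neg_one_vac (a : V) : A.mode a (-1) A.vac = a := A.Y_neg_one_vac a

theorem mode_add (a b : V) (n : ℤ) (c : V) : A.mode (a + b) n c = A.mode a n c + A.mode b n c := by
  simp [mode]

theorem mode_smul (r : ℂ) (a : V) (n : ℤ) (c : V) : A.mode (r • a) n c = r • A.mode a n c := by
  simp [mode]

theorem T_mode (a b : V) (n : ℤ) :
    A.T (A.mode a n b) = A.mode a n (A.T b) + (-n : ℂ) • A.mode a (n - 1) b := by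
  have := LinearMap.congr_fun (A.translation a n) b
  simp only [LinearMap.sub_apply, LinearMap.comp_apply, LinearMap.smul_apply] at this
  rw [sub_eq_iff_eq_add'] at this
  exact this

theorem T_mode_neg_one (a b : V) :
    A.T (A.mode a (-1) b) = A.mode a (-1) (A.T b) + A.mode a (-2) b := by
  rw [T_mode]; norm_num

theorem T_eq (a : V) : A.T a = A.mode a (-2) A.vac := by
  have := T_mode_neg_one (A := A) a A.vac
  rwa [mode_neg_one_vac, A.T_vac, map_zero, zero_add] at this

theorem IsCommutative.comm (h : A.IsCommutative) (a b : V) :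
    A.mode a (-1) b = A.mode b (-1) a := by
  conv_lhs => rw [← mode_neg_one_vac (A := A) b, h, mode_neg_one_vac]

theorem IsCommutative.assoc (h : A.IsCommutative) (a b c : V) :
    A.mode (A.mode a (-1) b) (-1) c = A.mode a (-1) (A.mode b (-1) c) := by
  rw [h.comm, h c a, h.comm c b]

theorem IsCommutative.mode_neg_two (h : A.IsCommutative) (a b : V) :
    A.mode a (-2) b = A.mode (A.T a) (-1) b := by
  conv_lhs => rw [← mode_neg_one_vac (A := A) b, h, ← T_eq, h.comm]

end VertexAlgebra

/-- The commutative `ℤ`-graded vertex algebras `V = ⨁ V_Δ` that are bounded below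
(`V_Δ = 0` for `Δ ≪ 0`) and have finite dimensional graded pieces. -/
structure GrComVA where
  carrier : Type u
  [addCommGroup : AddCommGroup carrier]
  [module : Module ℂ carrier]
  /-- The vertex algebra structure. -/
  va : VertexAlgebra carrier
  commutative : va.IsCommutative
  /-- The graded piece `V_Δ`. -/
  grade : ℤ → Submodule ℂ carrier
  graded : va.IsGradedBy grade
  boundedBelow : ∃ N : ℤ, ∀ Δ < N, grade Δ = ⊥
  finiteDimensional : ∀ Δ, FiniteDimensional ℂ (grade Δ)

instance : CoeSort GrComVA.{u} (Type u) := ⟨GrComVA.carrier⟩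

attribute [instance] GrComVA.addCommGroup GrComVA.module

namespace GrComVA

/-- Morphisms of `ℤ`-graded vertex algebras. -/
@[ext]
structure Hom (V W : GrComVA.{u}) where
  /-- The underlying linear map. -/
  toLinearMap : V →ₗ[ℂ] W
  map_vac : toLinearMap V.va.vac = W.va.vac
  map_T : ∀ a, toLinearMap (V.va.T a) = W.va.T (toLinearMap a)
  map_mode : ∀ (a : V) (n : ℤ) (b : V),
    toLinearMap (V.va.mode a n b) = W.va.mode (toLinearMap a) n (toLinearMap b)
  map_grade : ∀ Δ, ∀ a ∈ V.grade Δ, toLinearMap a ∈ W.grade Δ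

instance : Category GrComVA.{u} where
  Hom := Hom
  id V :=
    { toLinearMap := LinearMap.id
      map_vac := rfl
      map_T := fun _ => rfl
      map_mode := fun _ _ _ => rfl
      map_grade := fun _ _ h => h }
  comp f g :=
    { toLinearMap := g.toLinearMap ∘ₗ f.toLinearMap
      map_vac := by simp [f.map_vac, g.map_vac]
      map_T := fun a => by simp [f.map_T, g.map_T]
      map_mode := fun a n b => by simp [f.map_mode, g.map_mode]
      map_grade := fun Δ a h => g.map_grade Δ _ (f.map_grade Δ a h) }

end GrComVA

/-! ## Graded commutative differential algebras and their completions -/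

/-- A `ℤ`-graded commutative algebra, bounded below with finite dimensional graded pieces, with a
derivation of degree `1`. -/
structure GrDiffAlg where
  carrier : Type u
  [commRing : CommRing carrier]
  [algebra : Algebra ℂ carrier]
  /-- The derivation. -/
  T : carrier →ₗ[ℂ] carrier
  /-- The graded piece of degree `Δ`. -/
  grade : ℤ → Submodule ℂ carrier
  isInternal : DirectSum.IsInternal grade
  T_mul : ∀ a b, T (a * b) = T a * b + a * T b
  one_mem : 1 ∈ grade 0
  mul_mem : ∀ {Δ Δ' : ℤ} {a b : carrier}, a ∈ grade Δ → b ∈ grade Δ' → a * b ∈ grade (Δ + Δ')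
  T_mem : ∀ {Δ : ℤ} {a : carrier}, a ∈ grade Δ → T a ∈ grade (Δ + 1)
  boundedBelow : ∃ N : ℤ, ∀ Δ < N, grade Δ = ⊥
  finiteDimensional : ∀ Δ, FiniteDimensional ℂ (grade Δ)

instance : CoeSort GrDiffAlg.{u} (Type u) := ⟨GrDiffAlg.carrier⟩

attribute [instance] GrDiffAlg.commRing GrDiffAlg.algebra GrDiffAlg.finiteDimensional

/-- A commutative vertex algebra as a commutative algebra with the product `a b = a₍₋₁₎ b`, the unit
`|0⟩` and the derivation `T`. -/
def GrComVA.toDiffAlg (V : GrComVA.{u}) : GrDiffAlg.{u} :=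
  let R : CommRing V.carrier :=
    { V.addCommGroup with
      mul := fun a b => V.va.mode a (-1) b
      one := V.va.vac
      zero_mul := fun a => by
        change V.va.mode 0 (-1) a = 0
        simp [VertexAlgebra.mode]
      mul_zero := fun a => (V.va.mode a (-1)).map_zero
      left_distrib := fun a b c => (V.va.mode a (-1)).map_add b c
      right_distrib := fun a b c => VertexAlgebra.mode_add a b (-1) c
      mul_assoc := fun a b c => V.commutative.assoc a b c
      one_mul := fun a => VertexAlgebra.mode_vac (-1) a
      mul_one := fun a => VertexAlgebra.mode_neg_one_vac a
      mul_comm := fun a b => V.commutative.comm a b }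
  let M : @Module ℂ V.carrier _ R.toRing.toAddCommGroup.toAddCommMonoid := V.module
  { carrier := V.carrier
    commRing := R
    algebra := @Algebra.ofModule ℂ V.carrier _ R.toSemiring M
      (fun r a b => VertexAlgebra.mode_smul r a (-1) b)
      (fun r a b => (V.va.mode a (-1)).map_smul r b)
    T := V.va.T
    grade := V.grade
    isInternal := V.graded.isInternal
    T_mul := fun a b => by
      change V.va.T (V.va.mode a (-1) b) = V.va.mode (V.va.T a) (-1) b + V.va.mode a (-1) (V.va.T b)
      rw [VertexAlgebra.T_mode_neg_one, V.commutative.mode_neg_two, add_comm]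
    one_mem := V.graded.vac_mem
    mul_mem := fun {Δ Δ'} {a b} ha hb => by
      have h := V.graded.mode_mem Δ Δ' (-1) a b ha hb
      rwa [sub_neg_eq_add, add_sub_cancel_right] at h
    T_mem := fun {Δ} {a} ha => by
      have h := V.graded.mode_mem Δ 0 (-2) a _ ha V.graded.vac_mem
      rw [← VertexAlgebra.T_eq] at h
      have e : Δ + 0 - -2 - 1 = Δ + 1 := by ring
      rwa [e] at h
    boundedBelow := V.boundedBelow
    finiteDimensional := V.finiteDimensional }

namespace GrDiffAlg

/-- The completion `V̄ = ∏ V_Δ`, with the product of the canonical topologies of the finite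
dimensional spaces `V_Δ`. -/
def Completion (D : GrDiffAlg.{u}) : Type u := ∀ Δ : ℤ, D.grade Δ

section Topology

variable (D : GrDiffAlg.{u}) (Δ : ℤ)

instance : TopologicalSpace (D.grade Δ) := moduleTopology ℂ (D.grade Δ)

instance : IsModuleTopology ℂ (D.grade Δ) := ⟨rfl⟩

instance : IsTopologicalAddGroup (D.grade Δ) := IsModuleTopology.topologicalAddGroup ℂ _

instance : ContinuousSMul ℂ (D.grade Δ) := IsModuleTopology.toContinuousSMul ℂ _

instance : LocallyConvexSpace ℝ (D.grade Δ) := by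
  let e := (Module.finBasis ℂ (D.grade Δ)).equivFun
  have he : Continuous e := IsModuleTopology.continuous_of_linearMap e.toLinearMap
  have he' : Continuous e.symm := LinearMap.continuous_on_pi e.symm.toLinearMap
  have hi : Topology.IsInducing e :=
    (Homeomorph.mk e.toEquiv he he').isInducing
  rw [hi.eq_induced]
  exact LocallyConvexSpace.induced (e.toLinearMap.restrictScalars ℝ)

end Topology

variable {D : GrDiffAlg.{u}}

namespace Completion

instance : AddCommGroup D.Completion := inferInstanceAs (AddCommGroup (∀ Δ : ℤ, D.grade Δ))

instance : Module ℂ D.Completion := inferInstanceAs (Module ℂ (∀ Δ : ℤ, D.grade Δ))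

instance : TopologicalSpace D.Completion :=
  inferInstanceAs (TopologicalSpace (∀ Δ : ℤ, D.grade Δ))

instance : IsTopologicalAddGroup D.Completion :=
  inferInstanceAs (IsTopologicalAddGroup (∀ Δ : ℤ, D.grade Δ))

instance : ContinuousSMul ℂ D.Completion :=
  inferInstanceAs (ContinuousSMul ℂ (∀ Δ : ℤ, D.grade Δ))

instance : LocallyConvexSpace ℝ D.Completion :=
  inferInstanceAs (LocallyConvexSpace ℝ (∀ Δ : ℤ, D.grade Δ))

/-- The projection `π_Δ : V̄ → V_Δ ⊆ V`. -/
def coeff (Δ : ℤ) : D.Completion →ₗ[ℂ] D where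
  toFun a := (a Δ : D)
  map_add' _ _ := rfl
  map_smul' _ _ := rfl

theorem coeff_mem (Δ : ℤ) (a : D.Completion) : coeff Δ a ∈ D.grade Δ := (a Δ).2

theorem ext' {a b : D.Completion} (h : ∀ Δ, coeff Δ a = coeff Δ b) : a = b :=
  funext fun Δ => Subtype.ext (h Δ)

/-- The element of `V̄` with given components. -/
def mk (f : ℤ → D) (hf : ∀ Δ, f Δ ∈ D.grade Δ) : D.Completion := fun Δ => ⟨f Δ, hf Δ⟩

@[simp]
theorem coeff_mk (f : ℤ → D) (hf : ∀ Δ, f Δ ∈ D.grade Δ) (Δ : ℤ) : coeff Δ (mk f hf) = f Δ := rfl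

/-- A lower bound for the degrees. -/
def IsLB (D : GrDiffAlg.{u}) (M : ℤ) : Prop := M ≤ 0 ∧ ∀ Δ < M, D.grade Δ = ⊥

theorem exists_isLB (D : GrDiffAlg.{u}) : ∃ M, IsLB D M := by
  obtain ⟨N, hN⟩ := D.boundedBelow
  exact ⟨min N 0, min_le_right _ _, fun Δ h => hN Δ (h.trans_le (min_le_left _ _))⟩

theorem IsLB.coeff_eq_zero {M : ℤ} (hM : IsLB D M) (a : D.Completion) {Δ : ℤ} (h : Δ < M) :
    coeff Δ a = 0 := by
  have := coeff_mem Δ a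
  rwa [hM.2 Δ h, Submodule.mem_bot] at this

theorem IsLB.add {M M' : ℤ} (hM : IsLB D M) (hM' : IsLB D M') : IsLB D (M + M') :=
  ⟨by linarith [hM.1, hM'.1], fun Δ h => hM.2 Δ (by linarith [hM'.1])⟩

/-- The components of an element of `V̄`, as the coefficients of a power series. -/
def ps (M : ℤ) (a : D.Completion) : PowerSeries D := PowerSeries.mk fun k => coeff (M + k) a

theorem IsLB.ext {M : ℤ} (hM : IsLB D M) {a b : D.Completion} (h : ps M a = ps M b) : a = b := by
  refine ext' fun Δ => ?_
  rcases lt_or_ge Δ M with hΔ | hΔ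
  · rw [hM.coeff_eq_zero a hΔ, hM.coeff_eq_zero b hΔ]
  · have := congrArg (PowerSeries.coeff (Δ - M).toNat) h
    have e : M + ((Δ - M).toNat : ℤ) = Δ := by omega
    simpa only [ps, PowerSeries.coeff_mk, e] using this

instance : Mul D.Completion := ⟨fun a b =>
  mk (fun Δ => ∑ᶠ Δ' : ℤ, coeff Δ' a * coeff (Δ - Δ') b) fun Δ =>
    finsum_induction (· ∈ D.grade Δ) (zero_mem _) (fun _ _ => add_mem) fun Δ' => by
      have := D.mul_mem (coeff_mem Δ' a) (coeff_mem (Δ - Δ') b)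
      rwa [add_sub_cancel] at this⟩

instance : One D.Completion := ⟨mk (fun Δ => if Δ = 0 then 1 else 0) fun Δ => by
  split_ifs with h
  · subst h; exact D.one_mem
  · exact zero_mem _⟩

theorem coeff_mul (Δ : ℤ) (a b : D.Completion) :
    coeff Δ (a * b) = ∑ᶠ Δ' : ℤ, coeff Δ' a * coeff (Δ - Δ') b := rfl

theorem coeff_one (Δ : ℤ) : coeff Δ (1 : D.Completion) = if Δ = 0 then 1 else 0 := rfl

theorem ps_mul {M M' : ℤ} (hM : IsLB D M) (hM' : IsLB D M') (a b : D.Completion) :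
    ps (M + M') (a * b) = ps M a * ps M' b := by
  ext k
  rw [PowerSeries.coeff_mul, Finset.Nat.sum_antidiagonal_eq_sum_range_succ_mk]
  simp only [ps, PowerSeries.coeff_mk]
  rw [coeff_mul, finsum_eq_sum_of_support_subset (s := (Finset.range k.succ).image
    fun i : ℕ => M + (i : ℤ))]
  · rw [Finset.sum_image (fun i _ j _ h => by simpa using h)]
    refine Finset.sum_congr rfl fun i hi => ?_
    have : M + M' + (k : ℤ) - (M + i) = M' + ((k - i : ℕ) : ℤ) := by
      have := Finset.mem_range.1 hi
      omega
    rw [this]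
  · intro Δ' h
    simp only [Finset.coe_image, Set.mem_image, Finset.coe_range, Set.mem_Iio]
    have h₁ : M ≤ Δ' := by
      by_contra hlt
      exact h (by simp only [hM.coeff_eq_zero a (not_le.1 hlt), zero_mul])
    have h₂ : M' ≤ M + M' + k - Δ' := by
      by_contra hlt
      exact h (by simp only [hM'.coeff_eq_zero b (not_le.1 hlt), mul_zero])
    exact ⟨(Δ' - M).toNat, by omega, by omega⟩

theorem ps_add (M : ℤ) (a b : D.Completion) : ps M (a + b) = ps M a + ps M b := by
  ext k; simp [ps]

theorem ps_smul (M : ℤ) (c : ℂ) (a : D.Completion) : ps M (c • a) = c • ps M a := by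
  ext k; simp [ps]

theorem ps_zero (M : ℤ) : ps M (0 : D.Completion) = 0 := by
  ext k; simp [ps]

theorem completion_mul_comm (a b : D.Completion) : a * b = b * a := by
  obtain ⟨M, hM⟩ := exists_isLB D
  refine (hM.add hM).ext ?_
  rw [ps_mul hM hM, ps_mul hM hM, mul_comm]

theorem completion_one_mul (a : D.Completion) : 1 * a = a := by
  refine ext' fun Δ => ?_
  rw [coeff_mul, finsum_eq_single _ 0, coeff_one, if_pos rfl, one_mul, sub_zero]
  intro Δ' h
  rw [coeff_one, if_neg h, zero_mul]

theorem completion_add_mul (a b c : D.Completion) : (a + b) * c = a * c + b * c := by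
  obtain ⟨M, hM⟩ := exists_isLB D
  refine (hM.add hM).ext ?_
  rw [ps_add, ps_mul hM hM, ps_mul hM hM, ps_mul hM hM, ps_add, add_mul]

theorem completion_smul_mul (r : ℂ) (a b : D.Completion) : (r • a) * b = r • (a * b) := by
  obtain ⟨M, hM⟩ := exists_isLB D
  refine (hM.add hM).ext ?_
  rw [ps_smul, ps_mul hM hM, ps_mul hM hM, ps_smul, smul_mul_assoc]

theorem completion_mul_assoc (a b c : D.Completion) : a * b * c = a * (b * c) := by
  obtain ⟨M, hM⟩ := exists_isLB D
  refine ((hM.add hM).add hM).ext ?_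
  rw [ps_mul (hM.add hM) hM, ps_mul hM hM, add_assoc, ps_mul hM (hM.add hM), ps_mul hM hM,
    mul_assoc]

instance : CommRing D.Completion :=
  { (inferInstance : AddCommGroup D.Completion) with
    mul := (· * ·)
    one := 1
    mul_assoc := completion_mul_assoc
    mul_comm := completion_mul_comm
    one_mul := completion_one_mul
    mul_one := fun a => by rw [completion_mul_comm, completion_one_mul]
    zero_mul := fun a => by
      have := completion_smul_mul (0 : ℂ) a a
      have h := completion_smul_mul (0 : ℂ) (0 : D.Completion) a
      rwa [zero_smul, zero_smul] at h
    mul_zero := fun a => by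
      have h := completion_smul_mul (0 : ℂ) (0 : D.Completion) a
      rw [zero_smul, zero_smul] at h
      rw [completion_mul_comm, h]
    left_distrib := fun a b c => by
      rw [completion_mul_comm, completion_add_mul, completion_mul_comm b, completion_mul_comm c]
    right_distrib := completion_add_mul }

instance : Algebra ℂ D.Completion :=
  Algebra.ofModule completion_smul_mul fun r a b => by
    rw [mul_comm, completion_smul_mul, mul_comm]

/-! ### Continuity -/

/-- The inclusion of a graded piece. -/
def single (i : ℤ) : D.grade i →ₗ[ℂ] D.Completion :=
  LinearMap.single ℂ (fun Δ : ℤ => D.grade Δ) i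

theorem coeff_single (i Δ : ℤ) (a : D.grade i) :
    coeff Δ (single i a) = if Δ = i then (a : D) else 0 := by
  change ((Pi.single i a : ∀ Δ : ℤ, D.grade Δ) Δ : D) = _
  split_ifs with h
  · subst h; simp
  · rw [Pi.single_eq_of_ne h]; rfl

/-- A linear map is continuous if each component of its value depends on finitely many components of
the argument. -/
theorem continuous_of_finite {D' : GrDiffAlg.{u}} (L : D.Completion →ₗ[ℂ] D'.Completion)
    (h : ∀ Δ, ∃ s : Finset ℤ, ∀ a, (∀ i ∈ s, coeff i a = 0) → coeff Δ (L a) = 0) :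
    Continuous L := by
  refine continuous_pi fun Δ => ?_
  obtain ⟨s, hs⟩ := h Δ
  have key : (fun a : D.Completion => L a Δ) =
      fun a => ∑ i ∈ s, L (single i (a i)) Δ := by
    funext a
    have h0 := hs (a - ∑ i ∈ s, single i (a i)) (fun i hi => by
      rw [map_sub, map_sum, Finset.sum_eq_single i, coeff_single, if_pos rfl]
      · exact sub_self _
      · intro j _ hj
        rw [coeff_single, if_neg hj.symm]
      · exact fun h => absurd hi h)
    rw [map_sub, map_sub, sub_eq_zero, map_sum, map_sum] at h0
    refine Subtype.ext (h0.trans ?_)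
    rw [Submodule.coe_sum]
    rfl
  rw [key]
  refine continuous_finsetSum _ fun i _ => ?_
  have hc : Continuous ((LinearMap.proj Δ : (∀ Δ : ℤ, D'.grade Δ) →ₗ[ℂ] D'.grade Δ) ∘ₗ
      (L ∘ₗ single i : D.grade i →ₗ[ℂ] ∀ Δ : ℤ, D'.grade Δ)) :=
    IsModuleTopology.continuous_of_linearMap _
  exact hc.comp (continuous_apply i)

theorem continuous_mul_left' (a : D.Completion) : Continuous fun b : D.Completion => a * b := by
  refine continuous_of_finite (LinearMap.mulLeft ℂ a) fun Δ => ?_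
  obtain ⟨M, hM⟩ := exists_isLB D
  refine ⟨Finset.Icc M (Δ - M), fun b hb => ?_⟩
  rw [LinearMap.mulLeft_apply, coeff_mul]
  refine finsum_eq_zero_of_forall_eq_zero fun Δ' => ?_
  rcases lt_or_ge Δ' M with h | h
  · rw [hM.coeff_eq_zero a h, zero_mul]
  · rcases lt_or_ge (Δ - Δ') M with h' | h'
    · rw [hM.coeff_eq_zero b h', mul_zero]
    · rw [hb _ (Finset.mem_Icc.2 ⟨h', by omega⟩), mul_zero]

/-! ### The action of the motions -/

/-- The map `q^{L₀}`. -/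
def rotMap (q : Circle) : D.Completion →ₗ[ℂ] D.Completion where
  toFun a := mk (fun Δ => ((q : ℂ) ^ Δ) • coeff Δ a) fun Δ =>
    Submodule.smul_mem _ _ (coeff_mem Δ a)
  map_add' a b := ext' fun Δ => by simp
  map_smul' c a := ext' fun Δ => by
    simp only [coeff_mk, map_smul, RingHom.id_apply]
    exact smul_comm _ _ _

@[simp]
theorem coeff_rotMap (q : Circle) (Δ : ℤ) (a : D.Completion) :
    coeff Δ (rotMap q a) = ((q : ℂ) ^ Δ) • coeff Δ a := rfl

theorem T_pow_mem (n : ℕ) {Δ : ℤ} {a : D} (h : a ∈ D.grade Δ) :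
    (D.T ^ n) a ∈ D.grade (Δ + n) := by
  induction n with
  | zero => simpa using h
  | succ n ih =>
    rw [pow_succ', Module.End.mul_apply]
    have := D.T_mem ih
    push_cast
    rwa [← add_assoc]

/-- The `n`-th term `zⁿ Tⁿ / n!` of `e^{zT}`. -/
def expTerm (D : GrDiffAlg.{u}) (z : ℂ) (n : ℕ) : D →ₗ[ℂ] D :=
  (z ^ n / (n.factorial : ℂ)) • D.T ^ n

theorem expTerm_mem (z : ℂ) (n : ℕ) {Δ : ℤ} {a : D} (h : a ∈ D.grade Δ) :
    expTerm D z n a ∈ D.grade (Δ + n) :=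
  Submodule.smul_mem _ _ (T_pow_mem n h)

/-- The components of `e^{zT} a`. -/
def expCoeff (z : ℂ) (a : D.Completion) (Δ : ℤ) : D :=
  ∑ᶠ n : ℕ, (z ^ n / (n.factorial : ℂ)) • (D.T ^ n) (coeff (Δ - n) a)

theorem expCoeff_mem (z : ℂ) (a : D.Completion) (Δ : ℤ) : expCoeff z a Δ ∈ D.grade Δ :=
  finsum_induction (· ∈ D.grade Δ) (zero_mem _) (fun _ _ => add_mem) fun n => by
    have := expTerm_mem z n (coeff_mem (Δ - n) a)
    rwa [sub_add_cancel] at this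

theorem expCoeff_eq (z : ℂ) (a : D.Completion) {M : ℤ} (hM : IsLB D M) (k : ℕ) :
    expCoeff z a (M + k) =
      ∑ p ∈ Finset.HasAntidiagonal.antidiagonal k, expTerm D z p.2 (PowerSeries.coeff p.1 (ps M a)) := by
  rw [Finset.Nat.sum_antidiagonal_eq_sum_range_succ_mk, ← Finset.sum_range_reflect, expCoeff,
    finsum_eq_sum_of_support_subset (s := Finset.range k.succ)]
  · refine Finset.sum_congr rfl fun n hn => ?_
    have hn := Finset.mem_range.1 hn
    have e₁ : k.succ - 1 - n = k - n := by omega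
    have e₂ : k - (k - n) = n := by omega
    have e₃ : M + (k : ℤ) - n = M + ((k - n : ℕ) : ℤ) := by omega
    simp only [ps, PowerSeries.coeff_mk, e₁, e₂, e₃]
    rfl
  · intro n h
    simp only [Finset.coe_range, Set.mem_Iio]
    by_contra hn
    exact h (by simp only [hM.coeff_eq_zero a (show M + (k : ℤ) - n < M by omega), map_zero,
      smul_zero])

theorem expCoeff_of_lt (z : ℂ) (a : D.Completion) {M : ℤ} (hM : IsLB D M) {Δ : ℤ} (h : Δ < M) :
    expCoeff z a Δ = 0 := by
  have := expCoeff_mem z a Δ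
  rwa [hM.2 Δ h, Submodule.mem_bot] at this

/-- The map `e^{zT}`. -/
def expMap (z : ℂ) : D.Completion →ₗ[ℂ] D.Completion where
  toFun a := mk (expCoeff z a) (expCoeff_mem z a)
  map_add' a b := by
    obtain ⟨M, hM⟩ := exists_isLB D
    refine hM.ext ?_
    ext k
    simp only [ps_add, map_add]
    simp only [ps, PowerSeries.coeff_mk, coeff_mk]
    simp only [expCoeff_eq z _ hM, ps_add, map_add, Finset.sum_add_distrib]
  map_smul' c a := by
    obtain ⟨M, hM⟩ := exists_isLB D
    refine hM.ext ?_
    ext k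
    simp only [ps_smul, RingHom.id_apply]
    rw [PowerSeries.coeff_smul]
    simp only [ps, PowerSeries.coeff_mk, coeff_mk]
    simp only [expCoeff_eq z _ hM, ps_smul, PowerSeries.coeff_smul, map_smul, Finset.smul_sum]

theorem coeff_expMap (z : ℂ) (Δ : ℤ) (a : D.Completion) :
    coeff Δ (expMap z a) =
      ∑ᶠ n : ℕ, (z ^ n / (n.factorial : ℂ)) • (D.T ^ n) (coeff (Δ - n) a) := rfl

theorem coeff_ps_expMap (z : ℂ) (a : D.Completion) {M : ℤ} (hM : IsLB D M) (k : ℕ) :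
    PowerSeries.coeff k (ps M (expMap z a)) =
      ∑ p ∈ Finset.HasAntidiagonal.antidiagonal k, expTerm D z p.2 (PowerSeries.coeff p.1 (ps M a)) := by
  rw [← expCoeff_eq z a hM k]
  simp only [ps, PowerSeries.coeff_mk]
  rfl

theorem expTerm_zero_zero : expTerm D 0 0 = LinearMap.id := by
  simp [expTerm]; rfl

theorem expTerm_one (z : ℂ) (n : ℕ) : expTerm D z n 1 = if n = 0 then 1 else 0 := by
  have hT : D.T 1 = 0 := by
    have := D.T_mul 1 1
    simpa using this
  cases n with
  | zero => simp [expTerm]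
  | succ n =>
    rw [if_neg (Nat.succ_ne_zero n), expTerm, LinearMap.smul_apply, pow_succ D.T,
      Module.End.mul_apply, hT, map_zero, smul_zero]

theorem factorial_div (z w : ℂ) {i j n : ℕ} (h : i + j = n) :
    (n.choose i : ℂ) * (z ^ i * w ^ j / (n.factorial : ℂ)) =
      (z ^ i / (i.factorial : ℂ)) * (w ^ j / (j.factorial : ℂ)) := by
  subst h
  have h : (i + j).choose i * i.factorial * j.factorial = (i + j).factorial := by
    have := Nat.choose_mul_factorial_mul_factorial (Nat.le_add_right i j)
    rwa [Nat.add_sub_cancel_left] at this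
  have h' : ((i + j).choose i : ℂ) * i.factorial * j.factorial = (i + j).factorial := by
    exact_mod_cast h
  have h1 : (i.factorial : ℂ) ≠ 0 := by exact_mod_cast i.factorial_ne_zero
  have h2 : (j.factorial : ℂ) ≠ 0 := by exact_mod_cast j.factorial_ne_zero
  have h3 : ((i + j).factorial : ℂ) ≠ 0 := by exact_mod_cast (i + j).factorial_ne_zero
  field_simp
  rw [← h']
  ring

theorem expTerm_add (z w : ℂ) (n : ℕ) (a : D) :
    expTerm D (z + w) n a =
      ∑ p ∈ Finset.HasAntidiagonal.antidiagonal n, expTerm D z p.1 (expTerm D w p.2 a) := by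
  have h : ((z + w) ^ n : ℂ) = _ := (Commute.all z w).add_pow' n
  rw [expTerm, h, Finset.sum_div, Finset.sum_smul, LinearMap.sum_apply]
  refine Finset.sum_congr rfl fun p hp => ?_
  have hp := Finset.HasAntidiagonal.mem_antidiagonal.1 hp
  rw [expTerm, expTerm, LinearMap.smul_apply, LinearMap.smul_apply, LinearMap.smul_apply, map_smul,
    smul_smul, ← Module.End.mul_apply, ← pow_add, hp, nsmul_eq_mul, mul_div_assoc,
    factorial_div z w hp]

theorem T_pow_mul (n : ℕ) (a b : D) :
    (D.T ^ n) (a * b) =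
      ∑ p ∈ Finset.HasAntidiagonal.antidiagonal n, n.choose p.1 • ((D.T ^ p.1) a * (D.T ^ p.2) b) := by
  let S : Module.End ℂ (D ⊗[ℂ] D) := TensorProduct.map D.T LinearMap.id
  let S' : Module.End ℂ (D ⊗[ℂ] D) := TensorProduct.map LinearMap.id D.T
  have hm : ∀ x, D.T (LinearMap.mul' ℂ D x) = LinearMap.mul' ℂ D ((S + S') x) := by
    intro x
    induction x using TensorProduct.induction_on with
    | zero => simp
    | tmul a b => simp [S, S', D.T_mul]
    | add x y hx hy => simp only [map_add, hx, hy]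
  have hn : ∀ (n : ℕ) x, (D.T ^ n) (LinearMap.mul' ℂ D x) =
      LinearMap.mul' ℂ D (((S + S') ^ n) x) := by
    intro n
    induction n with
    | zero => intro x; rfl
    | succ n ih => intro x; rw [pow_succ, pow_succ, Module.End.mul_apply, Module.End.mul_apply, hm, ih]
  have hc : Commute S S' := by
    change S * S' = S' * S
    refine TensorProduct.ext' fun a b => ?_
    simp [S, S']
  have h := hn n (a ⊗ₜ b)
  rw [LinearMap.mul'_apply, hc.add_pow', LinearMap.sum_apply, map_sum] at h
  rw [h]
  refine Finset.sum_congr rfl fun p _ => ?_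
  have h₁ : S ^ p.1 = TensorProduct.map (D.T ^ p.1) LinearMap.id := by
    have := TensorProduct.map_pow (R := ℂ) D.T (LinearMap.id : D →ₗ[ℂ] D) p.1
    rw [this, ← Module.End.one_eq_id, one_pow]
  have h₂ : S' ^ p.2 = TensorProduct.map LinearMap.id (D.T ^ p.2) := by
    have := TensorProduct.map_pow (R := ℂ) (LinearMap.id : D →ₗ[ℂ] D) D.T p.2
    rw [this, ← Module.End.one_eq_id, one_pow]
  rw [h₁, h₂, LinearMap.smul_apply, map_nsmul, Module.End.mul_apply]
  simp

theorem expTerm_mul (z : ℂ) (n : ℕ) (a b : D) :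
    expTerm D z n (a * b) =
      ∑ p ∈ Finset.HasAntidiagonal.antidiagonal n, expTerm D z p.1 a * expTerm D z p.2 b := by
  rw [expTerm, LinearMap.smul_apply, T_pow_mul, Finset.smul_sum]
  refine Finset.sum_congr rfl fun p hp => ?_
  have hp := Finset.HasAntidiagonal.mem_antidiagonal.1 hp
  rw [expTerm, expTerm, LinearMap.smul_apply, LinearMap.smul_apply, smul_mul_smul_comm,
    ← factorial_div z z hp, ← pow_add, hp, ← Nat.cast_smul_eq_nsmul ℂ, smul_smul, mul_comm]

theorem expMap_one (z : ℂ) : expMap z (1 : D.Completion) = 1 := by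
  refine ext' fun Δ => ?_
  rw [coeff_expMap]
  have h : ∀ n : ℕ, (z ^ n / (n.factorial : ℂ)) • (D.T ^ n) (coeff (Δ - n) (1 : D.Completion)) =
      if n = 0 then coeff Δ (1 : D.Completion) else 0 := by
    intro n
    have h := expTerm_one (D := D) z n
    rw [expTerm, LinearMap.smul_apply] at h
    rw [coeff_one, coeff_one]
    rcases eq_or_ne n 0 with rfl | hn
    · simp
    · rw [if_neg hn] at h ⊢
      split_ifs
      · exact h
      · rw [map_zero, smul_zero]
  simp only [h]
  rw [finsum_eq_single _ 0 (fun n hn => if_neg hn), if_pos rfl]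

theorem expMap_mul (z : ℂ) (a b : D.Completion) :
    expMap z (a * b) = expMap z a * expMap z b := by
  obtain ⟨M, hM⟩ := exists_isLB D
  refine (hM.add hM).ext ?_
  ext k
  rw [coeff_ps_expMap z _ (hM.add hM), ps_mul hM hM, ps_mul hM hM, PowerSeries.coeff_mul]
  simp only [coeff_ps_expMap z _ hM, PowerSeries.coeff_mul, map_sum, expTerm_mul,
    Finset.sum_mul_sum, Finset.sum_sigma']
  refine Finset.sum_nbij'
    (fun x => ⟨(x.2.1.1 + x.2.2.1, x.2.1.2 + x.2.2.2), ⟨(x.2.1.1, x.2.2.1), (x.2.1.2, x.2.2.2)⟩⟩)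
    (fun y => ⟨(y.2.1.1 + y.2.2.1, y.2.1.2 + y.2.2.2), ⟨(y.2.1.1, y.2.2.1), (y.2.1.2, y.2.2.2)⟩⟩)
    ?_ ?_ ?_ ?_ ?_
  · rintro ⟨⟨c, n⟩, ⟨⟨a, b⟩, ⟨i, j⟩⟩⟩ h
    simp only [Finset.mem_sigma, Finset.HasAntidiagonal.mem_antidiagonal] at h ⊢
    obtain ⟨_, rfl, rfl⟩ := h
    exact ⟨by omega, trivial, trivial⟩
  · rintro ⟨⟨c, n⟩, ⟨⟨a, b⟩, ⟨i, j⟩⟩⟩ h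
    simp only [Finset.mem_sigma, Finset.HasAntidiagonal.mem_antidiagonal] at h ⊢
    obtain ⟨_, rfl, rfl⟩ := h
    exact ⟨by omega, trivial, trivial⟩
  · rintro ⟨⟨c, n⟩, ⟨⟨a, b⟩, ⟨i, j⟩⟩⟩ h
    simp only [Finset.mem_sigma, Finset.HasAntidiagonal.mem_antidiagonal] at h
    obtain ⟨_, rfl, rfl⟩ := h
    rfl
  · rintro ⟨⟨c, n⟩, ⟨⟨a, b⟩, ⟨i, j⟩⟩⟩ h
    simp only [Finset.mem_sigma, Finset.HasAntidiagonal.mem_antidiagonal] at h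
    obtain ⟨_, rfl, rfl⟩ := h
    rfl
  · rintro ⟨⟨c, n⟩, ⟨⟨a, b⟩, ⟨i, j⟩⟩⟩ _
    rfl

theorem expMap_expMap (z w : ℂ) (a : D.Completion) :
    expMap z (expMap w a) = expMap (z + w) a := by
  obtain ⟨M, hM⟩ := exists_isLB D
  refine hM.ext ?_
  ext k
  rw [coeff_ps_expMap z _ hM, coeff_ps_expMap (z + w) _ hM]
  simp only [coeff_ps_expMap w _ hM, map_sum, expTerm_add]
  rw [Finset.sum_sigma', Finset.sum_sigma']
  refine Finset.sum_nbij'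
    (fun x => ⟨(x.2.1, x.1.2 + x.2.2), (x.1.2, x.2.2)⟩)
    (fun y => ⟨(y.1.1 + y.2.2, y.2.1), (y.1.1, y.2.2)⟩) ?_ ?_ ?_ ?_ ?_
  · rintro ⟨⟨c, n⟩, ⟨a, m⟩⟩ h
    simp only [Finset.mem_sigma, Finset.HasAntidiagonal.mem_antidiagonal] at h ⊢
    obtain ⟨_, rfl⟩ := h
    exact ⟨by omega, trivial⟩
  · rintro ⟨⟨a, N⟩, ⟨n, m⟩⟩ h
    simp only [Finset.mem_sigma, Finset.HasAntidiagonal.mem_antidiagonal] at h ⊢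
    obtain ⟨_, rfl⟩ := h
    exact ⟨by omega, trivial⟩
  · rintro ⟨⟨c, n⟩, ⟨a, m⟩⟩ h
    simp only [Finset.mem_sigma, Finset.HasAntidiagonal.mem_antidiagonal] at h
    obtain ⟨_, rfl⟩ := h
    rfl
  · rintro ⟨⟨a, N⟩, ⟨n, m⟩⟩ h
    simp only [Finset.mem_sigma, Finset.HasAntidiagonal.mem_antidiagonal] at h
    obtain ⟨_, rfl⟩ := h
    rfl
  · rintro ⟨⟨c, n⟩, ⟨a, m⟩⟩ _
    rfl

theorem expMap_zero (a : D.Completion) : expMap 0 a = a := by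
  refine ext' fun Δ => ?_
  rw [coeff_expMap, finsum_eq_single _ 0]
  · simp
  · intro n hn
    rw [zero_pow hn, zero_div, zero_smul]

theorem rotMap_one_map (q : Circle) : rotMap q (1 : D.Completion) = 1 := by
  refine ext' fun Δ => ?_
  rw [coeff_rotMap, coeff_one]
  split_ifs with h
  · rw [h, zpow_zero, one_smul]
  · rw [smul_zero]

theorem rotMap_mul_map (q : Circle) (a b : D.Completion) :
    rotMap q (a * b) = rotMap q a * rotMap q b := by
  refine ext' fun Δ => ?_
  rw [coeff_rotMap, coeff_mul, coeff_mul, smul_finsum]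
  refine finsum_congr fun Δ' => ?_
  rw [coeff_rotMap, coeff_rotMap, smul_mul_smul_comm, ← zpow_add₀ (Circle.coe_ne_zero q),
    add_sub_cancel]

theorem rotMap_id (a : D.Completion) : rotMap 1 a = a := by
  refine ext' fun Δ => ?_
  rw [coeff_rotMap, Circle.coe_one, one_zpow, one_smul]

theorem rotMap_rotMap (p q : Circle) (a : D.Completion) :
    rotMap p (rotMap q a) = rotMap (p * q) a := by
  refine ext' fun Δ => ?_
  rw [coeff_rotMap, coeff_rotMap, coeff_rotMap, smul_smul, Circle.coe_mul, mul_zpow]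

theorem rotMap_expMap (q : Circle) (z : ℂ) (a : D.Completion) :
    rotMap q (expMap z a) = expMap (q * z) (rotMap q a) := by
  refine ext' fun Δ => ?_
  rw [coeff_rotMap, coeff_expMap, coeff_expMap, smul_finsum]
  refine finsum_congr fun n => ?_
  rw [coeff_rotMap, map_smul, smul_smul, smul_smul]
  congr 1
  have h := Circle.coe_ne_zero q
  rw [zpow_sub₀ h, zpow_natCast, mul_pow]
  field_simp

/-- `q^{L₀}` as an algebra homomorphism. -/
def rot (q : Circle) : D.Completion →ₐ[ℂ] D.Completion :=
  AlgHom.ofLinearMap (rotMap q) (rotMap_one_map q) (rotMap_mul_map q)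

/-- `e^{zT}` as an algebra homomorphism. -/
def exp (z : ℂ) : D.Completion →ₐ[ℂ] D.Completion :=
  AlgHom.ofLinearMap (expMap z) (expMap_one z) (expMap_mul z)

theorem continuous_rot (q : Circle) : Continuous (rot (D := D) q) :=
  continuous_of_finite (rotMap q) fun Δ => ⟨{Δ}, fun a ha => by
    rw [coeff_rotMap, ha Δ (Finset.mem_singleton_self _), smul_zero]⟩

theorem continuous_exp (z : ℂ) : Continuous (exp (D := D) z) := by
  refine continuous_of_finite (expMap z) fun Δ => ?_
  obtain ⟨M, hM⟩ := exists_isLB D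
  refine ⟨Finset.Icc M Δ, fun a ha => ?_⟩
  rw [coeff_expMap]
  refine finsum_eq_zero_of_forall_eq_zero fun n => ?_
  rcases lt_or_ge (Δ - n) M with h | h
  · rw [hM.coeff_eq_zero a h, map_zero, smul_zero]
  · rw [ha _ (Finset.mem_Icc.2 ⟨h, by omega⟩), map_zero, smul_zero]

end Completion

/-- The completion `V̄`, on which `(q, z) ∈ S¹ ⋉ ℂ` acts by `e^{zT} q^{L₀}`. -/
def toMotionAlg (D : GrDiffAlg.{u}) : MotionAlg.{u} where
  carrier := D.Completion
  continuous_mul := Completion.continuous_mul_left'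
  θ g := (Completion.exp g.trans).comp (Completion.rot g.rot)
  θ_one := AlgHom.ext fun a => by
    change Completion.expMap 0 (Completion.rotMap 1 a) = a
    rw [Completion.expMap_zero, Completion.rotMap_id]
  θ_mul g h := AlgHom.ext fun a => by
    change Completion.expMap (g.trans + g.rot * h.trans) (Completion.rotMap (g.rot * h.rot) a) =
      Completion.expMap g.trans (Completion.rotMap g.rot
        (Completion.expMap h.trans (Completion.rotMap h.rot a)))
    rw [Completion.rotMap_expMap, Completion.expMap_expMap, Completion.rotMap_rotMap]
  continuous_θ g := (Completion.continuous_exp g.trans).comp (Completion.continuous_rot g.rot)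

end GrDiffAlg

/-! ## The functor -/

namespace GrComVA

open GrDiffAlg

/-- The completion `V̄ = ∏ V_Δ` of a commutative graded vertex algebra. -/
def bar (V : GrComVA.{u}) : MotionAlg.{u} := V.toDiffAlg.toMotionAlg

variable {V W : GrComVA.{u}}

/-- The map `f̄ : V̄ → W̄` that is given by `f` in each degree. -/
def barMap (f : V ⟶ W) : V.toDiffAlg.Completion →ₗ[ℂ] W.toDiffAlg.Completion where
  toFun a := Completion.mk (D := W.toDiffAlg) (fun Δ => f.toLinearMap (Completion.coeff Δ a))
    fun Δ => f.map_grade Δ _ (Completion.coeff_mem Δ a)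
  map_add' _ _ := Completion.ext' fun _ => f.toLinearMap.map_add _ _
  map_smul' c _ := Completion.ext' fun _ => f.toLinearMap.map_smul c _

/-- A morphism as a linear map of differential algebras. -/
def diffMap (f : V ⟶ W) : V.toDiffAlg →ₗ[ℂ] W.toDiffAlg where
  toFun := f.toLinearMap
  map_add' := f.toLinearMap.map_add
  map_smul' := f.toLinearMap.map_smul

theorem diffMap_mul (f : V ⟶ W) (a b : V.toDiffAlg) :
    diffMap f (a * b) = diffMap f a * diffMap f b := f.map_mode a (-1) b

theorem diffMap_one (f : V ⟶ W) : diffMap f 1 = 1 := f.map_vac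

theorem diffMap_T_pow (f : V ⟶ W) (n : ℕ) (a : V.toDiffAlg) :
    diffMap f ((V.toDiffAlg.T ^ n) a) = (W.toDiffAlg.T ^ n) (diffMap f a) := by
  induction n with
  | zero => rfl
  | succ n ih =>
    rw [pow_succ', pow_succ', Module.End.mul_apply, Module.End.mul_apply, ← ih]
    exact f.map_T _

theorem coeff_barMap (f : V ⟶ W) (Δ : ℤ) (a : V.toDiffAlg.Completion) :
    Completion.coeff Δ (barMap f a) = diffMap f (Completion.coeff Δ a) := rfl

theorem ps_barMap (f : V ⟶ W) (M : ℤ) (a : V.toDiffAlg.Completion) (k : ℕ) :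
    PowerSeries.coeff k (Completion.ps M (barMap f a)) =
      diffMap f (PowerSeries.coeff k (Completion.ps M a)) := by
  simp only [Completion.ps, PowerSeries.coeff_mk, coeff_barMap]

theorem exists_isLB₂ (V W : GrComVA.{u}) :
    ∃ M, Completion.IsLB V.toDiffAlg M ∧ Completion.IsLB W.toDiffAlg M := by
  obtain ⟨M, hM⟩ := Completion.exists_isLB V.toDiffAlg
  obtain ⟨M', hM'⟩ := Completion.exists_isLB W.toDiffAlg
  refine ⟨M + M', ⟨by linarith [hM.1, hM'.1], fun Δ h => hM.2 Δ (by linarith [hM'.1])⟩,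
    ⟨by linarith [hM.1, hM'.1], fun Δ h => hM'.2 Δ (by linarith [hM.1])⟩⟩

theorem barMap_mul (f : V ⟶ W) (a b : V.toDiffAlg.Completion) :
    barMap f (a * b) = barMap f a * barMap f b := by
  obtain ⟨M, hV, hW⟩ := exists_isLB₂ V W
  refine (hW.add hW).ext ?_
  ext k
  rw [ps_barMap, Completion.ps_mul hV hV, Completion.ps_mul hW hW, PowerSeries.coeff_mul,
    PowerSeries.coeff_mul, map_sum]
  simp only [diffMap_mul, ps_barMap]

theorem barMap_one (f : V ⟶ W) : barMap f 1 = 1 := by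
  refine Completion.ext' fun Δ => ?_
  rw [coeff_barMap, Completion.coeff_one, Completion.coeff_one]
  split_ifs
  · exact diffMap_one f
  · exact map_zero _

theorem barMap_rotMap (f : V ⟶ W) (q : Circle) (a : V.toDiffAlg.Completion) :
    barMap f (Completion.rotMap q a) = Completion.rotMap q (barMap f a) := by
  refine Completion.ext' fun Δ => ?_
  rw [coeff_barMap, Completion.coeff_rotMap, Completion.coeff_rotMap, map_smul, coeff_barMap]

theorem barMap_expMap (f : V ⟶ W) (z : ℂ) (a : V.toDiffAlg.Completion) :
    barMap f (Completion.expMap z a) = Completion.expMap z (barMap f a) := by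
  obtain ⟨M, hV, hW⟩ := exists_isLB₂ V W
  refine hW.ext ?_
  ext k
  rw [ps_barMap, Completion.coeff_ps_expMap z _ hV, Completion.coeff_ps_expMap z _ hW, map_sum]
  refine Finset.sum_congr rfl fun p _ => ?_
  rw [ps_barMap, Completion.expTerm, Completion.expTerm, LinearMap.smul_apply,
    LinearMap.smul_apply, map_smul, diffMap_T_pow]

/-- The continuous equivariant algebra homomorphism `f̄ : V̄ → W̄`. -/
def barHom (f : V ⟶ W) : MotionAlg.Hom V.bar W.bar where
  hom := AlgHom.ofLinearMap (barMap f) (barMap_one f) (barMap_mul f)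
  continuous_hom := Completion.continuous_of_finite (barMap f) fun Δ => ⟨{Δ}, fun a ha => by
    rw [coeff_barMap, ha Δ (Finset.mem_singleton_self _), map_zero]⟩
  hom_θ g a := by
    change barMap f (Completion.expMap _ (Completion.rotMap _ a)) =
      Completion.expMap _ (Completion.rotMap _ (barMap f a))
    exact (barMap_expMap f _ _).trans (congrArg _ (barMap_rotMap f _ a))

end GrComVA

/-- The functor `V ↦ F_V̄`, from commutative graded vertex algebras that are bounded below with
finite dimensional graded pieces to `S¹ ⋉ ℂ`-equivariant prefactorization algebras. -/
def Floc : GrComVA.{u} ⥤ EquivPFA.{u} where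
  obj V := V.bar.toPFA
  map f := MotionAlg.toPFAHom (GrComVA.barHom f)
  map_id V := MotionAlg.toPFAHom_id V.bar _ rfl
  map_comp f g := MotionAlg.toPFAHom_comp (GrComVA.barHom f) (GrComVA.barHom g) _ rfl

end CFact

end

/-! The poset of disk configurations in `U` is in general not directed, so elements of the colimit
`F_A(U)` are hard to compare at a common stage. The proof describes `F_A(U)` by points instead. For
finitely many points `q i` of `U`, possibly coinciding, `val` sends `A^{⊗ι}` to `F_A(U)` by putting
the factors at these points. The result does not depend on the disks used (`val_eq`), factors at the
same point are multiplied (`val_push`), and points may be moved inside the disks of a configuration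
(`val_congr`). These rules give the first three statements below for every commutative algebra `A`
with an action of the motions.

Disks and the plane: all points can be collected at one point, so the total product `aug` identifies
`F_A(U)` with `A`, with inverse `pt`. Structure maps commute with `aug`, whence local constancy.

Descent: a finite set of points of `U` lies in a member of a Weiss cover, and compatible maps on the
members therefore have a well defined value `glue` on tensors at these points. A disk need not lie
in one member, but along a path of points the value is locally constant, hence constant
(`glue_congr`).

Multiplicativity: points of `U ⊔ V` are sorted by the side on which they lie. As disks are
connected, this is compatible with moving points, and it yields a continuous inverse `comul` of the
multiplication.

Holomorphy: for `A = V̄` the isomorphism `aug` is equivariant and `V̄` is a product of finite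
dimensional spaces, so it is Hausdorff and complete. Weight vectors are exactly the elements
concentrated in one degree. The products in condition (iv) become `∏ᵢ e^{zᵢ T} aᵢ`, and since
degrees are bounded below, each component is a polynomial in the `zᵢ`.

Full faithfulness has two halves. A morphism `F_A → F_B` is determined by its effect on single
disks, because pure tensors over several disks are products (`component_eq`); on disks it is one
linear map `A → B`, which is a continuous equivariant algebra homomorphism because the product of
`A` is the multiplication for two disjoint disks (`algHom`). A continuous homomorphism `V̄ → W̄`
that commutes with rotations preserves degrees and is determined by its graded components
(`coeff_map`); commuting with `e^{zT}` makes these components commute with `T`. Finally, a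
commutative vertex algebra is determined by its differential algebra, since `a₍₋₁₋ₖ₎|0⟩ = Tᵏa / k!`
and the non-negative modes vanish (`IsCommutative.map_mode`). -/

noncomputable section

namespace CFact

/-! ### Configurations of small disks around given points -/

namespace DiskConfig

/-- A finite subset of an open set is covered by finitely many disjoint disks in the open set. -/
theorem exists_config (s : Finset ℂ) (W : Opens ℂ) (hs : ∀ p ∈ s, p ∈ W) :
    ∃ N : DiskConfig, N.support ≤ W ∧ ∀ p ∈ s, p ∈ N.support := by
  classical
  -- Finitely many conditions, each valid for all small radii, so one common radius serves all
  -- points.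
  have h : ∀ᶠ r : ℝ in 𝓝[>] 0, 0 < r ∧ (∀ p ∈ s, ball p r ⊆ (W : Set ℂ)) ∧
      ∀ p ∈ s, ∀ q ∈ s, p ≠ q → Disjoint (ball p r) (ball q r) := by
    refine Filter.Eventually.and self_mem_nhdsWithin (Filter.Eventually.and ?_ ?_)
    · rw [Filter.eventually_all_finset]
      intro p hp
      obtain ⟨ε, hε, h⟩ := Metric.isOpen_iff.1 W.2 p (hs p hp)
      filter_upwards [Ioo_mem_nhdsGT hε] with r hr
      exact (ball_subset_ball hr.2.le).trans h
    · rw [Filter.eventually_all_finset]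
      intro p hp
      rw [Filter.eventually_all_finset]
      intro q hq
      by_cases hpq : p = q
      · simp [hpq]
      · filter_upwards [Ioo_mem_nhdsGT (half_pos (dist_pos.2 hpq))] with r hr _
        exact ball_disjoint_ball (by linarith [hr.2])
  obtain ⟨r, hr, h₁, h₂⟩ := h.exists
  refine ⟨⟨s.image fun p => (p, r), ?_, ?_⟩, ?_, ?_⟩
  · intro d hd
    obtain ⟨p, _, rfl⟩ := Finset.mem_image.1 hd
    exact hr
  · intro d hd e he hne
    obtain ⟨p, hp, rfl⟩ := Finset.mem_image.1 hd
    obtain ⟨q, hq, rfl⟩ := Finset.mem_image.1 he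
    exact h₂ p hp q hq fun h => hne (by rw [h])
  · intro w hw
    obtain ⟨d, hd, hwd⟩ := mem_support.1 hw
    obtain ⟨p, hp, rfl⟩ := Finset.mem_image.1 hd
    exact h₁ p hp hwd
  · intro p hp
    exact mem_support.2 ⟨(p, r), Finset.mem_image_of_mem _ hp, mem_ball_self hr⟩

theorem exists_config' {ι : Type} [Finite ι] (q : ι → ℂ) (W : Opens ℂ) (hq : ∀ i, q i ∈ W) :
    ∃ N : DiskConfig, N.support ≤ W ∧ ∀ i, q i ∈ N.support := by
  classical
  cases nonempty_fintype ι
  obtain ⟨N, h, h'⟩ := exists_config (Finset.univ.image q) W (by simpa using hq)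
  exact ⟨N, h, fun i => h' _ (Finset.mem_image_of_mem _ (Finset.mem_univ i))⟩

/-- The disk of `L` that contains a given point of the support. -/
def locate (L : DiskConfig) {ι : Type} (q : ι → ℂ) (h : ∀ i, q i ∈ L.support) (i : ι) : L.disks :=
  ⟨(mem_support.1 (h i)).choose, (mem_support.1 (h i)).choose_spec.1⟩

theorem mem_locate (L : DiskConfig) {ι : Type} (q : ι → ℂ) (h : ∀ i, q i ∈ L.support) (i : ι) :
    q i ∈ ball (L.locate q h i).1.1 (L.locate q h i).1.2 :=
  (mem_support.1 (h i)).choose_spec.2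

theorem locate_eq {L : DiskConfig} {ι : Type} {q : ι → ℂ} (h : ∀ i, q i ∈ L.support) {i : ι}
    {e : L.disks} (he : q i ∈ ball e.1.1 e.1.2) : L.locate q h i = e :=
  eq_of_mem (L.mem_locate q h i) he

theorem parent_locate {L M : DiskConfig} (hLM : L ≤ M) {ι : Type} (q : ι → ℂ)
    (h : ∀ i, q i ∈ L.support) (i : ι) :
    parent hLM (L.locate q h i) = M.locate q (fun i => hLM (h i)) i :=
  (locate_eq _ (subset_parent hLM _ (L.mem_locate q h i))).symm

/-- The centers of the disks. -/
def center (L : DiskConfig) (d : L.disks) : ℂ := d.1.1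

theorem center_mem_support (L : DiskConfig) (d : L.disks) : L.center d ∈ L.support :=
  L.ball_subset d (L.center_mem d)

theorem locate_center (L : DiskConfig) (d : L.disks) :
    L.locate L.center L.center_mem_support d = d :=
  locate_eq _ (L.center_mem d)

/-- The configuration which consists of a single disk. -/
def single (z : ℂ) (r : ℝ) (hr : 0 < r) : DiskConfig where
  disks := {(z, r)}
  radius_pos d hd := by rw [Finset.mem_singleton.1 hd]; exact hr
  disjoint d hd e he hne := by
    rw [Finset.mem_singleton.1 hd, Finset.mem_singleton.1 he] at hne
    exact absurd rfl hne

theorem mem_support_single {z : ℂ} {r : ℝ} (hr : 0 < r) {w : ℂ} :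
    w ∈ (single z r hr).support ↔ w ∈ ball z r := by
  simp [mem_support, single]

instance (z : ℂ) (r : ℝ) (hr : 0 < r) : Subsingleton (single z r hr).disks :=
  ⟨fun a b => Subtype.ext ((Finset.mem_singleton.1 a.2).trans (Finset.mem_singleton.1 b.2).symm)⟩

end DiskConfig

/-! ### The total product on a tensor power -/

namespace TPow

variable {ι κ μ : Type} {A : Type u} [CommRing A] [Algebra ℂ A]

/-- The fibres of a bijection are singletons, so `push` only renames the factors. -/
theorem tprod_congr_fiber [Fintype ι] [DecidableEq κ] (e : ι ≃ κ) (a : κ → A) :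
    push e (AlgHom.id ℂ A) (tprod fun i => a (e i)) = tprod a := by
  classical
  rw [push_tprod]
  congr 1
  funext j
  rw [Finset.prod_eq_single (e.symm j)]
  · simp
  · intro i hi hij
    simp only [Finset.mem_filter, Finset.mem_univ, true_and] at hi
    exact absurd (by rw [← hi, e.symm_apply_apply]) hij
  · intro h
    simp at h

/-- The product of all entries. -/
def mulAll [Fintype ι] : TPow ι A →ₗ[ℂ] A := lift (MultilinearMap.mkPiAlgebra ℂ ι A)

@[simp]
theorem mulAll_tprod [Fintype ι] (a : ι → A) : mulAll (tprod a) = ∏ i, a i := by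
  rw [mulAll, lift_tprod, MultilinearMap.mkPiAlgebra_apply]

theorem mulAll_one [Fintype ι] : mulAll (1 : TPow ι A) = 1 := by
  rw [← tprod_one, mulAll_tprod]; simp

theorem mulAll_mul [Fintype ι] (x y : TPow ι A) : mulAll (x * y) = mulAll x * mulAll y := by
  induction x using TPow.induction with
  | h₁ x x' hx hx' => rw [add_mul, map_add, hx, hx', map_add, add_mul]
  | h₂ c x hx => rw [smul_mul_assoc, map_smul, hx, map_smul, smul_mul_assoc]
  | h₀ a =>
    induction y using TPow.induction with
    | h₁ x x' hx hx' => rw [mul_add, map_add, hx, hx', map_add, mul_add]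
    | h₂ c x hx => rw [mul_smul_comm, map_smul, hx, map_smul, mul_smul_comm]
    | h₀ b =>
      rw [tprod_mul]
      simp only [mulAll_tprod, Pi.mul_apply, Finset.prod_mul_distrib]

/-- Multiplying within the fibres of `p` and then over `κ` is multiplying over `ι`. Transition maps,
motions and algebra homomorphisms are all instances of `push`, so this one identity makes the total
product compatible with each of them. -/
theorem mulAll_push [Fintype ι] [Fintype κ] [DecidableEq κ] {B : Type u} [CommRing B] [Algebra ℂ B]
    (p : ι → κ) (θ : A →ₐ[ℂ] B) (x : TPow ι A) : mulAll (push p θ x) = θ (mulAll x) := by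
  induction x using TPow.induction with
  | h₁ x x' hx hx' => simp only [map_add, hx, hx']
  | h₂ c x hx => simp only [map_smul, hx]
  | h₀ a =>
    rw [push_tprod, mulAll_tprod, mulAll_tprod, map_prod, Finset.prod_fiberwise]

/-- Exhibits the total product as a `push` to one point, so that `val_push` can collect all factors
there. -/
theorem push_unit [Fintype ι] (x : TPow ι A) :
    push (fun _ : ι => ()) (AlgHom.id ℂ A) x = tprod fun _ : Unit => mulAll x := by
  have : (push (fun _ : ι => ()) (AlgHom.id ℂ A)).toLinearMap =
      (tprod.toLinearMap (fun _ : Unit => (0 : A)) ()) ∘ₗ mulAll := by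
    refine hom_ext fun a => ?_
    rw [AlgHom.toLinearMap_apply, push_tprod, LinearMap.comp_apply, mulAll_tprod]
    change _ = tprod (Function.update _ () _)
    congr 1
    funext j
    simp
  have h := LinearMap.congr_fun this x
  rw [AlgHom.toLinearMap_apply] at h
  rw [h, LinearMap.comp_apply]
  change tprod (Function.update _ () _) = _
  congr 1

end TPow

theorem TPow.continuous_mulAll {ι : Type} [Fintype ι] {A : MotionAlg.{u}} :
    Continuous (TPow.mulAll : TPow ι A →ₗ[ℂ] A) := by
  refine TPow.continuous_of_tprod _ fun i a => ?_
  have h : ∀ x : A, TPow.mulAll (TPow.tprod (Function.update a i x)) =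
      (∏ j ∈ Finset.univ.erase i, a j) * x := by
    intro x
    rw [TPow.mulAll_tprod, ← Finset.prod_erase_mul _ _ (Finset.mem_univ i), Function.update_self]
    congr 1
    refine Finset.prod_congr rfl fun j hj => ?_
    rw [Function.update_of_ne (Finset.ne_of_mem_erase hj)]
  simp only [h]
  exact A.continuous_mul _

/-! ### Placing tensors at points of an open set -/

namespace MotionAlg

namespace Colim

open DiskConfig

variable {A B : MotionAlg.{u}} {U V W : Opens ℂ} {ι κ : Type}

open Classical in
/-- The map `A^{⊗ι} → F(U)` that places the factors at given points of `U`. -/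
def val [Fintype ι] (U : Opens ℂ) (q : ι → ℂ) (hq : ∀ i, q i ∈ U) : TPow ι A →ₗ[ℂ] A.Colim U :=
  inc (exists_config' q U hq).choose (exists_config' q U hq).choose_spec.1 ∘ₗ
    (TPow.push (locate _ q (exists_config' q U hq).choose_spec.2) (AlgHom.id ℂ A)).toLinearMap

open Classical in
theorem inc_locate_of_le [Fintype ι] {L M : DiskConfig} (h : L ≤ M) (hL : L.support ≤ U)
    (hM : M.support ≤ U) (q : ι → ℂ) (hq : ∀ i, q i ∈ L.support) (x : TPow ι A) :
    inc L hL (TPow.push (L.locate q hq) (AlgHom.id ℂ A) x) =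
      inc M hM (TPow.push (M.locate q fun i => h (hq i)) (AlgHom.id ℂ A) x) := by
  rw [← inc_ext h hM, ext, TPow.push_push]
  congr 3
  funext i
  exact parent_locate h q hq i

-- Two configurations around the points need not lie in a common larger one, but they have a common
-- refinement: small disks about the points inside both supports. Both values agree with the value
-- at the refinement.
open Classical in
theorem val_eq [Fintype ι] (q : ι → ℂ) (hq : ∀ i, q i ∈ U) (L : DiskConfig) (hL : L.support ≤ U)
    (h : ∀ i, q i ∈ L.support) (x : TPow ι A) :
    val U q hq x = inc L hL (TPow.push (L.locate q h) (AlgHom.id ℂ A) x) := by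
  have h₁ := (exists_config' q U hq).choose_spec.1
  have h₂ := (exists_config' q U hq).choose_spec.2
  obtain ⟨N, hN, hqN⟩ := exists_config' q
    ((exists_config' q U hq).choose.support ⊓ L.support) fun i => ⟨h₂ i, h i⟩
  have a : N ≤ (exists_config' q U hq).choose := hN.trans inf_le_left
  have b : N ≤ L := hN.trans inf_le_right
  rw [val, LinearMap.comp_apply, AlgHom.toLinearMap_apply,
    ← inc_locate_of_le a (hN.trans (inf_le_left.trans h₁)) h₁ q hqN,
    inc_locate_of_le b _ hL q hqN]

/-- Each disk contains its own center. Hence tensors at points generate the colimit, and statements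
about `inc` can be reduced to statements about `val`. -/
theorem inc_eq_val (L : DiskConfig) (hL : L.support ≤ U) (x : TPow L.disks A) :
    inc L hL x = val U L.center (fun d => hL (L.center_mem_support d)) x := by
  classical
  rw [val_eq _ _ L hL L.center_mem_support]
  congr 1
  have : L.locate L.center L.center_mem_support = fun d => d := funext L.locate_center
  rw [this]
  exact (TPow.push_id x).symm

/-- The points `q (p i)` may coincide, and factors at a common point are multiplied. With `p =
parent` this is how the transition maps of the colimit act on points. -/
theorem val_push [Fintype ι] [Fintype κ] [DecidableEq κ] (p : ι → κ) (q : κ → ℂ)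
    (hq : ∀ i, q i ∈ U) (x : TPow ι A) :
    val U q hq (TPow.push p (AlgHom.id ℂ A) x) = val U (fun i => q (p i)) (fun _ => hq _) x := by
  classical
  obtain ⟨N, hN, hqN⟩ := exists_config' q U hq
  rw [val_eq _ _ N hN hqN, val_eq _ _ N hN fun _ => hqN _, TPow.push_push]
  congr 1

theorem val_reindex [Fintype ι] [Fintype κ] (e : ι ≃ κ) (q : κ → ℂ) (hq : ∀ i, q i ∈ U)
    (a : κ → A) :
    val U q hq (TPow.tprod a) =
      val U (fun i => q (e i)) (fun _ => hq _) (TPow.tprod fun i => a (e i)) := by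
  classical
  rw [← val_push e q hq, TPow.tprod_congr_fiber]

theorem res_val [Fintype ι] (h : U ≤ V) (q : ι → ℂ) (hq : ∀ i, q i ∈ U) (x : TPow ι A) :
    res h (val U q hq x) = val V q (fun i => h (hq i)) x := by
  classical
  obtain ⟨N, hN, hqN⟩ := exists_config' q U hq
  rw [val_eq _ _ N hN hqN, val_eq _ _ N (hN.trans h) hqN, res_inc]

theorem continuous_val [Fintype ι] (q : ι → ℂ) (hq : ∀ i, q i ∈ U) :
    Continuous (val (A := A) U q hq) := by
  classical
  exact (continuous_inc _ _).comp (TPow.continuous_push _ _ continuous_id)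

/-- Points can be moved inside the disks of a configuration. -/
theorem val_congr [Fintype ι] (L : DiskConfig) (hL : L.support ≤ U) (q q' : ι → ℂ)
    (h : ∀ i, ∃ d ∈ L.disks, q i ∈ ball d.1 d.2 ∧ q' i ∈ ball d.1 d.2)
    (hq : ∀ i, q i ∈ U) (hq' : ∀ i, q' i ∈ U) (x : TPow ι A) :
    val U q hq x = val U q' hq' x := by
  classical
  have h₁ : ∀ i, q i ∈ L.support := fun i => by
    obtain ⟨d, hd, hi, _⟩ := h i
    exact mem_support.2 ⟨d, hd, hi⟩
  have h₂ : ∀ i, q' i ∈ L.support := fun i => by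
    obtain ⟨d, hd, _, hi⟩ := h i
    exact mem_support.2 ⟨d, hd, hi⟩
  rw [val_eq _ _ L hL h₁, val_eq _ _ L hL h₂]
  have : L.locate q h₁ = L.locate q' h₂ := funext fun i => by
    obtain ⟨d, hd, hi, hi'⟩ := h i
    rw [locate_eq h₁ (e := ⟨d, hd⟩) hi, locate_eq h₂ (e := ⟨d, hd⟩) hi']
  rw [this]

/-! ### The augmentation to `A`, and local constancy -/

/-- The product of all entries. -/
def aug (U : Opens ℂ) : A.Colim U →L[ℂ] A :=
  liftL (fun _ _ => TPow.mulAll) (fun L M h _ _ x => by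
    classical
    rw [ext, TPow.mulAll_push]; rfl) fun _ _ => TPow.continuous_mulAll

@[simp]
theorem aug_inc (L : DiskConfig) (hL : L.support ≤ U) (x : TPow L.disks A) :
    aug U (inc L hL x) = TPow.mulAll x :=
  liftL_inc _ _ _ L hL x

theorem aug_res (h : U ≤ V) (x : A.Colim U) : aug V (res h x) = aug U x := by
  induction x using Colim.induction with
  | h₁ x x' hx hx' => simp only [map_add, hx, hx']
  | h₀ L hL x => rw [res_inc, aug_inc, aug_inc]

theorem aug_mulBilin (hd : Disjoint U V) (h : U ⊔ V ≤ W) (x : A.Colim U) (y : A.Colim V) :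
    aug W (mulBilin hd h x y) = aug U x * aug V y := by
  induction x using Colim.induction with
  | h₁ x x' hx hx' => simp only [map_add, LinearMap.add_apply, hx, hx', add_mul]
  | h₀ L hL x =>
    induction y using Colim.induction with
    | h₁ y y' hy hy' => simp only [map_add, hy, hy', mul_add]
    | h₀ M hM y =>
      classical
      rw [mulBilin_inc, mulInc, LinearMap.compr₂_apply, basisMul_apply, aug_inc, aug_inc, aug_inc,
        TPow.mulAll_mul, ext, ext, TPow.mulAll_push, TPow.mulAll_push]
      rfl

theorem aug_move (g : Motion) (x : A.Colim U) : aug _ (move g U x) = A.θ g (aug U x) := by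
  induction x using Colim.induction with
  | h₁ x x' hx hx' => simp only [map_add, hx, hx']
  | h₀ L hL x =>
    classical
    rw [move_inc, aug_inc, aug_inc, basisMove, TPow.mulAll_push]

theorem aug_map (f : MotionAlg.Hom A B) (x : A.Colim U) : aug U (map f U x) = f.hom (aug U x) := by
  induction x using Colim.induction with
  | h₁ x x' hx hx' => simp only [map_add, hx, hx']
  | h₀ L hL x =>
    classical
    rw [map_inc, aug_inc, aug_inc, basisMap, TPow.mulAll_push]

theorem aug_val [Fintype ι] (q : ι → ℂ) (hq : ∀ i, q i ∈ U) (x : TPow ι A) :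
    aug U (val U q hq x) = TPow.mulAll x := by
  classical
  rw [val, LinearMap.comp_apply, aug_inc, AlgHom.toLinearMap_apply, TPow.mulAll_push]
  rfl

/-- The map `A → F(U)` that places an element at a point of `U`. -/
def pt (U : Opens ℂ) (p : ℂ) (hp : p ∈ U) : A →ₗ[ℂ] A.Colim U :=
  val U (fun _ : Unit => p) (fun _ => hp) ∘ₗ TPow.tprod.toLinearMap (fun _ : Unit => (0 : A)) ()

theorem pt_apply (p : ℂ) (hp : p ∈ U) (a : A) :
    pt U p hp a = val U (fun _ : Unit => p) (fun _ => hp) (TPow.tprod fun _ => a) := by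
  rw [pt, LinearMap.comp_apply]
  change val _ _ _ (TPow.tprod (Function.update _ () _)) = _
  congr 2

theorem continuous_pt (p : ℂ) (hp : p ∈ U) : Continuous (pt (A := A) U p hp) :=
  (continuous_val (fun _ : Unit => p) fun _ => hp).comp (TPow.continuous_tprod_update () _)

theorem aug_pt (p : ℂ) (hp : p ∈ U) (a : A) : aug U (pt U p hp a) = a := by
  rw [pt_apply, aug_val, TPow.mulAll_tprod]; simp

/-- An open subset each of whose configurations lies in one disk. -/
def IsDiskLike (U : Opens ℂ) (p : ℂ) : Prop :=
  p ∈ U ∧ ∀ L : DiskConfig, L.support ≤ U →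
    ∃ (z : ℂ) (r : ℝ) (hr : 0 < r), L ≤ single z r hr ∧ p ∈ ball z r ∧
      (single z r hr).support ≤ U

/-- A configuration can be enlarged to a single disk around `p` inside `U`. There all centers may be
moved to `p`, and at a common point the entries are multiplied, which leaves the total product at
`p`. -/
theorem pt_aug {p : ℂ} (hU : IsDiskLike U p) (x : A.Colim U) : pt U p hU.1 (aug U x) = x := by
  induction x using Colim.induction with
  | h₁ x x' hx hx' => simp only [map_add, hx, hx']
  | h₀ L hL x =>
    obtain ⟨z, r, hr, hLM, hp, hM⟩ := hU.2 L hL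
    rw [aug_inc, pt_apply, ← TPow.push_unit, val_push, inc_eq_val]
    refine val_congr (single z r hr) hM _ _ (fun i => ⟨(z, r), Finset.mem_singleton_self _, hp, ?_⟩)
      _ _ x
    exact (mem_support_single hr).1 (hLM (L.center_mem_support i))

theorem isDiskLike_disk {z : ℂ} {r : ℝ} (hr : 0 < r) : IsDiskLike (EquivPFA.disk z r) z := by
  refine ⟨mem_ball_self hr, fun L hL => ⟨z, r, hr, fun w hw => ?_, mem_ball_self hr, fun w hw => ?_⟩⟩
  · exact (mem_support_single hr).2 (hL hw)
  · exact (mem_support_single hr).1 hw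

/-- A finite union of disks is bounded, hence contained in a large disk about the origin. -/
theorem isDiskLike_top : IsDiskLike ⊤ 0 := by
  refine ⟨trivial, fun L _ => ?_⟩
  have hb : Bornology.IsBounded (L.support : Set ℂ) :=
    (Bornology.isBounded_biUnion_finset L.disks).2 fun _ _ => isBounded_ball
  obtain ⟨r, hr⟩ := hb.subset_ball_lt 0 0
  exact ⟨0, r, hr.1, fun w hw => (mem_support_single hr.1).2 (hr.2 hw), mem_ball_self hr.1, le_top⟩

theorem aug_bijective {p : ℂ} (hU : IsDiskLike U p) : Function.Bijective (aug (A := A) U) :=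
  Function.bijective_iff_has_inverse.2 ⟨pt U p hU.1, pt_aug hU, aug_pt p hU.1⟩

/-- `F(U)` is isomorphic to `A`, for instance if `U` is a disk. -/
def augEquiv {p : ℂ} (hU : IsDiskLike U p) : A.Colim U ≃L[ℂ] A where
  toLinearEquiv := LinearEquiv.ofLinearMap (aug U).toLinearMap (pt U p hU.1)
    (LinearMap.ext fun a => aug_pt p hU.1 a) (LinearMap.ext fun x => pt_aug hU x)
  continuous_toFun := (aug U).continuous
  continuous_invFun := continuous_pt p hU.1

/-- Structure maps commute with `aug`, so they become the identity of `A` after both sides are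
identified with `A`. -/
theorem isHomeomorph_res {p q : ℂ} (hU : IsDiskLike U p) (hV : IsDiskLike V q) (h : U ≤ V) :
    IsHomeomorph (res (A := A) h) := by
  have e : (res (A := A) h : A.Colim U → A.Colim V) =
      (augEquiv hU).toHomeomorph.trans (augEquiv hV).symm.toHomeomorph := by
    funext x
    refine (aug_bijective hV).1 ?_
    rw [aug_res]
    exact (aug_pt q hV.1 _).symm
  rw [e]
  exact Homeomorph.isHomeomorph _

end Colim

theorem isLocallyConstant_toPFA (A : MotionAlg.{u}) : A.toPFA.IsLocallyConstant where
  finite_radius _ _ _ _ h hr hrR :=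
    Colim.isHomeomorph_res (Colim.isDiskLike_disk hr) (Colim.isDiskLike_disk (hr.trans hrR)) h
  infinite_radius _ _ hr := Colim.isHomeomorph_res (Colim.isDiskLike_disk hr) Colim.isDiskLike_top le_top

end MotionAlg

end CFact

namespace CFact

namespace MotionAlg

namespace Colim

open DiskConfig

variable {A : MotionAlg.{u}} {U V W : Opens ℂ} {ι κ : Type}

/-! ### Descent along Weiss covers -/

section Descent

variable {I : Type} {𝒰 : I → Opens ℂ} {E : LCS.{u}}

theorem exists_index (h𝒰 : EquivPFA.IsWeissCover U 𝒰) [Finite ι] (q : ι → ℂ) (hq : ∀ k, q k ∈ U) :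
    ∃ i, ∀ k, q k ∈ 𝒰 i := by
  obtain ⟨i, hi⟩ := h𝒰.2 (Set.range q) (Set.finite_range q) (by rintro _ ⟨k, rfl⟩; exact hq k)
  exact ⟨i, fun k => hi ⟨k, rfl⟩⟩

/-- The map on `A^{⊗ι}`, placed at points of `U`, that is given by compatible maps on the members
of a Weiss cover. -/
def glue (h𝒰 : EquivPFA.IsWeissCover U 𝒰) (f : ∀ i, A.Colim (𝒰 i) →L[ℂ] E) [Fintype ι] (q : ι → ℂ)
    (hq : ∀ k, q k ∈ U) : TPow ι A →ₗ[ℂ] E :=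
  (f (exists_index h𝒰 q hq).choose).toLinearMap ∘ₗ val _ q (exists_index h𝒰 q hq).choose_spec

theorem continuous_glue (h𝒰 : EquivPFA.IsWeissCover U 𝒰) (f : ∀ i, A.Colim (𝒰 i) →L[ℂ] E)
    [Fintype ι] (q : ι → ℂ) (hq : ∀ k, q k ∈ U) : Continuous (glue h𝒰 f q hq) :=
  (f _).continuous.comp (continuous_val q (exists_index h𝒰 q hq).choose_spec)

variable (h𝒰 : EquivPFA.IsWeissCover U 𝒰) {f : ∀ i, A.Colim (𝒰 i) →L[ℂ] E}
  (hf : ∀ (i j : I) (x : A.Colim (𝒰 i ⊓ 𝒰 j)),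
      f i (res inf_le_left x) = f j (res inf_le_right x))

include hf

/-- The points lie in the intersection of `𝒰 i` with the chosen member of the cover, and on this
intersection the two maps agree. -/
theorem glue_eq [Fintype ι] (q : ι → ℂ) (hq : ∀ k, q k ∈ U) (i : I) (hi : ∀ k, q k ∈ 𝒰 i)
    (x : TPow ι A) : glue h𝒰 f q hq x = f i (val (𝒰 i) q hi x) := by
  have hj := (exists_index h𝒰 q hq).choose_spec
  have hij : ∀ k, q k ∈ 𝒰 (exists_index h𝒰 q hq).choose ⊓ 𝒰 i := fun k => ⟨hj k, hi k⟩
  have h := hf (exists_index h𝒰 q hq).choose i (val _ q hij x)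
  exact (congrArg _ (res_val inf_le_left q hij x).symm).trans
    (h.trans (congrArg _ (res_val inf_le_right q hij x)))

theorem glue_push [Fintype ι] [Fintype κ] [DecidableEq κ] (p : ι → κ) (q : κ → ℂ)
    (hq : ∀ k, q k ∈ U) (x : TPow ι A) :
    glue h𝒰 f q hq (TPow.push p (AlgHom.id ℂ A) x) =
      glue h𝒰 f (fun k => q (p k)) (fun _ => hq _) x := by
  obtain ⟨i, hi⟩ := exists_index h𝒰 q hq
  rw [glue_eq h𝒰 hf _ _ i hi, glue_eq h𝒰 hf _ _ i fun _ => hi _, val_push]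

/-- A disk of `L` need not lie in a member of the cover, so `val_congr` does not apply to it
directly. Each point is moved along a segment in its disk. For nearby parameters the points stay in
small disks inside one member, so the value is locally constant on the unit interval, and therefore
constant. -/
theorem glue_congr [Fintype ι] (L : DiskConfig) (hL : L.support ≤ U) (q q' : ι → ℂ)
    (h : ∀ k, ∃ d ∈ L.disks, q k ∈ ball d.1 d.2 ∧ q' k ∈ ball d.1 d.2)
    (hq : ∀ k, q k ∈ U) (hq' : ∀ k, q' k ∈ U) (x : TPow ι A) :
    glue h𝒰 f q hq x = glue h𝒰 f q' hq' x := by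
  let γ : ι → ℝ → ℂ := fun k => AffineMap.lineMap (q k) (q' k)
  have hγ : ∀ k, Continuous (γ k) := fun k => AffineMap.lineMap_continuous
  have hγU : ∀ (t : unitInterval) k, γ k t ∈ U := by
    intro t k
    obtain ⟨d, hd, h₁, h₂⟩ := h k
    refine hL (mem_support.2 ⟨d, hd, ?_⟩)
    exact (convex_ball d.1 d.2).segment_subset h₁ h₂
      (by rw [segment_eq_image_lineMap]; exact ⟨t, t.2, rfl⟩)
  have hc : IsLocallyConstant fun t : unitInterval => glue h𝒰 f (fun k => γ k t) (hγU t) x := by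
    rw [IsLocallyConstant.iff_eventually_eq]
    intro t
    obtain ⟨i, hi⟩ := exists_index h𝒰 _ (hγU t)
    obtain ⟨N, hN, hqN⟩ := exists_config' _ (𝒰 i) hi
    have he : ∀ᶠ s : unitInterval in 𝓝 t, ∀ k, ∃ d ∈ N.disks,
        γ k s ∈ ball d.1 d.2 ∧ γ k t ∈ ball d.1 d.2 := by
      rw [Filter.eventually_all]
      intro k
      obtain ⟨d, hd, hkd⟩ := mem_support.1 (hqN k)
      have hcont : Continuous fun s : unitInterval => γ k s := (hγ k).comp continuous_subtype_val
      filter_upwards [hcont.continuousAt.preimage_mem_nhds (isOpen_ball.mem_nhds hkd)] with s hs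
      exact ⟨d, hd, hs, hkd⟩
    filter_upwards [he] with s hs
    have hsi : ∀ k, γ k s ∈ 𝒰 i := fun k => by
      obtain ⟨d, hd, h₁, _⟩ := hs k
      exact hN (mem_support.2 ⟨d, hd, h₁⟩)
    rw [glue_eq h𝒰 hf _ _ i hi, glue_eq h𝒰 hf _ _ i hsi, val_congr N hN _ _ hs]
  have h01 := hc.apply_eq_of_preconnectedSpace 0 1
  simpa [γ] using h01

/-- The maps `glue` at the centers of disks are compatible with `L ≤ M`: a transition map leads to
the centers of the parent disks, and from there the points are moved inside the disks of `M` to the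
centers of `L`. Uniqueness holds because every tensor at points of `U` comes from a member of the
cover. -/
theorem descent : ∃! g : A.Colim U →L[ℂ] E, ∀ (i : I) (x : A.Colim (𝒰 i)),
    g (res (h𝒰.1 i) x) = f i x := by
  refine ⟨liftL (fun L hL => glue h𝒰 f L.center fun d => hL (L.center_mem_support d)) ?_
    fun _ _ => continuous_glue _ _ _ _, ?_, ?_⟩
  · intro L M hLM hL hM x
    rw [ext, glue_push h𝒰 hf]
    refine glue_congr h𝒰 hf M hM _ _ (fun d => ⟨_, (parent hLM d).2, M.center_mem _, ?_⟩) _ _ x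
    exact subset_parent hLM d (L.center_mem d)
  · intro i x
    induction x using Colim.induction with
    | h₁ x x' hx hx' => simp only [map_add, hx, hx']
    | h₀ L hL x =>
      rw [res_inc, liftL_inc, glue_eq h𝒰 hf _ _ i fun d => hL (L.center_mem_support d),
        ← inc_eq_val]
  · intro g hg
    refine ContinuousLinearMap.ext fun x => ?_
    induction x using Colim.induction with
    | h₁ x x' hx hx' => simp only [map_add, hx, hx']
    | h₀ L hL x =>
      obtain ⟨i, hi⟩ := exists_index h𝒰 L.center fun d => hL (L.center_mem_support d)
      rw [liftL_inc, glue_eq h𝒰 hf _ _ i hi, ← hg, res_val, inc_eq_val]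

end Descent

/-! ### The multiplication for disjoint open sets is an isomorphism -/

section Multiplicativity

/-- Over the union of a configuration around `q` and one around `q'`, the entry at each disk is a
product over `ι ⊕ κ`, which splits into the two contributions. The joint family `r` is a separate
argument, so that it may come from `Sum.elim` or from a reindexing by `Equiv.sumCompl`. -/
theorem mulBilin_val [Fintype ι] [Fintype κ] (hd : Disjoint U V) (h : U ⊔ V ≤ W) (q : ι → ℂ)
    (hq : ∀ i, q i ∈ U) (q' : κ → ℂ) (hq' : ∀ k, q' k ∈ V) (r : ι ⊕ κ → ℂ) (hr : ∀ i, r i ∈ W)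
    (hrq : ∀ i, r (Sum.inl i) = q i) (hrq' : ∀ k, r (Sum.inr k) = q' k) (a : ι ⊕ κ → A) :
    mulBilin hd h (val U q hq (TPow.tprod fun i => a (Sum.inl i)))
        (val V q' hq' (TPow.tprod fun k => a (Sum.inr k))) =
      val W r hr (TPow.tprod a) := by
  classical
  obtain ⟨L, hL, hqL⟩ := exists_config' q U hq
  obtain ⟨M, hM, hqM⟩ := exists_config' q' V hq'
  have hLM := disjoint_support hd hL hM
  have hrN : ∀ i, r i ∈ (L.union M hLM).support := by
    rintro (i | k)
    · rw [hrq]; exact left_le_union L M hLM (hqL i)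
    · rw [hrq']; exact right_le_union L M hLM (hqM k)
  rw [val_eq _ _ L hL hqL, val_eq _ _ M hM hqM,
    mulBilin_inc' hd h hL hM (left_le_union L M hLM) (right_le_union L M hLM)
      (union_le hLM h hL hM), ext, ext, TPow.push_push, TPow.push_push,
    val_eq _ _ (L.union M hLM) (union_le hLM h hL hM) hrN, TPow.push_tprod, TPow.push_tprod,
    TPow.push_tprod, TPow.tprod_mul]
  congr 2
  funext e
  simp only [Pi.mul_apply, AlgHom.comp_apply, AlgHom.id_apply, Finset.prod_filter]
  rw [Fintype.prod_sum_type]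
  have h₁ : ∀ i, (L.union M hLM).locate r hrN (Sum.inl i) =
      parent (left_le_union L M hLM) (L.locate q hqL i) := fun i => by
    refine locate_eq _ ?_
    rw [hrq]
    exact subset_parent _ _ (L.mem_locate q hqL i)
  have h₂ : ∀ k, (L.union M hLM).locate r hrN (Sum.inr k) =
      parent (right_le_union L M hLM) (M.locate q' hqM k) := fun k => by
    refine locate_eq _ ?_
    rw [hrq']
    exact subset_parent _ _ (M.mem_locate q' hqM k)
  simp only [h₁, h₂]

open Classical in
/-- The map `A^{⊗ι} → F(U) ⊗ F(V)` that places the factors at points of `U ⊔ V`, as a multilinear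
map. -/
def splitMultilinear [Fintype ι] (q : ι → ℂ) (hq : ∀ i, q i ∈ U ⊔ V) :
    MultilinearMap ℂ (fun _ : ι => A) (A.Colim U ⊗[ℂ] A.Colim V) :=
  (((val U (fun i : {i // q i ∈ U} => q i) fun i => i.2).compMultilinearMap TPow.tprod).domCoprod
    ((val V (fun i : {i // ¬ q i ∈ U} => q i) fun i =>
      (hq i.1).resolve_left i.2).compMultilinearMap TPow.tprod)).domDomCongr
    (Equiv.sumCompl fun i => q i ∈ U)

open Classical in
theorem splitMultilinear_apply [Fintype ι] (q : ι → ℂ) (hq : ∀ i, q i ∈ U ⊔ V) (a : ι → A) :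
    splitMultilinear q hq a =
      val U (fun i : {i // q i ∈ U} => q i) (fun i => i.2) (TPow.tprod fun i => a i) ⊗ₜ
        val V (fun i : {i // ¬ q i ∈ U} => q i) (fun i => (hq i.1).resolve_left i.2)
          (TPow.tprod fun i => a i) := rfl

/-- The map `A^{⊗ι} → F(U) ⊗ F(V)` that places the factors at points of `U ⊔ V`. -/
def split [Fintype ι] (q : ι → ℂ) (hq : ∀ i, q i ∈ U ⊔ V) :
    TPow ι A →ₗ[ℂ] A.Colim U ⊗[ℂ] A.Colim V :=
  TPow.lift (splitMultilinear q hq)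

/-- The value of `split` can be computed with any decomposition of the index set. -/
theorem split_tprod_sum [Fintype ι] [Fintype κ] (hd : Disjoint U V) (q : ι → ℂ)
    (hq : ∀ i, q i ∈ U) (q' : κ → ℂ) (hq' : ∀ k, q' k ∈ V) {μ : Type} [Fintype μ] (e : ι ⊕ κ ≃ μ)
    (r : μ → ℂ) (hr : ∀ i, r i ∈ U ⊔ V) (hrq : ∀ i, r (e (Sum.inl i)) = q i)
    (hrq' : ∀ k, r (e (Sum.inr k)) = q' k) (a : μ → A) :
    split r hr (TPow.tprod a) =
      val U q hq (TPow.tprod fun i => a (e (Sum.inl i))) ⊗ₜ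
        val V q' hq' (TPow.tprod fun k => a (e (Sum.inr k))) := by
  classical
  have hV : ∀ {w : ℂ}, w ∈ V → ¬ w ∈ U := fun hw hw' => by
    rw [← Opens.coe_disjoint] at hd
    exact Set.disjoint_left.1 hd hw' hw
  -- As `V` misses `U`, the bijection `e` matches `ι` with the indices of points in `U` and `κ` with
  -- the remaining ones.
  let e₁ : ι ≃ {i // r i ∈ U} := Equiv.ofBijective
    (fun i => ⟨e (Sum.inl i), by rw [hrq]; exact hq i⟩)
    ⟨fun i j h => by simpa using h, fun ⟨m, hm⟩ => by
      obtain ⟨i | k, rfl⟩ := e.surjective m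
      · exact ⟨i, rfl⟩
      · rw [hrq'] at hm; exact absurd hm (hV (hq' k))⟩
  let e₂ : κ ≃ {i // ¬ r i ∈ U} := Equiv.ofBijective
    (fun k => ⟨e (Sum.inr k), by rw [hrq']; exact hV (hq' k)⟩)
    ⟨fun i j h => by simpa using h, fun ⟨m, hm⟩ => by
      obtain ⟨i | k, rfl⟩ := e.surjective m
      · rw [hrq] at hm; exact absurd (hq i) hm
      · exact ⟨k, rfl⟩⟩
  rw [split, TPow.lift_tprod, splitMultilinear_apply, val_reindex e₁, val_reindex e₂]
  have h₁ : (fun i => r (e₁ i)) = q := funext hrq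
  have h₂ : (fun i => r (e₂ i)) = q' := funext hrq'
  congr 1
  · congr 1
    simp only [h₁]
  · congr 1
    simp only [h₂]

/-- A disk is connected, so two disjoint open sets that cover it cannot both meet it. -/
theorem ball_subset_or (hd : Disjoint U V) {z : ℂ} {r : ℝ} (h : ball z r ⊆ ((U ⊔ V : Opens ℂ) : Set ℂ)) :
    ball z r ⊆ (U : Set ℂ) ∨ ball z r ⊆ (V : Set ℂ) := by
  rcases (ball z r).eq_empty_or_nonempty with he | ⟨w, hw⟩
  · rw [he]; exact Or.inl (Set.empty_subset _)
  rw [← Opens.coe_disjoint] at hd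
  have hc := (convex_ball z r).isPreconnected
  rcases h hw with hU | hV
  · exact Or.inl (hc.subset_left_of_subset_union U.2 V.2 hd h ⟨w, hw, hU⟩)
  · exact Or.inr (hc.subset_right_of_subset_union U.2 V.2 hd h ⟨w, hw, hV⟩)

open Classical in
/-- The disks of a configuration that lie in a given open set. -/
def _root_.CFact.DiskConfig.within (L : DiskConfig) (U : Opens ℂ) : DiskConfig where
  disks := {d ∈ L.disks | ball d.1 d.2 ⊆ (U : Set ℂ)}
  radius_pos d hd := L.radius_pos d (Finset.mem_filter.1 hd).1
  disjoint d hd e he := L.disjoint d (Finset.mem_filter.1 hd).1 e (Finset.mem_filter.1 he).1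

theorem support_within_le (L : DiskConfig) (U : Opens ℂ) : (L.within U).support ≤ U := by
  classical
  intro w hw
  obtain ⟨d, hd, hwd⟩ := mem_support.1 hw
  exact (Finset.mem_filter.1 hd).2 hwd

/-- Every disk of `L` lies in `U` or in `V`, so a point that moves inside its disk stays on its
side. On each side `val_congr` applies to those disks of `L` that lie there. -/
theorem split_congr [Fintype ι] (hd : Disjoint U V) (L : DiskConfig) (hL : L.support ≤ U ⊔ V)
    (q q' : ι → ℂ) (h : ∀ i, ∃ d ∈ L.disks, q i ∈ ball d.1 d.2 ∧ q' i ∈ ball d.1 d.2)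
    (hq : ∀ i, q i ∈ U ⊔ V) (hq' : ∀ i, q' i ∈ U ⊔ V) (x : TPow ι A) :
    split (U := U) q hq x = split q' hq' x := by
  classical
  have hV : ∀ {w : ℂ}, w ∈ V → ¬ w ∈ U := fun hw hw' => by
    rw [← Opens.coe_disjoint] at hd
    exact Set.disjoint_left.1 hd hw' hw
  have hsub : ∀ d ∈ L.disks, ball d.1 d.2 ⊆ (U : Set ℂ) ∨ ball d.1 d.2 ⊆ (V : Set ℂ) :=
    fun d hdL => ball_subset_or hd ((L.ball_subset ⟨d, hdL⟩).trans hL)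
  have h₁ : ∀ i : {i // q i ∈ U}, ∃ d ∈ (L.within U).disks,
      q i ∈ ball d.1 d.2 ∧ q' i ∈ ball d.1 d.2 := by
    rintro ⟨i, hi⟩
    obtain ⟨d, hdL, hqd, hqd'⟩ := h i
    refine ⟨d, Finset.mem_filter.2 ⟨hdL, (hsub d hdL).resolve_right fun hs => ?_⟩, hqd, hqd'⟩
    exact hV (hs hqd) hi
  have h₂ : ∀ i : {i // ¬ q i ∈ U}, ∃ d ∈ (L.within V).disks,
      q i ∈ ball d.1 d.2 ∧ q' i ∈ ball d.1 d.2 := by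
    rintro ⟨i, hi⟩
    obtain ⟨d, hdL, hqd, hqd'⟩ := h i
    exact ⟨d, Finset.mem_filter.2 ⟨hdL, (hsub d hdL).resolve_left fun hs => hi (hs hqd)⟩, hqd, hqd'⟩
  have hmem : ∀ {W : Opens ℂ} {w : ℂ}, (∃ d ∈ (L.within W).disks, w ∈ ball d.1 d.2) → w ∈ W :=
    fun {W w} hw => support_within_le L W (mem_support.2 hw)
  induction x using TPow.induction with
  | h₁ x x' hx hx' => simp only [map_add, hx, hx']
  | h₂ c x hx => simp only [map_smul, hx]
  | h₀ a =>
    rw [split_tprod_sum hd (fun i : {i // q i ∈ U} => q' i)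
      (fun i => hmem ((h₁ i).imp fun d h => ⟨h.1, h.2.2⟩))
      (fun i : {i // ¬ q i ∈ U} => q' i)
      (fun i => hmem ((h₂ i).imp fun d h => ⟨h.1, h.2.2⟩))
      (Equiv.sumCompl fun i => q i ∈ U) q' hq' (fun _ => rfl) (fun _ => rfl) a, split,
      TPow.lift_tprod, splitMultilinear_apply]
    congr 1
    · exact val_congr _ (support_within_le L U) _ _ h₁ _ _ _
    · exact val_congr _ (support_within_le L V) _ _ h₂ _ _ _

/-- Over an index that satisfies `P`, the restriction of `p` to `{i // P (p i)}` has the same fibre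
as `p`. In `split_push` this shows that `push p` restricts to a `push` on each side. -/
theorem prod_fiber_subtype {M : Type*} [CommMonoid M] [Fintype ι] [DecidableEq κ] (p : ι → κ)
    (P : κ → Prop) [Fintype {i // P (p i)}] (j : {k // P k}) (a : ι → M) :
    ∏ i ∈ Finset.univ.filter (fun i : {i // P (p i)} => (⟨p i.1, i.2⟩ : {k // P k}) = j), a i.1 =
      ∏ i with p i = j, a i := by
  refine Finset.prod_bij (fun i _ => i.1) ?_ ?_ ?_ ?_
  · intro i hi
    simp only [Finset.mem_filter, Finset.mem_univ, true_and] at hi ⊢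
    rw [← hi]
  · intro i _ i' _ h
    exact Subtype.ext h
  · intro i hi
    simp only [Finset.mem_filter, Finset.mem_univ, true_and] at hi
    refine ⟨⟨i, by rw [hi]; exact j.2⟩, ?_, rfl⟩
    simp only [Finset.mem_filter, Finset.mem_univ, true_and]
    exact Subtype.ext hi
  · intro i _
    rfl

theorem split_push [Fintype ι] [Fintype κ] [DecidableEq κ] (p : ι → κ)
    (q : κ → ℂ) (hq : ∀ i, q i ∈ U ⊔ V) (x : TPow ι A) :
    split (U := U) q hq (TPow.push p (AlgHom.id ℂ A) x) =
      split (fun i => q (p i)) (fun _ => hq _) x := by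
  classical
  induction x using TPow.induction with
  | h₁ x x' hx hx' => simp only [map_add, hx, hx']
  | h₂ c x hx => simp only [map_smul, hx]
  | h₀ a =>
    rw [TPow.push_tprod, split, split, TPow.lift_tprod, TPow.lift_tprod, splitMultilinear_apply,
      splitMultilinear_apply]
    have h : ∀ (P : κ → Prop) [Fintype {i // P (p i)}], (TPow.tprod fun j : {j // P j} =>
        ∏ i with p i = j, AlgHom.id ℂ A (a i)) =
          TPow.push (fun i : {i // P (p i)} => (⟨p i, i.2⟩ : {j // P j})) (AlgHom.id ℂ A)
            (TPow.tprod fun i => a i) := by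
      intro P _
      rw [TPow.push_tprod]
      congr 1
      funext j
      exact (prod_fiber_subtype p P j a).symm
    rw [h fun j => q j ∈ U, h fun j => ¬ q j ∈ U, val_push, val_push]

theorem mulBilin_split [Fintype ι] (hd : Disjoint U V) (q : ι → ℂ) (hq : ∀ i, q i ∈ U ⊔ V)
    (x : TPow ι A) :
    TensorProduct.lift (mulBilin hd le_rfl) (split q hq x) = val (U ⊔ V) q hq x := by
  classical
  induction x using TPow.induction with
  | h₁ x x' hx hx' => simp only [map_add, hx, hx']
  | h₂ c x hx => simp only [map_smul, hx]
  | h₀ a =>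
    rw [split, TPow.lift_tprod, splitMultilinear_apply, TensorProduct.lift.tmul,
      val_reindex (Equiv.sumCompl fun i => q i ∈ U) q hq a]
    exact mulBilin_val hd le_rfl _ _ _ _ (fun i => q (Equiv.sumCompl (fun i => q i ∈ U) i)) _
      (fun _ => rfl) (fun _ => rfl) fun i => a (Equiv.sumCompl (fun i => q i ∈ U) i)

theorem continuous_tmul_left {X Y : LCS.{u}} (y : Y) :
    Continuous fun x : X => (LCS.tmul x y : X.tensor Y) :=
  continuous_sInf_rng.2 fun _ ht => ht.2.2 y

theorem continuous_tmul_right {X Y : LCS.{u}} (x : X) :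
    Continuous fun y : Y => (LCS.tmul x y : X.tensor Y) :=
  continuous_sInf_rng.2 fun _ ht => ht.2.1 x

/-- The topology of `TPow ι A` tests one entry at a time. The varied entry sits in exactly one of
the two tensor factors, so separate continuity of the inductive tensor product suffices. -/
theorem continuous_split [Fintype ι] (q : ι → ℂ) (hq : ∀ i, q i ∈ U ⊔ V) :
    Continuous[_, inductiveTensorTopology (toLCS A U) (toLCS A V)] (split (A := A) q hq) := by
  classical
  let T := (toLCS A U).tensor (toLCS A V)
  refine @TPow.continuous_of_tprod ι A T T.addCommGroup T.module T.topology T.isTopologicalAddGroup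
    T.continuousSMul T.locallyConvex (split q hq) fun {_} i a => ?_
  refine @Continuous.congr A T _ T.topology
    (fun x : A => splitMultilinear (U := U) (V := V) q hq (Function.update a i x)) _ ?_
    fun x => (TPow.lift_tprod (splitMultilinear q hq) _).symm
  by_cases hi : q i ∈ U
  · have h : ∀ x : A, splitMultilinear (U := U) q hq (Function.update a i x) =
        LCS.tmul (X := toLCS A U) (Y := toLCS A V)
          (val U (fun i : {i // q i ∈ U} => q i) (fun i => i.2)
            (TPow.tprod (Function.update (fun i => a i.1) ⟨i, hi⟩ x)))
          (val V (fun i : {i // ¬ q i ∈ U} => q i) (fun i => (hq i.1).resolve_left i.2)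
          (TPow.tprod fun i => a i)) := by
      intro x
      rw [splitMultilinear_apply, LCS.tmul]
      congr 3
      · funext k
        by_cases hk : k = ⟨i, hi⟩
        · subst hk; simp
        · rw [Function.update_of_ne hk, Function.update_of_ne fun h => hk (Subtype.ext h)]
      · funext k
        rw [Function.update_of_ne]
        intro h
        exact k.2 (h ▸ hi)
    refine @Continuous.congr A T _ T.topology _ _ ?_ fun x => (h x).symm
    exact (continuous_tmul_left _).comp
      ((continuous_val _ _).comp (TPow.continuous_tprod_update _ _))
  · have h : ∀ x : A, splitMultilinear (U := U) q hq (Function.update a i x) =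
        LCS.tmul (X := toLCS A U) (Y := toLCS A V)
          (val U (fun i : {i // q i ∈ U} => q i) (fun i => i.2) (TPow.tprod fun i => a i))
          (val V (fun i : {i // ¬ q i ∈ U} => q i) (fun i => (hq i.1).resolve_left i.2)
          (TPow.tprod (Function.update (fun i => a i.1) ⟨i, hi⟩ x))) := by
      intro x
      rw [splitMultilinear_apply, LCS.tmul]
      congr 3
      · funext k
        rw [Function.update_of_ne]
        intro h
        exact hi (h ▸ k.2)
      · funext k
        by_cases hk : k = ⟨i, hi⟩
        · subst hk; simp
        · rw [Function.update_of_ne hk, Function.update_of_ne fun h => hk (Subtype.ext h)]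
    refine @Continuous.congr A T _ T.topology _ _ ?_ fun x => (h x).symm
    exact (continuous_tmul_right _).comp
      ((continuous_val _ _).comp (TPow.continuous_tprod_update _ _))

/-- The inverse of the multiplication `F(U) ⊗ F(V) → F(U ⊔ V)`. -/
def comul (hd : Disjoint U V) : A.Colim (U ⊔ V) →L[ℂ] (toLCS A U).tensor (toLCS A V) :=
  liftL (E := (toLCS A U).tensor (toLCS A V))
    (fun L hL => split L.center fun d => hL (L.center_mem_support d))
    (fun L M hLM hL hM x => by
      rw [ext]
      refine (split_push _ _ _ x).trans ?_
      refine split_congr hd M hM _ _ (fun d => ⟨_, (parent hLM d).2, M.center_mem _, ?_⟩) _ _ x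
      exact subset_parent hLM d (L.center_mem d))
    fun _ _ => continuous_split _ _

theorem comul_val [Fintype ι] (hd : Disjoint U V) (q : ι → ℂ) (hq : ∀ i, q i ∈ U ⊔ V)
    (x : TPow ι A) : comul hd (val (U ⊔ V) q hq x) = split q hq x := by
  classical
  obtain ⟨L, hL, hqL⟩ := exists_config' q _ hq
  rw [val_eq _ _ L hL hqL, comul]
  refine (liftL_inc (E := (toLCS A U).tensor (toLCS A V)) _ _ _ L hL _).trans ?_
  refine (split_push _ _ _ x).trans ?_
  exact split_congr hd L hL _ _ (fun i => ⟨_, (L.locate q hqL i).2, L.center_mem _,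
    L.mem_locate q hqL i⟩) _ _ x

/-- By linearity only pure tensors at centers matter: `mulBilin_val` merges the two families of
points, and `split_tprod_sum` separates them again. -/
theorem comul_mulBilin (hd : Disjoint U V) (x : A.Colim U) (y : A.Colim V) :
    comul hd (mulBilin hd le_rfl x y) = LCS.tmul (X := toLCS A U) (Y := toLCS A V) x y := by
  induction x using Colim.induction with
  | h₁ x x' hx hx' =>
    simp only [map_add, LinearMap.add_apply, hx, hx']
    exact (TensorProduct.add_tmul x x' y).symm
  | h₀ L hL x =>
    induction y using Colim.induction with
    | h₁ y y' hy hy' =>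
      simp only [map_add, hy, hy']
      exact (TensorProduct.tmul_add _ y y').symm
    | h₀ M hM y =>
      rw [inc_eq_val, inc_eq_val]
      induction x using TPow.induction with
      | h₁ x x' hx hx' =>
        simp only [map_add, LinearMap.add_apply, hx, hx']
        exact (TensorProduct.add_tmul _ _ _).symm
      | h₂ c x hx =>
        simp only [map_smul, LinearMap.smul_apply, hx]
        exact (TensorProduct.smul_tmul' c _ _)
      | h₀ a =>
        induction y using TPow.induction with
        | h₁ y y' hy hy' =>
          simp only [map_add, hy, hy']
          exact (TensorProduct.tmul_add _ _ _).symm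
        | h₂ c y hy =>
          simp only [map_smul, hy]
          exact (TensorProduct.tmul_smul c _ _).symm
        | h₀ b =>
          have hc : ∀ i, Sum.elim L.center M.center i ∈ U ⊔ V := by
            rintro (i | k)
            · exact Or.inl (hL (L.center_mem_support i))
            · exact Or.inr (hM (M.center_mem_support k))
          refine (congrArg _ (mulBilin_val hd le_rfl _ _ _ _ (Sum.elim L.center M.center) hc
            (fun _ => rfl) (fun _ => rfl) (Sum.elim a b))).trans ?_
          rw [comul_val]
          exact split_tprod_sum hd _ _ _ _ (Equiv.refl _) _ hc (fun _ => rfl) (fun _ => rfl)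
            (Sum.elim a b)

theorem isHomeomorph_mulL (hd : Disjoint U V) :
    IsHomeomorph (mulL (A := A) hd (le_refl (U ⊔ V))) := by
  refine isHomeomorph_iff_exists_inverse.2 ⟨(mulL hd le_rfl).continuous, comul hd, ?_, ?_,
    (comul hd).continuous⟩
  · intro t
    refine TensorProduct.induction_on (R := ℂ) (M := A.Colim U) (N := A.Colim V)
      (motive := fun t => comul hd (mulL hd le_rfl t) = t) t ?_ ?_ ?_
    · exact (congrArg _ (map_zero (mulL hd le_rfl))).trans (map_zero (comul hd))
    · intro x y
      exact (congrArg _ (mulL_tmul hd le_rfl x y)).trans (comul_mulBilin hd x y)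
    · intro s t hs ht
      refine (congrArg _ (map_add (mulL hd le_rfl) _ _)).trans ?_
      exact (map_add (comul hd) _ _).trans (congrArg₂ _ hs ht)
  · intro x
    induction x using Colim.induction with
    | h₁ x x' hx hx' => rw [map_add, map_add, hx, hx']
    | h₀ L hL x =>
      rw [inc_eq_val, comul_val]
      exact mulBilin_split hd _ _ _

end Multiplicativity

end Colim

theorem isFactorizationAlgebra_toPFA (A : MotionAlg.{u}) : A.toPFA.IsFactorizationAlgebra where
  descent _ _ _ h𝒰 _ _ hf := Colim.descent h𝒰 hf
  mul_iso _ _ hd := Colim.isHomeomorph_mulL hd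

end MotionAlg

end CFact

/-! ### Weight spaces and products of translated elements, seen through `aug` -/

namespace CFact

namespace MotionAlg

namespace Colim

open DiskConfig EquivPFA

variable {A : MotionAlg.{u}}

theorem aug_rotate {R : ℝ} (q : Circle) (a : A.Colim (disk 0 R)) :
    aug (disk 0 R) (A.toPFA.rotate R q a) = A.θ (rotation q) (aug (disk 0 R) a) :=
  (aug_res (rotation_disk q R).le _).trans (aug_move _ _)

/-- On a disk `aug` is injective and equivariant, so weights can be tested in `A`. -/
theorem mem_weightSpace_iff {R : ℝ} (hR : 0 < R) (Δ : ℤ) (a : A.Colim (disk 0 R)) :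
    a ∈ A.toPFA.weightSpace R Δ ↔
      ∀ q : Circle, A.θ (rotation q) (aug (disk 0 R) a) = ((q : ℂ) ^ Δ) • aug (disk 0 R) a := by
  refine forall_congr' fun q => ?_
  rw [← aug_rotate, ← map_smul]
  exact ((aug_bijective (isDiskLike_disk hR)).1.eq_iff).symm

/-- The structure map is bijective and does not change `aug`, so it preserves and reflects weights.
-/
theorem bijOn_weightSpace {r R : ℝ} (hr : 0 < r) (h : r < R) (Δ : ℤ) :
    Set.BijOn (A.toPFA.res (disk_mono h.le 0)) (A.toPFA.weightSpace r Δ)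
      (A.toPFA.weightSpace R Δ) := by
  have hb : Function.Bijective (res (A := A) (disk_mono h.le 0)) :=
    (isHomeomorph_res (isDiskLike_disk hr) (isDiskLike_disk (hr.trans h)) _).bijective
  have hiff : ∀ a : A.Colim (disk 0 r), res (disk_mono h.le 0) a ∈ A.toPFA.weightSpace R Δ ↔
      a ∈ A.toPFA.weightSpace r Δ := by
    intro a
    rw [mem_weightSpace_iff hr, mem_weightSpace_iff (hr.trans h), aug_res]
  refine ⟨fun a ha => (hiff a).2 ha, hb.1.injOn, fun b hb' => ?_⟩
  obtain ⟨a, rfl⟩ := hb.2 b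
  exact ⟨a, (hiff a).1 hb', rfl⟩

theorem aug_nary (n : ℕ) (U : Fin (n + 1) → Opens ℂ)
    (hU : _root_.Pairwise fun i j => Disjoint (U i) (U j)) (V : Opens ℂ) (hV : ∀ i, U i ≤ V)
    (a : ∀ i, A.Colim (U i)) :
    aug V (A.toPFA.nary n U hU V hV a) = ∏ i, aug (U i) (a i) := by
  induction n generalizing V with
  | zero =>
    rw [Fin.prod_univ_one]
    exact aug_res (hV 0) (a 0)
  | succ n ih =>
    rw [Fin.prod_univ_castSucc, ← ih (fun i => U i.castSucc)
      (fun _ _ hij => hU fun e => hij (Fin.castSucc_injective _ e)) _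
      (fun i => le_iSup (fun i : Fin (n + 1) => U i.castSucc) i) (fun i => a i.castSucc)]
    exact (congrArg _ (mulL_tmul _ _ _ _)).trans
      (aug_mulBilin (iSup_disjoint_iff.2 fun i => hU (Fin.castSucc_lt_last i).ne)
        (sup_le (iSup_le fun i => hV i.castSucc) (hV _)) _ _)

/-- Structure maps preserve `aug`, so the radius `1` can serve as a reference for the whole
compatible family. -/
theorem aug_val_costalk {Δ : ℤ} (a : A.toPFA.CostalkWeight Δ) (r : ℝ) (hr : 0 < r) :
    aug (disk 0 r) (a.val r hr) = aug (disk 0 1) (a.val 1 one_pos) := by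
  have h : ∀ (r R : ℝ) (hr : 0 < r) (h : r < R),
      aug (disk 0 r) (a.val r hr) = aug (disk 0 R) (a.val R (hr.trans h)) := by
    intro r R hr h
    rw [← a.compat r R hr h]
    exact (aug_res (disk_mono h.le 0) (a.val r hr)).symm
  rcases lt_trichotomy r 1 with h₁ | rfl | h₁
  · exact h r 1 hr h₁
  · rfl
  · exact (h 1 r one_pos h₁).symm

/-- The auxiliary small radius in `mu` drops out. What remains is a product in `A` with an explicit
dependence on the points, from which holomorphy can be read off. -/
theorem aug_mu {n : ℕ} {Δ : Fin (n + 1) → ℤ} (a : ∀ i, A.toPFA.CostalkWeight (Δ i)) (R : ℝ)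
    (z : Fin (n + 1) → ℂ) (hz : z ∈ conf (n + 1) R) :
    aug (disk 0 R) (A.toPFA.mu a R z hz) =
      ∏ i, A.θ (translation (z i)) (aug (disk 0 1) ((a i).val 1 one_pos)) := by
  refine (aug_nary n _ _ _ _ _).trans (Finset.prod_congr rfl fun i _ => ?_)
  refine (aug_move _ _).trans ?_
  rw [aug_val_costalk]

end Colim

end MotionAlg

/-! ### Holomorphic functions with values in the completion -/

/-- A criterion for holomorphy in a locally convex space with coordinates. -/
theorem EquivPFA.isHolomorphicOn_of_coordinates {n : ℕ} {U : Set (Fin n → ℂ)} {E : LCS.{u}}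
    {ι : Type*} {κ : ι → Type*} (e : E ≃L[ℂ] (∀ i, κ i → ℂ)) (f : ∀ z ∈ U, E)
    (G : ∀ i, κ i → (Fin n → ℂ) → ℂ) (hG : ∀ i k, Differentiable ℂ (G i k))
    (hf : ∀ z hz i k, e (f z hz) i k = G i k z) : EquivPFA.IsHolomorphicOn U f := by
  intro a ha
  -- The vectors `ξ j` are assembled from the partial derivatives of the coordinate functions.
  -- Convergence can then be tested in each coordinate.
  refine ⟨fun j => e.symm fun i k => fderiv ℂ (G i k) a (Pi.single j 1), ?_⟩
  rw [e.toHomeomorph.isInducing.tendsto_nhds_iff]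
  have h0 : e.toHomeomorph (0 : E) = 0 := map_zero e
  rw [h0, tendsto_pi_nhds]
  intro i
  rw [tendsto_pi_nhds]
  intro k
  have hd := hasFDerivAt_iff_tendsto.1 (hG i k a).hasFDerivAt
  have hd' : Filter.Tendsto (fun z : U => ‖z.1 - a‖⁻¹ *
      ‖G i k z.1 - G i k a - fderiv ℂ (G i k) a (z.1 - a)‖) (𝓝[≠] (⟨a, ha⟩ : U)) (𝓝 0) :=
    hd.comp (continuous_subtype_val.continuousAt.mono_left nhdsWithin_le_nhds)
  refine squeeze_zero_norm' ?_ hd'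
  filter_upwards [self_mem_nhdsWithin] with z hz
  have hz' : z.1 - a ≠ 0 := fun h => hz (Subtype.ext (sub_eq_zero.1 h))
  -- `Fin n → ℂ` carries the sup norm, whereas holomorphy is defined with the Euclidean norm. The
  -- latter is larger, so its difference quotient is bounded by the one of the Fréchet derivative.
  have hle : ‖z.1 - a‖ ≤ Real.sqrt (∑ j, ‖z.1 j - a j‖ ^ 2) := by
    refine (pi_norm_le_iff_of_nonneg (Real.sqrt_nonneg _)).2 fun j => ?_
    refine Real.le_sqrt_of_sq_le ?_
    exact Finset.single_le_sum (f := fun j => ‖z.1 j - a j‖ ^ 2) (fun _ _ => sq_nonneg _)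
      (Finset.mem_univ j)
  have hcoord : ∑ j, (z.1 j - a j) * fderiv ℂ (G i k) a (Pi.single j 1) =
      fderiv ℂ (G i k) a (z.1 - a) := by
    conv_rhs => rw [pi_eq_sum_univ' (z.1 - a), map_sum]
    refine Finset.sum_congr rfl fun j _ => ?_
    rw [map_smul, smul_eq_mul]
    rfl
  have hval : e.toHomeomorph (((Real.sqrt (∑ j, ‖z.1 j - a j‖ ^ 2) : ℝ) : ℂ)⁻¹ •
      (f z.1 z.2 - f a ha -
        ∑ j, (z.1 j - a j) • e.symm fun i k => fderiv ℂ (G i k) a (Pi.single j 1))) i k =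
      ((Real.sqrt (∑ j, ‖z.1 j - a j‖ ^ 2) : ℝ) : ℂ)⁻¹ *
        (G i k z.1 - G i k a - fderiv ℂ (G i k) a (z.1 - a)) := by
    change e (_ • (_ - _ - _)) i k = _
    rw [map_smul, map_sub, map_sub, map_sum, ← hcoord]
    simp [hf, Finset.sum_apply]
  change ‖e.toHomeomorph _ i k‖ ≤ _
  rw [hval, norm_mul, norm_inv, Complex.norm_real, Real.norm_of_nonneg (Real.sqrt_nonneg _)]
  exact mul_le_mul_of_nonneg_right (inv_anti₀ (norm_pos_iff.2 hz') hle) (norm_nonneg _)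

namespace GrDiffAlg

open Completion

variable {D : GrDiffAlg.{u}}

/-- Coordinates on the completion. -/
def coordEquiv (D : GrDiffAlg.{u}) :
    D.Completion ≃L[ℂ] (∀ Δ : ℤ, Fin (Module.finrank ℂ (D.grade Δ)) → ℂ) :=
  ContinuousLinearEquiv.piCongrRight fun Δ =>
    { (Module.finBasis ℂ (D.grade Δ)).equivFun with
      continuous_toFun := IsModuleTopology.continuous_of_linearMap
        (Module.finBasis ℂ (D.grade Δ)).equivFun.toLinearMap
      continuous_invFun := LinearMap.continuous_on_pi
        (Module.finBasis ℂ (D.grade Δ)).equivFun.symm.toLinearMap }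

/-- The functions to `D` that are finite sums of products of a holomorphic function and a constant
vector. -/
def holSpan (D : GrDiffAlg.{u}) (n : ℕ) : Submodule ℂ ((Fin n → ℂ) → D) :=
  Submodule.span ℂ {f | ∃ (p : (Fin n → ℂ) → ℂ) (v : D), Differentiable ℂ p ∧ f = fun z => p z • v}

theorem smul_mem_holSpan {n : ℕ} {p : (Fin n → ℂ) → ℂ} (hp : Differentiable ℂ p) (v : D) :
    (fun z => p z • v) ∈ holSpan D n := Submodule.subset_span ⟨p, v, hp, rfl⟩

/-- `D` as a whole carries no topology here, so holomorphy of `D`-valued functions is expressed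
through `holSpan`. Products of generators are again generators. -/
theorem mul_mem_holSpan {n : ℕ} {f g : (Fin n → ℂ) → D} (hf : f ∈ holSpan D n)
    (hg : g ∈ holSpan D n) : f * g ∈ holSpan D n := by
  have h : f * g ∈ holSpan D n * holSpan D n := Submodule.mul_mem_mul hf hg
  rw [holSpan, Submodule.span_mul_span] at h
  refine Submodule.span_mono ?_ h
  rintro _ ⟨_, ⟨p, v, hp, rfl⟩, _, ⟨p', v', hp', rfl⟩, rfl⟩
  refine ⟨fun z => p z * p' z, v * v', hp.mul hp', ?_⟩
  funext z
  exact smul_mul_smul_comm _ _ _ _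

theorem differentiable_of_mem_holSpan {n : ℕ} {f : (Fin n → ℂ) → D} (hf : f ∈ holSpan D n)
    (φ : D →ₗ[ℂ] ℂ) : Differentiable ℂ fun z => φ (f z) := by
  induction hf using Submodule.span_induction with
  | mem f hf =>
    obtain ⟨p, v, hp, rfl⟩ := hf
    simp only [map_smul, smul_eq_mul]
    exact hp.mul_const _
  | zero => simp
  | add f g _ _ hf hg => simp only [Pi.add_apply, map_add]; exact hf.add hg
  | smul c f _ hf => simp only [Pi.smul_apply, map_smul]; exact hf.const_smul c

/-- A component of a product of two elements of the completion is a finite sum over degrees from `M`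
to `Δ - M`. This range does not depend on the elements, hence not on `z`. -/
theorem coeff_prod_mem_holSpan {n : ℕ} {ι : Type*} (s : Finset ι)
    (F : ι → (Fin n → ℂ) → D.Completion)
    (hF : ∀ i Δ, (fun z => coeff Δ (F i z)) ∈ holSpan D n) (Δ : ℤ) :
    (fun z => coeff Δ (∏ i ∈ s, F i z)) ∈ holSpan D n := by
  classical
  induction s using Finset.induction_on generalizing Δ with
  | empty =>
    simp only [Finset.prod_empty]
    have := smul_mem_holSpan (n := n) (differentiable_const (1 : ℂ)) (coeff Δ (1 : D.Completion))
    simpa using this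
  | insert i s hi ih =>
    obtain ⟨M, hM⟩ := exists_isLB D
    have h : (fun z => coeff Δ (∏ j ∈ insert i s, F j z)) = ∑ Δ' ∈ Finset.Icc M (Δ - M),
        (fun z => coeff Δ' (F i z)) * (fun z => coeff (Δ - Δ') (∏ j ∈ s, F j z)) := by
      funext z
      rw [Finset.prod_insert hi, coeff_mul, Finset.sum_apply]
      refine finsum_eq_sum_of_support_subset _ fun Δ' hΔ' => ?_
      rw [Finset.mem_coe, Finset.mem_Icc]
      by_contra hlt
      refine hΔ' ?_
      rcases lt_or_ge Δ' M with h₁ | h₁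
      · simp only [hM.coeff_eq_zero _ h₁, zero_mul]
      · have h₂ : Δ - Δ' < M := by omega
        simp only [hM.coeff_eq_zero _ h₂, mul_zero]
    rw [h]
    exact Submodule.sum_mem _ fun Δ' _ => mul_mem_holSpan (hF i Δ') (ih _)

/-- Degrees are bounded below, so only finitely many powers of `T` reach degree `Δ`, and the
component is a polynomial in `z i`. -/
theorem coeff_exp_mem_holSpan {n : ℕ} (i : Fin n) (a : D.Completion) (Δ : ℤ) :
    (fun z : Fin n → ℂ => coeff Δ (expMap (z i) a)) ∈ holSpan D n := by
  obtain ⟨M, hM⟩ := exists_isLB D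
  have h : (fun z : Fin n → ℂ => coeff Δ (expMap (z i) a)) =
      ∑ k ∈ Finset.range ((Δ - M).toNat + 1), fun z : Fin n → ℂ =>
        (z i ^ k / (k.factorial : ℂ)) • (D.T ^ k) (coeff (Δ - k) a) := by
    funext z
    rw [coeff_expMap, Finset.sum_apply]
    refine finsum_eq_sum_of_support_subset _ fun k hk => ?_
    rw [Finset.mem_coe, Finset.mem_range]
    by_contra hlt
    have h₂ : Δ - k < M := by omega
    exact hk (by simp only [hM.coeff_eq_zero _ h₂, map_zero, smul_zero])
  rw [h]
  refine Submodule.sum_mem _ fun k _ => smul_mem_holSpan ?_ _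
  fun_prop

theorem θ_translation (z : ℂ) (a : D.Completion) :
    D.toMotionAlg.θ (EquivPFA.translation z) a = expMap z a := by
  change expMap z (rotMap 1 a) = _
  rw [rotMap_id]

theorem θ_rotation (q : Circle) (a : D.Completion) :
    D.toMotionAlg.θ (EquivPFA.rotation q) a = rotMap q a :=
  expMap_zero _

theorem exists_zpow_ne {m n : ℤ} (h : m ≠ n) : ∃ q : Circle, (q : ℂ) ^ m ≠ (q : ℂ) ^ n := by
  -- With this angle the power `q ^ (m - n)` is `-1`, whereas equality of the two powers would make
  -- it `1`.
  refine ⟨Circle.exp (Real.pi / (m - n)), fun he => ?_⟩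
  have hmn : (m : ℂ) - n ≠ 0 := sub_ne_zero.2 (by exact_mod_cast h)
  have h0 := Circle.coe_ne_zero (Circle.exp (Real.pi / (m - n)))
  have h1 : (Circle.exp (Real.pi / (m - n)) : ℂ) ^ (m - n) = 1 := by
    rw [zpow_sub₀ h0, he, div_self (zpow_ne_zero _ h0)]
  rw [Circle.coe_exp, ← Complex.exp_int_mul] at h1
  have h2 : ((m - n : ℤ) : ℂ) * (((Real.pi / (m - n) : ℝ) : ℂ) * Complex.I) =
      Real.pi * Complex.I := by
    push_cast
    field_simp
  rw [h2, Complex.exp_pi_mul_I] at h1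
  norm_num at h1

/-- In degree `Δ'` the rotation acts by `q ^ Δ'`, which differs from `q ^ Δ` for some `q`. Weight
vectors are thus concentrated in one degree. -/
theorem coeff_eq_zero_of_rotMap {Δ Δ' : ℤ} {a : D.Completion}
    (ha : ∀ q : Circle, rotMap q a = ((q : ℂ) ^ Δ) • a) (h : Δ' ≠ Δ) : coeff Δ' a = 0 := by
  obtain ⟨q, hq⟩ := exists_zpow_ne h
  have := congrArg (coeff Δ') (ha q)
  rw [coeff_rotMap, map_smul, ← sub_eq_zero, ← sub_smul] at this
  exact (smul_eq_zero.1 this).resolve_left (sub_ne_zero.2 hq)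

end GrDiffAlg

-- All conditions are transported along `aug`, which identifies `F(D_R(0))` equivariantly with the
-- completion, a product of copies of `ℂ` as a topological vector space.
open MotionAlg Colim GrDiffAlg Completion EquivPFA in
theorem GrDiffAlg.isHolomorphic_toPFA (D : GrDiffAlg.{u}) :
    D.toMotionAlg.toPFA.IsHolomorphic where
  weight_iso r R hr h Δ := bijOn_weightSpace hr h Δ
  weight_bounded R hR := by
    obtain ⟨M, hM⟩ := exists_isLB D
    refine ⟨M, fun Δ hΔ => Set.eq_singleton_iff_unique_mem.2 ⟨?_, fun a ha => ?_⟩⟩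
    · refine (mem_weightSpace_iff hR Δ (0 : D.toMotionAlg.Colim (disk 0 R))).2 fun q => ?_
      simp
    · have ha' := (mem_weightSpace_iff hR Δ _).1 ha
      refine (aug_bijective (isDiskLike_disk hR)).1 ((Completion.ext' fun Δ' => ?_).trans
        (map_zero (aug (A := D.toMotionAlg) (disk 0 R))).symm)
      refine Eq.trans ?_ (map_zero (coeff Δ')).symm
      by_cases h : Δ' = Δ
      · subst h
        exact hM.coeff_eq_zero _ hΔ
      · exact coeff_eq_zero_of_rotMap (fun q => (θ_rotation q _).symm.trans (ha' q)) h
  quasiComplete R hR := by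
    let E := D.toMotionAlg.Colim (disk 0 R)
    let e : E ≃L[ℂ] _ := (augEquiv (isDiskLike_disk hR)).trans (coordEquiv D)
    let : UniformSpace E := IsTopologicalAddGroup.rightUniformSpace E
    have : IsUniformAddGroup E := isUniformAddGroup_of_addCommGroup
    -- A product of copies of `ℂ` is complete, and complete spaces are quasi-complete.
    have : CompleteSpace E := (e.isUniformEmbedding.isUniformInducing.completeSpace_congr
      e.surjective).2 inferInstance
    exact (inferInstance : QuasiCompleteSpace ℂ E)
  hausdorff R hR :=
    ((augEquiv (isDiskLike_disk hR)).trans (coordEquiv D)).toHomeomorph.symm.t2Space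
  holomorphic R hR n Δ a := by
    refine isHolomorphicOn_of_coordinates
      ((augEquiv (A := D.toMotionAlg) (isDiskLike_disk hR)).trans (coordEquiv D)) _
      (fun Δ k z => coordEquiv D (∏ i, expMap (z i)
        (aug (A := D.toMotionAlg) (disk 0 1) ((a i).val 1 one_pos))) Δ k) ?_ ?_
    · intro Δ k
      -- The coordinate is only defined on the graded piece; it is extended to `D` so that it can be
      -- applied to elements of `holSpan`.
      obtain ⟨φ, hφ⟩ := LinearMap.exists_extend
        ((LinearMap.proj k) ∘ₗ (Module.finBasis ℂ (D.grade Δ)).equivFun.toLinearMap)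
      have h := differentiable_of_mem_holSpan (coeff_prod_mem_holSpan Finset.univ
        (fun (i : Fin (n + 1)) (z : Fin (n + 1) → ℂ) => expMap (z i)
          (aug (A := D.toMotionAlg) (disk 0 1) ((a i).val 1 one_pos)))
        (fun i Δ => coeff_exp_mem_holSpan i _ Δ) Δ) φ
      exact (funext fun z => (LinearMap.congr_fun hφ _).symm) ▸ h
    · intro z hz Δ k
      have h := (aug_mu a R z hz).trans (Finset.prod_congr rfl fun i _ => θ_translation (z i) _)
      exact congrFun (congrFun (congrArg (coordEquiv D) h) Δ) k

end CFact

/-! ### Morphisms `F_A → F_B` come from homomorphisms `A → B` -/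

namespace CFact

namespace DiskConfig

theorem parent_val {L M : DiskConfig} (h : L ≤ M) (d : L.disks) (hd : d.1 ∈ M.disks) :
    (parent h d).1 = d.1 :=
  congrArg Subtype.val (parent_eq h d (e := ⟨d.1, hd⟩) (L.center_mem d))

end DiskConfig

namespace MotionAlg

open DiskConfig Colim EquivPFA

variable {A B : MotionAlg.{u}} {U V W : Opens ℂ}

theorem Colim.isDiskLike_support_single {z : ℂ} {r : ℝ} (hr : 0 < r) :
    IsDiskLike (single z r hr).support z :=
  ⟨(mem_support_single hr).2 (mem_ball_self hr),
    fun _ hL => ⟨z, r, hr, hL, mem_ball_self hr, le_rfl⟩⟩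

/-- If the disks of `L` and `M` are the disks of `N`, then pure tensors over `L` and `M` multiply to
a pure tensor over `N`. -/
theorem Colim.mulBilin_inc_tprod {L M N : DiskConfig} (hd : Disjoint L.support M.support)
    (h : L.support ⊔ M.support ≤ U) (hLN : L.disks ⊆ N.disks) (hMN : M.disks ⊆ N.disks)
    (hN : ∀ d ∈ N.disks, (d ∈ L.disks ∧ d ∉ M.disks) ∨ (d ∉ L.disks ∧ d ∈ M.disks))
    (hLN' : L ≤ N) (hMN' : M ≤ N) (hNU : N.support ≤ U) (a : ℂ × ℝ → A) :
    mulBilin hd h (inc L le_rfl (TPow.tprod fun d => a d.1))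
      (inc M le_rfl (TPow.tprod fun d => a d.1)) = inc N hNU (TPow.tprod fun d => a d.1) := by
  classical
  -- A disk of `K` is its own parent in `N`. The fibre over `e` is therefore `{e}` or empty, and an
  -- empty fibre contributes the factor `1`.
  have hfiber : ∀ (K : DiskConfig) (hKN : K.disks ⊆ N.disks) (hKN' : K ≤ N) (e : N.disks),
      ∏ d with parent hKN' d = e, a d.1 = if e.1 ∈ K.disks then a e.1 else 1 := by
    intro K hKN hKN' e
    have hp : ∀ d : K.disks, parent hKN' d = e ↔ d.1 = e.1 := fun d => by
      rw [← parent_val hKN' d (hKN d.2)]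
      exact ⟨congrArg _, Subtype.ext⟩
    split_ifs with he
    · rw [Finset.prod_eq_single ⟨e.1, he⟩]
      · intro d hd hne
        exact absurd (Subtype.ext ((hp d).1 (Finset.mem_filter.1 hd).2)) hne
      · intro hne
        refine absurd (Finset.mem_filter.2 ⟨Finset.mem_univ _, ?_⟩) hne
        exact (hp ⟨e.1, he⟩).2 rfl
    · refine Finset.prod_eq_one fun d hd => ?_
      have := (hp d).1 (Finset.mem_filter.1 hd).2
      exact absurd (this ▸ d.2) he
  rw [mulBilin_inc' hd h le_rfl le_rfl hLN' hMN' hNU, ext, ext, TPow.push_tprod,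
    TPow.push_tprod, TPow.tprod_mul]
  refine congrArg _ (congrArg _ (funext fun e => ?_))
  refine (congrArg₂ (· * ·) (hfiber L hLN hLN' e) (hfiber M hMN hMN' e)).trans ?_
  rcases hN e.1 e.2 with ⟨h₁, h₂⟩ | ⟨h₁, h₂⟩
  · simp only [if_pos h₁, if_neg h₂, mul_one]
  · simp only [if_neg h₁, if_pos h₂, _root_.one_mul]

/-- The components of a morphism `F_A → F_B`. -/
def component (φ : EquivPFA.Hom A.toPFA B.toPFA) (U : Opens ℂ) : A.Colim U →L[ℂ] B.Colim U :=
  φ.app U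

section

variable (φ ψ : EquivPFA.Hom A.toPFA B.toPFA)

theorem component_res (h : U ≤ V) (x : A.Colim U) :
    component φ V (res h x) = res h (component φ U x) := (φ.app_res h x).symm

theorem component_mulBilin (hd : Disjoint U V) (h : U ⊔ V ≤ W) (x : A.Colim U) (y : A.Colim V) :
    component φ W (mulBilin hd h x y) = mulBilin hd h (component φ U x) (component φ V y) :=
  (congrArg (φ.app W) (mulL_tmul hd h x y).symm).trans
    ((φ.app_mul hd h x y).trans (mulL_tmul hd h (φ.app U x) (φ.app V y)))

theorem component_move (g : Motion) (x : A.Colim U) :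
    component φ (g.actOn U) (Colim.move g U x) = Colim.move g U (component φ U x) :=
  (φ.app_σ g U x).symm

theorem component_one : component φ ⊥ (inc empty (empty_le ⊥) 1) = inc empty (empty_le ⊥) 1 :=
  φ.app_one

theorem component_toPFAHom (f : MotionAlg.Hom A B) (x : A.Colim U) :
    component (toPFAHom f) U x = Colim.map f U x := rfl

/-- A pure tensor over `insert d s` is the product of one over `s` and one over the single disk `d`.
Both morphisms are multiplicative, and on a single disk `aug` is injective; the empty configuration
is handled by the unit. The disks are given as a finite set, and `a` on all pairs, so that induction
on `s` can run. -/
theorem component_eq (h : ∀ (U : Opens ℂ) x, aug U (component φ U x) = aug U (component ψ U x))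
    (s : Finset (ℂ × ℝ)) (hs : ∀ d ∈ s, 0 < d.2)
    (hd : ∀ d ∈ s, ∀ e ∈ s, d ≠ e → Disjoint (ball d.1 d.2) (ball e.1 e.2)) (U : Opens ℂ)
    (hU : DiskConfig.support ⟨s, hs, hd⟩ ≤ U) (a : ℂ × ℝ → A) :
    component φ U (inc ⟨s, hs, hd⟩ hU (TPow.tprod fun d : s => a d)) =
      component ψ U (inc ⟨s, hs, hd⟩ hU (TPow.tprod fun d : s => a d)) := by
  classical
  induction s using Finset.induction_on generalizing U with
  | empty =>
    have hone : (inc ⟨∅, hs, hd⟩ hU (TPow.tprod fun d : (∅ : Finset (ℂ × ℝ)) => a d) :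
        A.Colim U) = res bot_le (inc empty (empty_le ⊥) 1) := by
      rw [res_inc, ← TPow.tprod_one]
      have : (fun d : (∅ : Finset (ℂ × ℝ)) => a d) = 1 :=
        funext fun d => absurd d.2 (Finset.notMem_empty _)
      rw [this]
      rfl
    rw [hone, component_res, component_res, component_one, component_one]
  | insert d s hds ih =>
    let L : DiskConfig := ⟨s, fun e he => hs e (Finset.mem_insert_of_mem he),
      fun e he e' he' => hd e (Finset.mem_insert_of_mem he) e' (Finset.mem_insert_of_mem he')⟩
    let N : DiskConfig := ⟨insert d s, hs, hd⟩
    have hr : 0 < d.2 := hs d (Finset.mem_insert_self d s)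
    let M : DiskConfig := single d.1 d.2 hr
    have hLN : L ≤ N := fun w hw => by
      obtain ⟨e, he, hwe⟩ := mem_support.1 hw
      exact mem_support.2 ⟨e, Finset.mem_insert_of_mem he, hwe⟩
    have hMN : M ≤ N := fun w hw =>
      mem_support.2 ⟨d, Finset.mem_insert_self d s, (mem_support_single hr).1 hw⟩
    have hLM : Disjoint L.support M.support := by
      rw [← Opens.coe_disjoint, Set.disjoint_left]
      intro w hw hw'
      obtain ⟨e, he, hwe⟩ := mem_support.1 hw
      refine Set.disjoint_left.1 (hd e (Finset.mem_insert_of_mem he) d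
        (Finset.mem_insert_self d s) fun h => hds (h ▸ he)) hwe ?_
      exact (mem_support_single hr).1 hw'
    have hsup : L.support ⊔ M.support ≤ U := sup_le (le_trans hLN hU) (le_trans hMN hU)
    have hcase : ∀ e ∈ N.disks, (e ∈ L.disks ∧ e ∉ M.disks) ∨ (e ∉ L.disks ∧ e ∈ M.disks) := by
      intro e he
      rcases Finset.mem_insert.1 he with rfl | hes
      · exact Or.inr ⟨hds, Finset.mem_singleton_self _⟩
      · exact Or.inl ⟨hes, fun hM => hds ((show e = d from Finset.mem_singleton.1 hM) ▸ hes)⟩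
    have hxy := mulBilin_inc_tprod (A := A) hLM hsup (fun e he => Finset.mem_insert_of_mem he)
      (fun e he => Finset.mem_insert.2 (Or.inl (Finset.mem_singleton.1 he))) hcase hLN hMN hU a
    rw [← hxy, component_mulBilin, component_mulBilin]
    congr 1
    · exact congrArg _ (ih _ _ _ le_rfl)
    · exact (aug_bijective (isDiskLike_support_single hr)).1 (h _ _)

/-- Morphisms that agree after multiplication of all entries are equal. -/
theorem toPFA_hom_ext (h : ∀ (U : Opens ℂ) x, aug U (component φ U x) = aug U (component ψ U x)) :
    φ = ψ := by
  classical
  have key : ∀ (U : Opens ℂ) (x : A.Colim U), component φ U x = component ψ U x := by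
    intro U x
    induction x using Colim.induction with
    | h₁ x x' hx hx' => rw [map_add, map_add, hx, hx']
    | h₀ L hL x =>
      induction x using TPow.induction with
      | h₁ x x' hx hx' => rw [map_add, map_add, map_add, hx, hx']
      | h₂ c x hx => rw [map_smul, map_smul, map_smul, hx]
      | h₀ a =>
        -- The entries are extended to all pairs; the value `0` outside `L.disks` plays no role.
        have := component_eq φ ψ h L.disks L.radius_pos L.disjoint U hL
          fun d => if hd : d ∈ L.disks then a ⟨d, hd⟩ else 0
        simp only [Finset.coe_mem, dif_pos] at this
        exact this
  exact EquivPFA.Hom.ext (funext fun U => ContinuousLinearMap.ext (key U))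

/-- The linear map `A → B` that underlies a morphism `F_A → F_B`. -/
def algMap : A →ₗ[ℂ] B :=
  (aug ⊤).toLinearMap ∘ₗ (component φ ⊤).toLinearMap ∘ₗ pt ⊤ 0 isDiskLike_top.1

/-- Placing `aug U x` at the origin of the plane gives the image of `x` under the structure map to
the plane. Naturality then shows that the single map `algMap φ` governs `φ` on every open set. -/
theorem algMap_aug (U : Opens ℂ) (x : A.Colim U) :
    algMap φ (aug U x) = aug U (component φ U x) := by
  have h : pt ⊤ 0 isDiskLike_top.1 (aug U x) = res (A := A) (le_top : U ≤ ⊤) x := by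
    rw [← aug_res (le_top : U ≤ ⊤)]
    exact pt_aug isDiskLike_top _
  change aug ⊤ (component φ ⊤ (pt ⊤ 0 isDiskLike_top.1 (aug U x))) = _
  rw [h, component_res, aug_res]

/-- The product of `A` is the multiplication of `F_A` for two disjoint disks followed by `aug`. The
centers `0` and `3` keep the unit disks apart. -/
theorem algMap_mul (a b : A) : algMap φ (a * b) = algMap φ a * algMap φ b := by
  have hd : Disjoint (disk 0 1) (disk 3 1) := by
    rw [← Opens.coe_disjoint]
    exact ball_disjoint_ball (by norm_num)
  rw [← aug_pt 0 (isDiskLike_disk (z := 0) one_pos).1 a,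
    ← aug_pt 3 (isDiskLike_disk (z := 3) one_pos).1 b, ← aug_mulBilin hd le_top, algMap_aug,
    algMap_aug, algMap_aug, component_mulBilin, aug_mulBilin]

theorem algMap_one : algMap φ 1 = 1 := by
  have h : ∀ C : MotionAlg.{u}, aug (A := C) ⊥ (inc empty (empty_le ⊥) 1) = 1 := fun C => by
    rw [aug_inc, TPow.mulAll_one]
  rw [← h A, algMap_aug, component_one, h]

/-- The homomorphism `A → B` that underlies a morphism `F_A → F_B`. -/
def algHom : MotionAlg.Hom A B where
  hom := AlgHom.ofLinearMap (algMap φ) (algMap_one φ) (algMap_mul φ)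
  continuous_hom := (aug ⊤).continuous.comp
    ((component φ ⊤).continuous.comp (continuous_pt 0 isDiskLike_top.1))
  hom_θ g a := by
    change algMap φ (A.θ g a) = B.θ g (algMap φ a)
    rw [← aug_pt 0 isDiskLike_top.1 a, ← aug_move, algMap_aug, algMap_aug, ← aug_move,
      component_move]

theorem toPFAHom_algHom : toPFAHom (algHom φ) = φ :=
  toPFA_hom_ext _ _ fun U x => by
    rw [component_toPFAHom, aug_map]
    exact algMap_aug φ U x

end

/-- The homomorphism is recovered from the component at the plane by composing with `pt` and `aug`.
-/
theorem hom_eq_of_toPFAHom_eq {f g : MotionAlg.Hom A B} (h : toPFAHom f = toPFAHom g) :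
    f.hom = g.hom := by
  refine AlgHom.ext fun a => ?_
  have hx : Colim.map f ⊤ (pt ⊤ 0 isDiskLike_top.1 a) =
      Colim.map g ⊤ (pt ⊤ 0 isDiskLike_top.1 a) := by
    rw [← component_toPFAHom, ← component_toPFAHom, h]
  have := congrArg (aug ⊤) hx
  rwa [aug_map, aug_map, aug_pt] at this

end MotionAlg

end CFact

/-! ### Homomorphisms of completions act degree by degree -/

namespace CFact

namespace GrDiffAlg

open Completion

variable {D D' : GrDiffAlg.{u}}

theorem single_mul_single {i j : ℤ} (a : D.grade i) (b : D.grade j) :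
    single i a * single j b = single (i + j) ⟨a.1 * b.1, D.mul_mem a.2 b.2⟩ := by
  refine Completion.ext' fun Δ => ?_
  rw [coeff_mul, finsum_eq_single _ i, coeff_single, if_pos rfl, coeff_single, coeff_single]
  · by_cases h : Δ = i + j
    · rw [if_pos h, if_pos (by omega)]
    · rw [if_neg h, if_neg (by omega), mul_zero]
  · intro Δ' h
    rw [coeff_single, if_neg h, zero_mul]

theorem single_one : single 0 (⟨1, D.one_mem⟩ : D.grade 0) = 1 :=
  Completion.ext' fun Δ => by rw [coeff_single, coeff_one]

theorem rotMap_single (q : Circle) {i : ℤ} (a : D.grade i) :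
    rotMap q (single i a) = ((q : ℂ) ^ i) • single i a := by
  refine Completion.ext' fun Δ => ?_
  rw [coeff_rotMap, map_smul, coeff_single]
  split_ifs with h
  · rw [h]
  · rw [smul_zero, smul_zero]

/-- Only the linear term of the exponential raises the degree by exactly one, so `T` can be read off
from the translation by `1`. -/
theorem coeff_expMap_single {i : ℤ} (a : D.grade i) :
    coeff (i + 1) (expMap 1 (single i a)) = D.T a := by
  rw [coeff_expMap, finsum_eq_single _ 1, coeff_single, if_pos (by push_cast; ring)]
  · simp
  · intro n hn
    rw [coeff_single, if_neg, map_zero, smul_zero]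
    intro h
    apply hn
    omega

/-- In the product topology it suffices that each component of the partial sums is eventually
constant. -/
theorem hasSum_single (a : D.Completion) : HasSum (fun i => single i (a i)) a := by
  refine tendsto_pi_nhds.2 fun Δ => ?_
  refine tendsto_const_nhds.congr' ?_
  filter_upwards [Filter.eventually_ge_atTop ({Δ} : Finset ℤ)] with s hs
  have h : coeff Δ (∑ i ∈ s, single i (a i)) = coeff Δ a := by
    rw [map_sum, Finset.sum_eq_single Δ]
    · rw [coeff_single, if_pos rfl]; rfl
    · intro j _ hj
      rw [coeff_single, if_neg hj.symm]
    · intro h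
      exact absurd (hs (Finset.mem_singleton_self Δ)) h
  exact (Subtype.ext h).symm

theorem hom_ext_of_grade {E : Type*} [AddCommGroup E] [Module ℂ E] {f g : D →ₗ[ℂ] E}
    (h : ∀ (i : ℤ) (a : D.grade i), f a = g a) : f = g := by
  refine LinearMap.ext fun a => ?_
  have ha : a ∈ ⨆ i, D.grade i := by rw [D.isInternal.submodule_iSup_eq_top]; trivial
  induction ha using Submodule.iSup_induction' with
  | mem i a ha => exact h i ⟨a, ha⟩
  | zero => rw [map_zero, map_zero]
  | add a b _ _ ha hb => rw [map_add, map_add, ha, hb]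

section

variable (H : D.Completion →ₗ[ℂ] D'.Completion)

/-- The linear map that is given by the diagonal components of a map of completions. -/
def diagonal : D →ₗ[ℂ] D' :=
  DirectSum.toModule ℂ ℤ D' (fun i => coeff i ∘ₗ H ∘ₗ single i) ∘ₗ
    (LinearEquiv.ofBijective (DirectSum.coeLinearMap D.grade) D.isInternal).symm.toLinearMap

theorem diagonal_apply (i : ℤ) (a : D.grade i) : diagonal H a = coeff i (H (single i a)) := by
  have h : (LinearEquiv.ofBijective (DirectSum.coeLinearMap D.grade) D.isInternal).symm (a : D) =
      DirectSum.lof ℂ ℤ (fun i => D.grade i) i a := by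
    rw [LinearEquiv.symm_apply_eq]
    exact (DirectSum.coeLinearMap_lof D.grade i a).symm
  rw [diagonal, LinearMap.comp_apply, LinearEquiv.coe_coe, h, DirectSum.toModule_lof]
  rfl

theorem diagonal_mem (i : ℤ) (a : D.grade i) : diagonal H a ∈ D'.grade i := by
  rw [diagonal_apply]; exact coeff_mem _ _

variable {H}

/-- `single i a` is a vector of weight `i`, hence so is its image, and weight vectors are
concentrated in their degree. -/
theorem map_single (hrot : ∀ q a, H (rotMap q a) = rotMap q (H a)) (i : ℤ) (a : D.grade i) :
    H (single i a) = single i ⟨diagonal H a, diagonal_mem H i a⟩ := by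
  refine Completion.ext' fun Δ => ?_
  rw [coeff_single]
  split_ifs with h
  · subst h
    exact (diagonal_apply H Δ a).symm
  · exact coeff_eq_zero_of_rotMap (fun q => by rw [← hrot, rotMap_single, map_smul]) h

/-- Every element is the convergent sum of its homogeneous parts, and on those `H` is diagonal by
`map_single`. Continuity of `H` and uniqueness of limits extend this to the completion. -/
theorem coeff_map (hc : Continuous H) (hrot : ∀ q a, H (rotMap q a) = rotMap q (H a)) (Δ : ℤ)
    (a : D.Completion) : coeff Δ (H a) = diagonal H (coeff Δ a) := by
  have h := (hasSum_single a).map H hc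
  have hT : T2Space D'.Completion := (coordEquiv D').toHomeomorph.symm.t2Space
  have h' : HasSum (fun i => H (single i (a i))) (Completion.mk (fun Δ => diagonal H (coeff Δ a))
      fun Δ => diagonal_mem H Δ (a Δ)) := by
    have := hasSum_single (Completion.mk (D := D') (fun Δ => diagonal H (coeff Δ a))
      fun Δ => diagonal_mem H Δ (a Δ))
    refine this.congr_fun fun i => ?_
    exact map_single hrot i (a i)
  exact congrArg (coeff Δ) (h.unique h')

theorem diagonal_mul (hrot : ∀ q a, H (rotMap q a) = rotMap q (H a))
    (hmul : ∀ a b, H (a * b) = H a * H b) (a b : D) :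
    diagonal H (a * b) = diagonal H a * diagonal H b := by
  have h : (LinearMap.mul ℂ D).compr₂ (diagonal H) =
      (LinearMap.mul ℂ D').compl₁₂ (diagonal H) (diagonal H) := by
    refine hom_ext_of_grade fun i a => hom_ext_of_grade fun j b => ?_
    have h := congrArg H (single_mul_single a b)
    rw [hmul, map_single hrot, map_single hrot, map_single hrot, single_mul_single] at h
    have := congrArg (coeff (i + j)) h
    rw [coeff_single, coeff_single, if_pos rfl, if_pos rfl] at this
    exact this.symm
  exact LinearMap.congr_fun₂ h a b

theorem diagonal_one (hrot : ∀ q a, H (rotMap q a) = rotMap q (H a)) (hone : H 1 = 1) :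
    diagonal H 1 = 1 := by
  have h := map_single hrot 0 (⟨1, D.one_mem⟩ : D.grade 0)
  rw [single_one, hone, ← single_one] at h
  have := congrArg (coeff 0) h
  rw [coeff_single, coeff_single, if_pos rfl, if_pos rfl] at this
  exact this.symm

/-- For `a` of degree `i`, compare the components of degree `i + 1` in `H (e^T a) = e^T (H a)`. -/
theorem diagonal_T (hc : Continuous H) (hrot : ∀ q a, H (rotMap q a) = rotMap q (H a))
    (hexp : ∀ z a, H (expMap z a) = expMap z (H a)) (a : D) :
    diagonal H (D.T a) = D'.T (diagonal H a) := by
  have h : diagonal H ∘ₗ D.T = D'.T ∘ₗ diagonal H := by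
    refine hom_ext_of_grade fun i a => ?_
    have h := congrArg (coeff (i + 1)) (hexp 1 (single i a))
    rw [coeff_map hc hrot, coeff_expMap_single, map_single hrot, coeff_expMap_single] at h
    exact h
  exact LinearMap.congr_fun h a

end

end GrDiffAlg

/-! ### Recovering all products from the differential algebra -/

namespace VertexAlgebra

variable {V W : Type*} [AddCommGroup V] [Module ℂ V] [AddCommGroup W] [Module ℂ W]
  {A : VertexAlgebra V} {B : VertexAlgebra W}

/-- Write `b` as `b₍₋₁₎|0⟩` and interchange the modes. All products are thereby reduced to the
`(-1)`-product and the action of modes on the vacuum. -/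
theorem IsCommutative.mode_eq (h : A.IsCommutative) (a b : V) (n : ℤ) :
    A.mode a n b = A.mode b (-1) (A.mode a n A.vac) := by
  conv_lhs => rw [← mode_neg_one_vac (A := A) b, h]

theorem T_mode_vac (a : V) (n : ℤ) :
    A.T (A.mode a n A.vac) = (-n : ℂ) • A.mode a (n - 1) A.vac := by
  rw [T_mode, A.T_vac, map_zero, zero_add]

/-- A homomorphism of the underlying differential algebras preserves all products. -/
theorem IsCommutative.map_mode (hA : A.IsCommutative) (hB : B.IsCommutative) (f : V →ₗ[ℂ] W)
    (hvac : f A.vac = B.vac) (hT : ∀ a, f (A.T a) = B.T (f a))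
    (hmul : ∀ a b, f (A.mode a (-1) b) = B.mode (f a) (-1) (f b)) (a : V) (n : ℤ) (b : V) :
    f (A.mode a n b) = B.mode (f a) n (f b) := by
  -- Applying `T` to `a₍₋₁₋ₖ₎|0⟩` gives `(k + 1) a₍₋₂₋ₖ₎|0⟩`. Since `k + 1 ≠ 0`, these vectors are
  -- determined recursively by `a` and `T`.
  have key : ∀ k : ℕ, f (A.mode a (-1 - k) A.vac) = B.mode (f a) (-1 - k) B.vac := by
    intro k
    induction k with
    | zero =>
      simp only [Nat.cast_zero, sub_zero]
      rw [hmul, hvac]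
    | succ k ih =>
      have hk : (-((-1 - k : ℤ) : ℂ)) ≠ 0 := by
        push_cast
        have : ((k + 1 : ℕ) : ℂ) ≠ 0 := Nat.cast_ne_zero.2 k.succ_ne_zero
        push_cast at this
        intro h
        apply this
        linear_combination h
      have e : (-1 - ((k + 1 : ℕ) : ℤ)) = -1 - k - 1 := by push_cast; ring
      have h₁ := congrArg f (T_mode_vac (A := A) a (-1 - k))
      rw [hT, ih, T_mode_vac, map_smul] at h₁
      rw [e]
      exact (smul_right_injective W hk h₁).symm
  rw [hA.mode_eq, hB.mode_eq, hmul]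
  congr 1
  -- Negative modes have the form `-1 - k` and are covered by `key`; the others annihilate the
  -- vacuum.
  rcases lt_or_ge n 0 with hn | hn
  · have e : n = -1 - ((-1 - n).toNat : ℤ) := by omega
    rw [e]
    exact key _
  · exact (congrArg f (A.Y_apply_vac a n hn)).trans
      ((map_zero f).trans (B.Y_apply_vac (f a) n hn).symm)

end VertexAlgebra

/-! ### Full faithfulness of the completion and of the functor -/

namespace GrComVA

open GrDiffAlg Completion

variable {V W : GrComVA.{u}}

/-- The morphism of vertex algebras that underlies a morphism of completions. -/
def ofBarHom (h : MotionAlg.Hom V.bar W.bar) : V ⟶ W :=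
  let H : V.toDiffAlg.Completion →ₗ[ℂ] W.toDiffAlg.Completion := h.hom.toLinearMap
  have hrot : ∀ q a, H (rotMap q a) = rotMap q (H a) := fun q a =>
    (congrArg H (θ_rotation q a).symm).trans ((h.hom_θ _ a).trans (θ_rotation q (H a)))
  have hexp : ∀ z a, H (expMap z a) = expMap z (H a) := fun z a =>
    (congrArg H (θ_translation z a).symm).trans ((h.hom_θ _ a).trans (θ_translation z (H a)))
  let f : V →ₗ[ℂ] W :=
    { toFun := diagonal H
      map_add' := (diagonal H).map_add
      map_smul' := (diagonal H).map_smul }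
  have hvac : f V.va.vac = W.va.vac := diagonal_one hrot (map_one h.hom)
  have hT : ∀ a, f (V.va.T a) = W.va.T (f a) := diagonal_T h.continuous_hom hrot hexp
  ({ toLinearMap := f
     map_vac := hvac
     map_T := hT
     map_mode := V.commutative.map_mode W.commutative f hvac hT (diagonal_mul hrot (map_mul h.hom))
     map_grade := fun i a ha => diagonal_mem H i ⟨a, ha⟩ } : Hom V W)

/-- By `coeff_map`, a continuous rotation-equivariant map is the completion of its diagonal part. -/
theorem barHom_ofBarHom (h : MotionAlg.Hom V.bar W.bar) : barHom (ofBarHom h) = h := by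
  let H : V.toDiffAlg.Completion →ₗ[ℂ] W.toDiffAlg.Completion := h.hom.toLinearMap
  have hrot : ∀ q a, H (rotMap q a) = rotMap q (H a) := fun q a =>
    (congrArg H (θ_rotation q a).symm).trans ((h.hom_θ _ a).trans (θ_rotation q (H a)))
  refine MotionAlg.Hom.ext (AlgHom.ext fun a => ?_)
  exact Completion.ext' fun Δ => (coeff_map (H := H) h.continuous_hom hrot Δ a).symm

/-- On elements concentrated in one degree the completed map returns the original one, and the
graded pieces span `V`. -/
theorem barHom_injective {f g : V ⟶ W} (h : (barHom f).hom = (barHom g).hom) : f = g := by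
  refine Hom.ext (LinearMap.ext fun a => ?_)
  have hd : diffMap f = diffMap g := by
    refine hom_ext_of_grade fun i a => ?_
    have := congrArg (coeff i) (show barMap f (single i a) = barMap g (single i a) from
      AlgHom.congr_fun h (single i a))
    rwa [coeff_barMap, coeff_barMap, coeff_single, if_pos rfl] at this
  exact LinearMap.congr_fun hd a

end GrComVA

theorem isLocHolFA_Floc (V : GrComVA.{u}) : EquivPFA.IsLocHolFA (Floc.obj V) :=
  ⟨V.bar.isFactorizationAlgebra_toPFA, V.bar.isLocallyConstant_toPFA,
    V.toDiffAlg.isHolomorphic_toPFA⟩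

instance : Floc.{u}.Faithful where
  map_injective h := GrComVA.barHom_injective (MotionAlg.hom_eq_of_toPFAHom_eq h)

instance : Floc.{u}.Full where
  map_surjective {V W} φ := ⟨GrComVA.ofBarHom (MotionAlg.algHom φ), by
    change MotionAlg.toPFAHom (GrComVA.barHom _) = φ
    rw [GrComVA.barHom_ofBarHom]
    exact MotionAlg.toPFAHom_algHom φ⟩

end CFact

end

/-- The functor `V ↦ F_V̄` takes values in the full subcategory of locally constant holomorphic
factorization algebras, and as a functor to this subcategory it is full and faithful. -/
theorem mainTheorem9 :
    ∃ h : ∀ V : CFact.GrComVA.{u}, CFact.EquivPFA.IsLocHolFA (CFact.Floc.obj V),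
      (CFact.EquivPFA.IsLocHolFA.lift CFact.Floc h).Full ∧
        (CFact.EquivPFA.IsLocHolFA.lift CFact.Floc h).Faithful := by
  exact ⟨CFact.isLocHolFA_Floc, inferInstance, inferInstance⟩
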